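/- **Setting.** Let $O\subset\mathbb R^2$ be the regular octagon centred at the origin with horizontal and vertical sides, and $S_O$ the translation surface obtained by gluing opposite sides by translations; the vertices give its only singular point. The pairs of opposite sides are labelled: $A$ (horizontal), $B$ (upper right/lower left), $C$ (vertical), $D$ (lower right/upper left). A trajectory $\tau$ in direction $\theta$ is a bi-infinite unit speed straight line $\tau:\mathbb R\to S_O$ with velocity $(\cos\theta,\sin\theta)$ that avoids the singular point. An affine automorphism $\Psi$ of $S_O$ is a homeomorphism that preserves the singular point and is affine, with constant derivative $D\Psi\in GL(2,\mathbb R)$, in translation charts elsewhere; the Veech group $V(S_O)$ is the group of the derivatives. The cutting sequence of $\tau$ with respect to the sides of $\Psi O$ is the bi-infinite word (defined up to shift) of the labels of the sides of $\Psi O$ crossed by $\tau$ in order of increasing time, where a side of $\Psi O$ has the label of the side of $O$ of which it is the image under $\Psi$. The cutting sequence $c(\tau)$ is the one with respect to $O$ ($\Psi=\mathrm{id}$). **Combinatorial renormalization.** Let $\pi_0,\dots,\pi_7$ be the permutations $\mathrm{id},(AD)(BC),(ABCD),(AC),(AC)(BD),(AB)(CD),(ADCB),(BD)$. The diagram $\mathscr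 D_0$ is the chain $A\rightleftarrows D\rightleftarrows B\rightleftarrows C$ with a loop at $C$, and $X\to Y$ is an edge of $\mathscr D_j$ iff $\pi_j X\to\pi_j Y$ is an edge of $\mathscr D_0$. A bi-infinite word is admissible in $\mathscr D_j$ if all its pairs of consecutive letters are edges of $\mathscr D_j$. The derived sequence $u'$ of a word $u$ is the sequence of those letters of $u$ that are preceded and followed by the same letter. Put $w_0=w$; if $w_k$ is admissible in a unique diagram $\mathscr D_d$, put $w_{k+1}=(\pi_d\cdot w_k)'$, provided that this is again a bi-infinite word. **Normalized Teichmüller cutting sequence.** For $j=0,\dots,7$ let $\nu_j\in O(2)$ be $$\begin{pmatrix}1&0\\0&1\end{pmatrix},\ \tfrac1{\sqrt2}\begin{pmatrix}1&1\\1&-1\end{pmatrix},\ \tfrac1{\sqrt2}\begin{pmatrix}1&1\\-1&1\end{pmatrix},\ \begin{pmatrix}0&1\\1&0\end{pmatrix},\ \begin{pmatrix}0&1\\-1&0\end{pmatrix},\ \tfrac1{\sqrt2}\begin{pmatrix}-1&1\\1&1\end{pmatrix},\ \tfrac1{\sqrt2}\begin{pmatrix}-1&1\\-1&-1\end{pmatrix},\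 \begin{pmatrix}-1&0\\0&1\end{pmatrix},$$ and let $\gamma=\begin{pmatrix}-1&2(1+\sqrt2)\\0&1\end{pmatrix}$. A matrix $\begin{pmatrix}a&b\\c&d\end{pmatrix}$ acts on the right on the upper half plane $\mathbb H$ by $z\mapsto\frac{az+c}{bz+d}$ if its determinant is positive and by $z\mapsto\frac{a\bar z+c}{b\bar z+d}$ if it is negative. Let $\mathscr F$ be the hyperbolic triangle with vertices $i$, $0$, $1-\sqrt2$ (the last two ideal), let $\mathscr O=\bigcup_j\mathscr F\nu_j$, an ideal octagon, let $E_0$ be the side of $\mathscr O$ fixed by $\gamma$, and let $E_j=E_0\nu_j$; the images of $\mathscr O$ under $V(S_O)$ are the tiles of the ideal octagon tessellation. Let $r_\theta$ be the geodesic ray $t\mapsto i\cdot g^\theta_t$, $t\ge0$, where $g_t^\theta=\rho^{-1}\,\mathrm{diag}(e^{t/2},e^{-t/2})\,\rho$ and $\rho$ is the counterclockwise rotation by $\pi/2-\theta$. Its normalized Teichmüller cutting sequence $s_0,s_1,\dots$ is defined as follows: the ray leaves $\mathscr O$ through $E_{s_0}$; and if, for $k\ge1$, the $k$-th tile that the ray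 enters is $\mathscr O'$, entered through the side $E'$ and left through the side $E''$, and $\nu'\in V(S_O)$ sends $\mathscr O'$ to $\mathscr O$ and $E'$ to $E_0$, then $\nu'$ sends $E''$ to $E_{s_k}$. **Statement.** Let $w=c(\tau)$ be the cutting sequence of a trajectory $\tau$ in direction $\theta$, and assume that $w$ is not periodic. Then $r_\theta$ has an infinite normalized Teichmüller cutting sequence $s_0,s_1,\dots$, and for every $k\ge0$ the word $w_k$ is well defined (up to shift), there is a unique affine automorphism $\Psi_{\nu(k)}$ of $S_O$ with derivative $$\nu(k)=\nu_{s_0}^{-1}\gamma\,\nu_{s_1}^{-1}\gamma\cdots\nu_{s_{k-1}}^{-1}\gamma ,$$ and $w_k$ is the cutting sequence of the same trajectory $\tau$ with respect to the sides of $\Psi_{\nu(k)}O$ with the labelling induced by $\Psi_{\nu(k)}$. -/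

import Mathlib

open Real

noncomputable section

namespace Octagon

/-! ## The translation surface of the regular octagon -/

/-- The labels of the four pairs of opposite sides of the octagon. -/
inductive Letter
  | A
  | B
  | C
  | D

/-- The unit normal of one of the two opposite sides labelled by the letter: `A` labels the
horizontal sides, `C` the vertical sides, `B` the upper right and lower left sides, `D` the lower
right and upper left sides. -/
def normal : Letter → (Fin 2 → ℝ)
  | .A => ![0, 1]
  | .B => ![1 / √2, 1 / √2]
  | .C => ![1, 0]
  | .D => ![1 / √2, -(1 / √2)]

/-- The coordinate of `p` along the normal to the sides labelled `X`. -/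
def height (X : Letter) (p : Fin 2 → ℝ) : ℝ := normal X ⬝ᵥ p

/-- The closed regular octagon centred at the origin, with horizontal and vertical sides
(and inscribed circle of radius one). -/
def octagon : Set (Fin 2 → ℝ) := {p | ∀ X, |height X p| ≤ 1}

/-- A point of a side is glued to the point of the opposite side to which it is carried by the
translation between the two sides. -/
def glue (p q : octagon) : Prop :=
  ∃ X, height X p.1 = 1 ∧ q.1 = p.1 - (2 : ℝ) • normal X

/-- The surface `S_O`, with the quotient topology. -/
abbrev Surface : Type := Quot glue

/-- The projection of the octagon to the surface. -/
def proj (p : octagon) : Surface := Quot.mk glue p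

/-- The set of singular points: the image of the vertices of the octagon. -/
def singularSet : Set Surface :=
  {x | ∃ p : octagon, proj p = x ∧ ∃ X Y, X ≠ Y ∧ |height X p.1| = 1 ∧ |height Y p.1| = 1}

/-- The image in the surface of the pair of opposite sides of the octagon labelled `X`. -/
def side (X : Letter) : Set Surface :=
  {x | ∃ p : octagon, proj p = x ∧ |height X p.1| = 1}

/-- `Displaced x u y`: the point `y` is reached from `x` by the translation by `u` inside the
octagon.  For `x` not singular and `u` small this determines `y`, and
`u ↦ y` is then the translation chart of the surface at `x`. -/
def Displaced (x : Surface) (u : Fin 2 → ℝ) (y : Surface) : Prop :=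
  ∃ p q : octagon, proj p = x ∧ proj q = y ∧ q.1 = p.1 + u

/-- A bi-infinite linear trajectory in direction `θ`: it avoids the singular point and, in
translation charts, it moves with velocity `(cos θ, sin θ)`. -/
def IsTrajectory (θ : ℝ) (τ : ℝ → Surface) : Prop :=
  (∀ t, τ t ∉ singularSet) ∧
  ∀ t, ∃ ε > 0, ∀ r : ℝ, |r| < ε → Displaced (τ t) (r • ![cos θ, sin θ]) (τ (t + r))

/-- `Ψ` is an affine automorphism of the surface with derivative `M`: a homeomorphism preserving
the set of singular points which, in translation charts at every other point, is affine with
linear part `M`. -/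
def IsAffineAutomorphism (Ψ : Surface ≃ₜ Surface) (M : GL (Fin 2) ℝ) : Prop :=
  Ψ '' singularSet = singularSet ∧
  ∀ x, x ∉ singularSet → ∃ ε > 0, ∀ u : Fin 2 → ℝ, ‖u‖ < ε → ∀ y,
    Displaced x u y → Displaced (Ψ x) (M.1.mulVec u) (Ψ y)

/-- The Veech group of the surface: the derivatives of its affine automorphisms. -/
def veechGroup : Set (GL (Fin 2) ℝ) := {M | ∃ Ψ, IsAffineAutomorphism Ψ M}

/-! ## Words, cutting sequences and the combinatorial renormalization -/

/-- Bi-infinite words. -/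
abbrev Word : Type := ℤ → Letter

/-- `w` is the cutting sequence of `τ` with respect to the sides of the image `Ψ O` of the
octagon, a side of `Ψ O` carrying the label of the side of `O` of which it is the image under `Ψ`.
The increasing enumeration `t` of the crossing times is unique up to a shift of
the index, and so is the word `w`. -/
def IsCuttingSequenceWrt (Ψ : Surface ≃ₜ Surface) (τ : ℝ → Surface) (w : Word) : Prop :=
  ∃ t : ℤ → ℝ, StrictMono t ∧ Set.range t = {r | ∃ X, τ r ∈ Ψ '' side X} ∧
    ∀ n, τ (t n) ∈ Ψ '' side (w n)

/-- `w` is the cutting sequence `c(τ)`, with respect to the sides of the octagon itself. -/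
def IsCuttingSequence (τ : ℝ → Surface) (w : Word) : Prop :=
  IsCuttingSequenceWrt (Homeomorph.refl Surface) τ w

/-- Periodic bi-infinite words. -/
def IsPeriodic (w : Word) : Prop := ∃ p : ℤ, 0 < p ∧ ∀ n, w (n + p) = w n

/-- The map of letters given by the list of the images of `A`, `B`, `C`, `D`. -/
def letterMap (a b c d : Letter) : Letter → Letter
  | .A => a
  | .B => b
  | .C => c
  | .D => d

/-- The permutations `π₀ = id`, `π₁ = (AD)(BC)`, `π₂ = (ABCD)`, `π₃ = (AC)`, `π₄ = (AC)(BD)`,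
`π₅ = (AB)(CD)`, `π₆ = (ADCB)`, `π₇ = (BD)`. -/
def perm : Fin 8 → Letter → Letter :=
  ![letterMap .A .B .C .D, letterMap .D .C .B .A, letterMap .B .C .D .A, letterMap .C .B .A .D,
    letterMap .C .D .A .B, letterMap .B .A .D .C, letterMap .D .A .B .C, letterMap .A .D .C .B]

/-- The edges of the transition diagram `𝒟₀`, which are the transitions of the trajectories
in the directions of `[0, π/8]`: the chain `A ⇄ D ⇄ B ⇄ C` with a loop at `C`. -/
def edge₀ : Letter → Letter → Prop
  | .A, .D => True
  | .D, .A => True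
  | .D, .B => True
  | .B, .D => True
  | .B, .C => True
  | .C, .B => True
  | .C, .C => True
  | _, _ => False

/-- The edges of the transition diagram `𝒟ⱼ`, of the directions of `[jπ/8, (j+1)π/8]`: this is
`𝒟₀` relabelled by `πⱼ⁻¹`. -/
def edge (j : Fin 8) (X Y : Letter) : Prop := edge₀ (perm j X) (perm j Y)

/-- The word `w` is admissible in diagram `j`. -/
def Admissible (j : Fin 8) (w : Word) : Prop := ∀ n, edge j (w n) (w (n + 1))

/-- `w'` is the derived sequence of `w`: the bi-infinite word of the sandwiched letters of `w`
(those preceded and followed by the same letter), in their order.  As for all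
bi-infinite words here, the choice of the origin is immaterial. -/
def IsDerived (w w' : Word) : Prop :=
  ∃ i : ℤ → ℤ, StrictMono i ∧ Set.range i = {n | w (n - 1) = w (n + 1)} ∧ ∀ n, w' n = w (i n)

/-- `IsRenormalized w k u`: the combinatorial renormalization scheme started at `w` can be carried
out `k` times, and `u` is the word `w_k` that it produces.  One step requires that the
current word be admissible in a unique diagram `d`, and takes the derived sequence of
the normal form, which is the word permuted by `π_d`. -/
inductive IsRenormalized (w : Word) : ℕ → Word → Prop
  | zero : IsRenormalized w 0 w
  | succ {k : ℕ} {u u' : Word} {d : Fin 8} (h : IsRenormalized w k u) (hd : Admissible d u)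
      (hu : ∀ e, Admissible e u → e = d) (hder : IsDerived (fun n => perm d (u n)) u') :
      IsRenormalized w (k + 1) u'

/-! ## The matrices -/

/-- The matrices of the isometries `ν_j` of the octagon, `ν_j` taking the sector
`[jπ/8, (j+1)π/8]` of lines to `[0, π/8]`. -/
def nuMatrix : Fin 8 → Matrix (Fin 2) (Fin 2) ℝ :=
  ![!![1, 0; 0, 1],
    !![1 / √2, 1 / √2; 1 / √2, -(1 / √2)],
    !![1 / √2, 1 / √2; -(1 / √2), 1 / √2],
    !![0, 1; 1, 0],
    !![0, 1; -1, 0],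
    !![-(1 / √2), 1 / √2; 1 / √2, 1 / √2],
    !![-(1 / √2), 1 / √2; -(1 / √2), -(1 / √2)],
    !![-1, 0; 0, 1]]

theorem nuMatrix_det_ne_zero (j : Fin 8) : (nuMatrix j).det ≠ 0 := by
  have h : (√2)⁻¹ * (√2)⁻¹ = (1 / 2 : ℝ) := by
    rw [← mul_inv, Real.mul_self_sqrt (by norm_num)]; norm_num
  fin_cases j <;> simp [nuMatrix, Matrix.det_fin_two] <;> nlinarith [h]

/-- The isometry `ν_j`. -/
def nu (j : Fin 8) : GL (Fin 2) ℝ :=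
  Matrix.GeneralLinearGroup.mkOfDetNeZero (nuMatrix j) (nuMatrix_det_ne_zero j)

/-- The matrix `γ`. -/
def gam : GL (Fin 2) ℝ :=
  Matrix.GeneralLinearGroup.mkOfDetNeZero !![-1, 2 * (1 + √2); 0, 1]
    (by simp [Matrix.det_fin_two])

/-- The counterclockwise rotation by the angle `φ`. -/
def rot (φ : ℝ) : GL (Fin 2) ℝ :=
  Matrix.GeneralLinearGroup.mkOfDetNeZero !![cos φ, -sin φ; sin φ, cos φ]
    (by simp [Matrix.det_fin_two, ← sq])

/-- The diagonal matrix `g_t` of the Teichmüller geodesic flow. -/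
def teich (t : ℝ) : GL (Fin 2) ℝ :=
  Matrix.GeneralLinearGroup.mkOfDetNeZero !![exp (t / 2), 0; 0, exp (-t / 2)]
    (by simp [Matrix.det_fin_two, exp_ne_zero])

/-- The transpose of an invertible matrix. -/
def transposeGL (M : GL (Fin 2) ℝ) : GL (Fin 2) ℝ :=
  Matrix.GeneralLinearGroup.mkOfDetNeZero M.1.transpose
    (by rw [Matrix.det_transpose]; exact M.det.ne_zero)

/-- `ν(k) = ν_{s₀}⁻¹ γ ν_{s₁}⁻¹ γ ⋯ ν_{s_{k-1}}⁻¹ γ`. -/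
def nuProd (s : ℕ → Fin 8) : ℕ → GL (Fin 2) ℝ
  | 0 => 1
  | k + 1 => nuProd s k * ((nu (s k))⁻¹ * gam)

/-! ## The Teichmüller disk, as the upper half plane, and its tessellation -/

/-- The right action of `M = (a b; c d)` on the upper half plane: `z ↦ (a z + c) / (b z + d)` if
`det M > 0` and `z ↦ (a z̄ + c) / (b z̄ + d)` if `det M < 0`. -/
def rightAct (z : UpperHalfPlane) (M : GL (Fin 2) ℝ) : UpperHalfPlane := transposeGL M • z

/-- The image of a set under the right action of `M`. -/
def imageRight (S : Set UpperHalfPlane) (M : GL (Fin 2) ℝ) : Set UpperHalfPlane :=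
  (fun z => rightAct z M) '' S

/-- The point `(a i + c) / (b i + d)` (for positive determinant) of the Teichmüller disk which
represents, up to isometry, the marked surface `η · S_O`, `η = (a b; c d)`. -/
def isometryClass (η : GL (Fin 2) ℝ) : UpperHalfPlane := rightAct UpperHalfPlane.I η

/-- The hyperbolic triangle `ℱ`, with one vertex at the base point `i` and two ideal vertices
`0` and `1 - √2`.  Its sides lie on the mirrors of the reflections by which
`α = (1 0; 0 -1)`, `β = (1/√2 1/√2; 1/√2 -1/√2)` and `γ` act: the line `Re z = 0` and the
circles `|z|² - 2 Re z = 1` and `(1 + √2) |z|² + Re z = 0`. -/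
def triangle : Set UpperHalfPlane :=
  {z | z.re ≤ 0 ∧ ‖(z : ℂ)‖ ^ 2 - 2 * z.re ≤ 1 ∧ 0 ≤ (1 + √2) * ‖(z : ℂ)‖ ^ 2 + z.re}

/-- The ideal octagon `𝒪`, the union of the eight images `ℱ ν_j` of the triangle. -/
def idealOctagon : Set UpperHalfPlane := ⋃ j, imageRight triangle (nu j)

/-- The side `E_j = E₀ ν_j` of the ideal octagon, `E₀` being the mirror of `γ`. -/
def idealSide (j : Fin 8) : Set UpperHalfPlane :=
  imageRight {z | rightAct z gam = z} (nu j)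

/-- The geodesic ray `r_θ`: the projection of `g_t^θ · S_O`, where
`g_t^θ = ρ⁻¹ g_t ρ` with `ρ` the rotation by `π/2 - θ`. -/
def ray (θ t : ℝ) : UpperHalfPlane :=
  isometryClass ((rot (π / 2 - θ))⁻¹ * teich t * rot (π / 2 - θ))

/-- `s` is the (infinite) normalized Teichmüller cutting sequence of the ray `r_θ`.

The ray runs in the `k`-th tile `T k` of the ideal octagon tessellation during the time interval
`[t k, t (k+1)]`, and leaves it through the side `exit k`, beyond which lies the next tile.
The tile `T 0` is `𝒪`, and `exit 0` has as label the index `j` such that it is `E_j`.  For `k ≥ 1`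
the element `μ k` of the Veech group sends the tile `T k` to `𝒪` and its entering side
`exit (k-1)` to `E₀`, and the label of `exit k` is the index `j` such that `μ k` sends
it to `E_j`. -/
def IsNormalizedTeichCuttingSequence (θ : ℝ) (s : ℕ → Fin 8) : Prop :=
  ∃ (t : ℕ → ℝ) (T exit : ℕ → Set UpperHalfPlane) (μ : ℕ → GL (Fin 2) ℝ),
    t 0 = 0 ∧ StrictMono t ∧
    (∀ k, ∀ r ∈ Set.Icc (t k) (t (k + 1)), ray θ r ∈ T k) ∧
    (∀ k, ray θ (t (k + 1)) ∈ exit k) ∧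
    (∀ k, T (k + 1) ≠ T k) ∧
    (∀ k, μ k ∈ veechGroup ∧ imageRight (T k) (μ k) = idealOctagon ∧
      imageRight (exit k) (μ k) = idealSide (s k)) ∧
    μ 0 = 1 ∧
    (∀ k, imageRight (exit k) (μ (k + 1)) = idealSide 0)

end Octagon

end

open Real

noncomputable section

namespace Octagon

/-! ## The octagon in coordinates -/

/-! The combinatorial step and the passage to the next tile both read off the same datum: the sector
of angle $\pi/8$ that contains the direction of the trajectory as seen in the current octagon.

Combinatorial side. After an isometry $\nu_d$ the direction lies in the first sector. The involution
with derivative $\gamma$ is a reflection composed with horizontal cylinder twists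
(`exists_gam_automorphism`). It carries the pair of sides $A$ to itself. The image of another side
$X$, developed across $X$ into the two octagons that share it, lies on one straight diagonal. A
trajectory crossing $X$ meets this diagonal exactly when it comes from and goes to sides with the
same label, that is, when $X$ is sandwiched (`cutPos_mul_neg`, `exists_sandwiched_of_crossing`).
Since these crossings also occur in the order of the letters (`crossing_lt_succ`), the derived word
is the cutting sequence with respect to the sheared octagon (`IsCoding.isCuttingSequenceWrt`).
Undoing $\nu_d$ shows that a step replaces $\Psi$ by an automorphism with derivative
$D\Psi\,\nu_d^{-1}\gamma$ (`IsTraj.renormalization_step`).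

The step also needs a unique diagram. Two diagrams share only walks of period two, unless one lacks
the loop of the other (`edge_inter`), so it suffices that an aperiodic word of the first sector
contains $CC$ (`IsTraj.exists_loop`). Without $CC$, renormalization either produces a word that
forces periodicity or stays in sector 1. There $v_0-(1+\sqrt2)v_1$ is preserved while $v_1$ keeps
dropping by a fixed amount (up to the sign of $v$), which cannot go on forever.

Geometric side. Points of the half plane are quadratic forms of determinant one, with the right
action as pullback. Along $r_\theta$ the form is $e^{-t}$ times the standard one plus $(e^{2t}-1)$
times the square of a linear form with kernel in direction $\theta$ (`gramForm_ray`). The function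
vanishing on a side of a tile is therefore, up to a positive factor, affine in $e^{2t}-1$, and its
slope is minus the value of `sectorForm` at the direction seen from the tile (`sideForm_ray`). Hence
the exit side is the one whose sector contains that direction, which yields a cutting sequence.
Conversely, any normalized cutting sequence is of this kind: the stabilizer of $E_0$ in the Veech
group is $\{\pm1,\pm\gamma\}$ (`eq_of_imageRight_idealSide`, by commensurability of the periods of
closed trajectories), and $\pm\gamma$ would lead back into the previous tile.

Aperiodicity keeps all these directions off the sector boundaries, since every trajectory in the
directions $0$ and $\pi/8$ is closed (`IsTraj.not_parallel`). An automorphism is determined by its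
derivative because one with trivial derivative fixes the centre of the octagon
(`IsAffineAutomorphism.eq_of_one`). -/

instance : DecidableEq Letter := fun a b => by
  cases a <;> cases b <;>
    first
    | exact isTrue rfl
    | exact isFalse (by intro h; cases h)

instance : Fintype Letter := ⟨{.A, .B, .C, .D}, by intro x; cases x <;> simp⟩

theorem sqrt_two_mul_self : √2 * √2 = 2 := Real.mul_self_sqrt (by norm_num)

theorem sqrt_two_gt : (1.414 : ℝ) < √2 := by
  rw [Real.lt_sqrt] <;> norm_num

theorem sqrt_two_lt : √2 < (1.415 : ℝ) := by
  rw [Real.sqrt_lt'] <;> norm_num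

theorem inv_sqrt_two : 1 / √2 = √2 / 2 := by
  have h : √2 ≠ 0 := by positivity
  field_simp
  exact (Real.sq_sqrt (by norm_num)).symm

@[simp] theorem height_A (p : Fin 2 → ℝ) : height .A p = p 1 := by
  simp [height, normal, dotProduct, Fin.sum_univ_two]

@[simp] theorem height_C (p : Fin 2 → ℝ) : height .C p = p 0 := by
  simp [height, normal, dotProduct, Fin.sum_univ_two]

@[simp] theorem height_B (p : Fin 2 → ℝ) : height .B p = (√2 / 2) * (p 0 + p 1) := by
  simp only [height, normal, dotProduct, Fin.sum_univ_two, inv_sqrt_two]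
  simp; ring

@[simp] theorem height_D (p : Fin 2 → ℝ) : height .D p = (√2 / 2) * (p 0 - p 1) := by
  simp only [height, normal, dotProduct, Fin.sum_univ_two, inv_sqrt_two]
  simp; ring

theorem height_add (X : Letter) (p q : Fin 2 → ℝ) : height X (p + q) = height X p + height X q := by
  simp [height, dotProduct_add]

theorem height_sub (X : Letter) (p q : Fin 2 → ℝ) : height X (p - q) = height X p - height X q := by
  simp [height, dotProduct_sub]

theorem height_smul (X : Letter) (c : ℝ) (p : Fin 2 → ℝ) : height X (c • p) = c * height X p := by
  simp [height, dotProduct_smul]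

theorem height_neg (X : Letter) (p : Fin 2 → ℝ) : height X (-p) = -height X p := by
  simp [height]

theorem height_zero (X : Letter) : height X 0 = 0 := by simp [height]

theorem normal_zero (X : Letter) : normal X 0 = match X with
    | .A => 0 | .B => √2 / 2 | .C => 1 | .D => √2 / 2 := by
  cases X <;> simp only [normal, inv_sqrt_two] <;> simp

theorem normal_one (X : Letter) : normal X 1 = match X with
    | .A => 1 | .B => √2 / 2 | .C => 0 | .D => -(√2 / 2) := by
  cases X <;> simp only [normal, inv_sqrt_two] <;> simp

theorem height_normal (X : Letter) : height X (normal X) = 1 := by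
  have := sqrt_two_mul_self
  cases X <;> simp [normal_zero, normal_one] <;> nlinarith

/-- The translation vector which carries a side to the opposite side. -/
def period (X : Letter) : Fin 2 → ℝ := (2 : ℝ) • normal X

@[simp] theorem period_zero (X : Letter) : period X 0 = match X with
    | .A => 0 | .B => √2 | .C => 2 | .D => √2 := by
  cases X <;> simp [period, normal_zero] <;> ring

@[simp] theorem period_one (X : Letter) : period X 1 = match X with
    | .A => 2 | .B => √2 | .C => 0 | .D => -√2 := by
  cases X <;> simp [period, normal_one] <;> ring

theorem height_period (X : Letter) : height X (period X) = 2 := by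
  rw [period, height_smul, height_normal]; norm_num

theorem half_sqrt_two_mul_eq {x : ℝ} : (√2 / 2) * x = 1 ↔ x = √2 := by
  have h1 := sqrt_two_mul_self
  have h2 := sqrt_two_gt
  constructor <;> intro h <;> nlinarith

theorem half_sqrt_two_mul_eq_neg {x : ℝ} : (√2 / 2) * x = -1 ↔ x = -√2 := by
  have h1 := sqrt_two_mul_self
  have h2 := sqrt_two_gt
  constructor <;> intro h <;> nlinarith

theorem abs_half_sqrt_two_mul_le {x : ℝ} : |(√2 / 2) * x| ≤ 1 ↔ -√2 ≤ x ∧ x ≤ √2 := by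
  have h1 := sqrt_two_mul_self
  have h2 := sqrt_two_gt
  rw [abs_le]
  constructor <;> rintro ⟨h, h'⟩ <;> constructor <;> nlinarith

theorem height_eq_one_iff {X : Letter} {p : Fin 2 → ℝ} : height X p = 1 ↔ match X with
    | .A => p 1 = 1 | .B => p 0 + p 1 = √2 | .C => p 0 = 1 | .D => p 0 - p 1 = √2 := by
  cases X <;> simp [half_sqrt_two_mul_eq]

theorem height_eq_neg_one_iff {X : Letter} {p : Fin 2 → ℝ} : height X p = -1 ↔ match X with
    | .A => p 1 = -1 | .B => p 0 + p 1 = -√2 | .C => p 0 = -1 | .D => p 0 - p 1 = -√2 := by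
  cases X <;> simp [half_sqrt_two_mul_eq_neg]

theorem mem_octagon {p : Fin 2 → ℝ} : p ∈ octagon ↔ (-1 ≤ p 0 ∧ p 0 ≤ 1) ∧ (-1 ≤ p 1 ∧ p 1 ≤ 1) ∧
    (-√2 ≤ p 0 + p 1 ∧ p 0 + p 1 ≤ √2) ∧ (-√2 ≤ p 0 - p 1 ∧ p 0 - p 1 ≤ √2) := by
  constructor
  · intro h
    have hA := h .A
    have hB := h .B
    have hC := h .C
    have hD := h .D
    simp only [height_A, height_B, height_C, height_D, abs_half_sqrt_two_mul_le] at *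
    exact ⟨abs_le.1 hC, abs_le.1 hA, hB, hD⟩
  · rintro ⟨hC, hA, hB, hD⟩ X
    cases X <;> simp only [height_A, height_B, height_C, height_D, abs_half_sqrt_two_mul_le]
    exacts [abs_le.2 hA, hB, abs_le.2 hC, hD]

theorem add_smul_mem_octagon {p v : Fin 2 → ℝ} {r R : ℝ} (hp : p ∈ octagon)
    (hq : p + R • v ∈ octagon) (h0 : 0 ≤ r) (h1 : r ≤ R) : p + r • v ∈ octagon := by
  intro X
  have h2 := abs_le.1 (hp X)
  have h3 := abs_le.1 (hq X)
  rw [height_add, height_smul] at *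
  rw [abs_le]
  rcases le_total 0 (height X v) with h | h <;> constructor <;> nlinarith

theorem neg_mem_octagon {p : Fin 2 → ℝ} (hp : p ∈ octagon) : -p ∈ octagon := by
  intro X
  rw [height_neg, abs_neg]
  exact hp X

theorem zero_mem_octagon : (0 : Fin 2 → ℝ) ∈ octagon := by
  intro X
  simp [height_zero]

theorem sub_period_mem {p : Fin 2 → ℝ} (hp : p ∈ octagon) {X : Letter} (h : height X p = 1) :
    p - period X ∈ octagon := by
  rw [mem_octagon] at *
  rw [height_eq_one_iff] at h
  have := sqrt_two_gt
  have := sqrt_two_lt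
  obtain ⟨⟨a1, a2⟩, ⟨a3, a4⟩, ⟨a5, a6⟩, a7, a8⟩ := hp
  cases X <;> simp at h ⊢ <;> refine ⟨⟨?_, ?_⟩, ⟨?_, ?_⟩, ⟨?_, ?_⟩, ?_, ?_⟩ <;> linarith

theorem add_period_mem {p : Fin 2 → ℝ} (hp : p ∈ octagon) {X : Letter} (h : height X p = -1) :
    p + period X ∈ octagon := by
  have := neg_mem_octagon (sub_period_mem (neg_mem_octagon hp) (X := X) (by rw [height_neg, h]; simp))
  simpa [add_comm] using this

/-- The vertices of the octagon. -/
def IsVertex (p : Fin 2 → ℝ) : Prop :=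
  (|p 0| = √2 - 1 ∧ |p 1| = 1) ∨ (|p 0| = 1 ∧ |p 1| = √2 - 1)

theorem isVertex_neg {p : Fin 2 → ℝ} : IsVertex (-p) ↔ IsVertex p := by
  simp [IsVertex]

theorem abs_height_eq_one {X : Letter} {p : Fin 2 → ℝ} (h : |height X p| = 1) :
    height X p = 1 ∨ height X p = -1 := by
  rcases abs_cases (height X p) with ⟨h1, -⟩ | ⟨h1, -⟩
  · left; linarith
  · right; linarith

/-- Two lines carrying sides with different labels meet at a vertex or outside the octagon; all
pairs and signs are checked. This is why a nonsingular boundary point has only one label. -/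
theorem isVertex_of_abs_height {p : Fin 2 → ℝ} (hp : p ∈ octagon) {X Y : Letter} (hXY : X ≠ Y)
    (hX : |height X p| = 1) (hY : |height Y p| = 1) : IsVertex p := by
  have hx := abs_height_eq_one hX
  have hy := abs_height_eq_one hY
  have h1 := sqrt_two_gt
  have h2 := sqrt_two_lt
  simp only [height_eq_one_iff, height_eq_neg_one_iff] at hx hy
  obtain ⟨⟨a1, a2⟩, ⟨a3, a4⟩, ⟨a5, a6⟩, a7, a8⟩ := mem_octagon.1 hp
  have key : ∀ s : ℝ, |s| = 1 ↔ (s = 1 ∨ s = -1) := fun s => abs_eq (by norm_num)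
  have key' : ∀ s : ℝ, |s| = √2 - 1 ↔ (s = √2 - 1 ∨ s = -(√2 - 1)) := fun s => abs_eq (by linarith)
  simp only [IsVertex, key, key']
  have cl : ∀ a b : ℝ, p 0 = a → p 1 = b →
      ((a = √2 - 1 ∨ a = -(√2 - 1)) ∧ (b = 1 ∨ b = -1) ∨
        (a = 1 ∨ a = -1) ∧ (b = √2 - 1 ∨ b = -(√2 - 1))) →
      ((p 0 = √2 - 1 ∨ p 0 = -(√2 - 1)) ∧ (p 1 = 1 ∨ p 1 = -1) ∨
        (p 0 = 1 ∨ p 0 = -1) ∧ (p 1 = √2 - 1 ∨ p 1 = -(√2 - 1))) := by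
    rintro a b rfl rfl h; exact h
  cases X <;> cases Y <;> simp only [ne_eq, not_true_eq_false] at hXY <;>
    rcases hx with hx | hx <;> rcases hy with hy | hy <;> simp only at hx hy <;>
    first
    | (exfalso; linarith)
    | exact cl (√2 - 1) 1 (by linarith) (by linarith) (by simp)
    | exact cl (√2 - 1) (-1) (by linarith) (by linarith) (by simp)
    | exact cl (-(√2 - 1)) 1 (by linarith) (by linarith) (by simp)
    | exact cl (-(√2 - 1)) (-1) (by linarith) (by linarith) (by simp)
    | exact cl 1 (√2 - 1) (by linarith) (by linarith) (by simp)
    | exact cl (-1) (√2 - 1) (by linarith) (by linarith) (by simp)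
    | exact cl 1 (-(√2 - 1)) (by linarith) (by linarith) (by simp)
    | exact cl (-1) (-(√2 - 1)) (by linarith) (by linarith) (by simp)

theorem isVertex_cases {p : Fin 2 → ℝ} (h : IsVertex p) :
    ((p 0 = √2 - 1 ∨ p 0 = 1 - √2) ∧ (p 1 = 1 ∨ p 1 = -1)) ∨
      ((p 0 = 1 ∨ p 0 = -1) ∧ (p 1 = √2 - 1 ∨ p 1 = 1 - √2)) := by
  have h1 := sqrt_two_gt
  have key : ∀ s : ℝ, |s| = 1 ↔ (s = 1 ∨ s = -1) := fun s => abs_eq (by norm_num)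
  have key' : ∀ s : ℝ, |s| = √2 - 1 ↔ (s = √2 - 1 ∨ s = 1 - √2) := fun s => by
    rw [abs_eq (by linarith), neg_sub]
  simpa only [IsVertex, key, key'] using h

theorem IsVertex.mem {p : Fin 2 → ℝ} (h : IsVertex p) : p ∈ octagon := by
  have h1 := sqrt_two_gt
  have h2 := sqrt_two_lt
  rw [mem_octagon]
  rcases isVertex_cases h with ⟨h | h, h' | h'⟩ | ⟨h | h, h' | h'⟩ <;> rw [h, h'] <;>
    refine ⟨⟨?_, ?_⟩, ⟨?_, ?_⟩, ⟨?_, ?_⟩, ?_, ?_⟩ <;> linarith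

theorem IsVertex.exists_heights {p : Fin 2 → ℝ} (h : IsVertex p) :
    ∃ X Y, X ≠ Y ∧ |height X p| = 1 ∧ |height Y p| = 1 := by
  have e : ∀ X, |height X p| = 1 ↔ (height X p = 1 ∨ height X p = -1) := fun s =>
    abs_eq (by norm_num)
  simp only [e, height_eq_one_iff, height_eq_neg_one_iff]
  rcases isVertex_cases h with ⟨h | h, h' | h'⟩ | ⟨h | h, h' | h'⟩
  · exact ⟨.A, .B, by simp, Or.inl h', Or.inl (by simp only [h, h']; ring)⟩
  · exact ⟨.A, .D, by simp, Or.inr h', Or.inl (by simp only [h, h']; ring)⟩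
  · exact ⟨.A, .D, by simp, Or.inl h', Or.inr (by simp only [h, h']; ring)⟩
  · exact ⟨.A, .B, by simp, Or.inr h', Or.inr (by simp only [h, h']; ring)⟩
  · exact ⟨.C, .B, by simp, Or.inl h, Or.inl (by simp only [h, h']; ring)⟩
  · exact ⟨.C, .D, by simp, Or.inl h, Or.inl (by simp only [h, h']; ring)⟩
  · exact ⟨.C, .D, by simp, Or.inr h, Or.inr (by simp only [h, h']; ring)⟩
  · exact ⟨.C, .B, by simp, Or.inr h, Or.inr (by simp only [h, h']; ring)⟩

/-- From a side to the opposite one, the translation either keeps or exchanges the absolute values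
of the two coordinates. -/
theorem isVertex_sub_period {p : Fin 2 → ℝ} {X : Letter} (h : height X p = 1) :
    IsVertex (p - period X) ↔ IsVertex p := by
  rw [height_eq_one_iff] at h
  cases X <;> simp only at h <;> simp only [IsVertex, Pi.sub_apply, period_zero, period_one]
  · norm_num [h]
  · have e0 : p 0 - √2 = -p 1 := by linarith
    have e1 : p 1 - √2 = -p 0 := by linarith
    rw [e0, e1, abs_neg, abs_neg]; tauto
  · norm_num [h]
  · have e0 : p 0 - √2 = p 1 := by linarith
    have e1 : p 1 - -√2 = p 0 := by linarith
    rw [e0, e1]; tauto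

/-! ## The projection to the surface -/

open Classical in
/-- The projection, extended by a junk value to the whole plane. -/
def pr (p : Fin 2 → ℝ) : Surface :=
  if h : p ∈ octagon then proj ⟨p, h⟩ else proj ⟨0, zero_mem_octagon⟩

theorem proj_eq_pr (p : octagon) : proj p = pr p.1 := by
  simp [pr, p.2]

theorem exists_pr (x : Surface) : ∃ p ∈ octagon, pr p = x := by
  obtain ⟨p, rfl⟩ := Quot.exists_rep x
  exact ⟨p.1, p.2, (proj_eq_pr p).symm⟩

theorem pr_sub_period {p : Fin 2 → ℝ} (hp : p ∈ octagon) {X : Letter} (h : height X p = 1) :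
    pr (p - period X) = pr p := by
  rw [← proj_eq_pr ⟨p, hp⟩, ← proj_eq_pr ⟨p - period X, sub_period_mem hp h⟩]
  exact (Quot.sound ⟨X, h, rfl⟩).symm

theorem pr_add_period {p : Fin 2 → ℝ} (hp : p ∈ octagon) {X : Letter} (h : height X p = -1) :
    pr (p + period X) = pr p := by
  have := pr_sub_period (add_period_mem hp h) (X := X) (by rw [height_add, h, height_period]; norm_num)
  rw [add_sub_cancel_right] at this
  exact this.symm

/-- The equivalence relation generated by the gluing. -/
def Identified (p q : Fin 2 → ℝ) : Prop :=
  p = q ∨ (∃ X, height X p = 1 ∧ q = p - period X) ∨ (∃ X, height X q = 1 ∧ p = q - period X) ∨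
    (IsVertex p ∧ IsVertex q)

theorem Identified.symm {p q : Fin 2 → ℝ} (h : Identified p q) : Identified q p := by
  rcases h with h | h | h | h
  · exact Or.inl h.symm
  · exact Or.inr (Or.inr (Or.inl h))
  · exact Or.inr (Or.inl h)
  · exact Or.inr (Or.inr (Or.inr h.symm))

theorem Identified.isVertex_iff {p q : Fin 2 → ℝ} (h : Identified p q) :
    IsVertex p ↔ IsVertex q := by
  rcases h with rfl | ⟨X, h, rfl⟩ | ⟨X, h, rfl⟩ | h
  · rfl
  · exact (isVertex_sub_period h).symm
  · exact isVertex_sub_period h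
  · simp [h.1, h.2]

/-- The clause about vertices absorbs every chain through a vertex. Any other boundary point lies on
one side only, so two consecutive gluings use the same letter and either cancel or disagree in sign.
-/
theorem Identified.trans {p q r : Fin 2 → ℝ} (hq : q ∈ octagon) (h : Identified p q)
    (h' : Identified q r) : Identified p r := by
  by_cases hv : IsVertex q
  · exact Or.inr (Or.inr (Or.inr ⟨h.isVertex_iff.2 hv, h'.isVertex_iff.1 hv⟩))
  have uniq : ∀ X Y, |height X q| = 1 → |height Y q| = 1 → X = Y := fun X Y h1 h2 => by
    by_contra hne
    exact hv (isVertex_of_abs_height hq hne h1 h2)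
  have hm : ∀ {X : Letter} {s : Fin 2 → ℝ}, height X s = 1 → q = s - period X →
      height X q = -1 := by
    intro X s h1 h2
    rw [h2, height_sub, h1, height_period]; norm_num
  rcases h with rfl | ⟨X, h1, h2⟩ | ⟨X, h1, h2⟩ | ⟨-, h⟩
  · exact h'
  · have e1 := hm h1 h2
    rcases h' with rfl | ⟨Y, h3, h4⟩ | ⟨Y, h3, h4⟩ | ⟨h', -⟩
    · exact Or.inr (Or.inl ⟨X, h1, h2⟩)
    · have := uniq X Y (by rw [e1]; simp) (by rw [h3]; simp)
      subst this; linarith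
    · have e2 := hm h3 h4
      have := uniq X Y (by rw [e1]; simp) (by rw [e2]; simp)
      subst this
      left
      exact sub_left_injective (h2.symm.trans h4)
    · exact absurd h' hv
  · rcases h' with rfl | ⟨Y, h3, h4⟩ | ⟨Y, h3, h4⟩ | ⟨h', -⟩
    · exact Or.inr (Or.inr (Or.inl ⟨X, h1, h2⟩))
    · have := uniq X Y (by rw [h1]; simp) (by rw [h3]; simp)
      subst this
      left
      rw [h2, h4]
    · have e2 := hm h3 h4
      have := uniq X Y (by rw [h1]; simp) (by rw [e2]; simp)
      subst this; linarith
    · exact absurd h' hv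
  · exact absurd h hv

theorem identified_of_pr_eq {p q : Fin 2 → ℝ} (hp : p ∈ octagon) (hq : q ∈ octagon)
    (h : pr p = pr q) : Identified p q := by
  rw [← proj_eq_pr ⟨p, hp⟩, ← proj_eq_pr ⟨q, hq⟩] at h
  have h' := Quot.eqvGen_exact h
  have key : ∀ a b : octagon, Relation.EqvGen glue a b → Identified a.1 b.1 := by
    intro a b hab
    induction hab with
    | rel a b h =>
      obtain ⟨X, h1, h2⟩ := h
      exact Or.inr (Or.inl ⟨X, h1, h2⟩)
    | refl a => exact Or.inl rfl
    | symm a b _ ih => exact ih.symm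
    | trans a b c _ _ ih1 ih2 => exact ih1.trans b.2 ih2
  exact key _ _ h'

/-- The seven gluings `s1` to `s7` form a spanning tree on the eight vertices, so there is a single
singular point. -/
theorem pr_eq_of_isVertex {p q : Fin 2 → ℝ} (hp : IsVertex p) (hq : IsVertex q) :
    pr p = pr q := by
  have h1 := sqrt_two_gt
  have step : ∀ (X : Letter) (a b c d : ℝ), IsVertex ![a, b] → height X ![a, b] = 1 →
      c = a - period X 0 → d = b - period X 1 → pr ![c, d] = pr ![a, b] := by
    intro X a b c d hv h hc hd
    rw [← pr_sub_period hv.mem h]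
    congr 1
    ext i
    fin_cases i <;> simp [hc, hd]
  have v1 : ∀ a b : ℝ, (a = √2 - 1 ∨ a = 1 - √2) → (b = 1 ∨ b = -1) → IsVertex ![a, b] := by
    intro a b ha hb
    left
    have : |a| = √2 - 1 := by
      rcases ha with rfl | rfl
      · exact abs_of_nonneg (by linarith)
      · rw [abs_sub_comm]; exact abs_of_nonneg (by linarith)
    rcases hb with rfl | rfl <;> simp [this]
  have v2 : ∀ a b : ℝ, (b = √2 - 1 ∨ b = 1 - √2) → (a = 1 ∨ a = -1) → IsVertex ![a, b] := by
    intro a b ha hb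
    right
    have : |b| = √2 - 1 := by
      rcases ha with rfl | rfl
      · exact abs_of_nonneg (by linarith)
      · rw [abs_sub_comm]; exact abs_of_nonneg (by linarith)
    rcases hb with rfl | rfl <;> simp [this]
  have s1 : pr ![√2 - 1, -1] = pr ![√2 - 1, 1] :=
    step .A _ _ _ _ (v1 _ _ (by simp) (by simp)) (by rw [height_eq_one_iff]; simp) (by simp) (by simp; ring)
  have s2 : pr ![-1, 1 - √2] = pr ![√2 - 1, 1] :=
    step .B _ _ _ _ (v1 _ _ (by simp) (by simp)) (by rw [height_eq_one_iff]; simp) (by simp) (by simp)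
  have s3 : pr ![1 - √2, -1] = pr ![1, √2 - 1] :=
    step .B _ _ _ _ (v2 _ _ (by simp) (by simp)) (by rw [height_eq_one_iff]; simp) (by simp) (by simp)
  have s4 : pr ![-1, √2 - 1] = pr ![1, √2 - 1] :=
    step .C _ _ _ _ (v2 _ _ (by simp) (by simp)) (by rw [height_eq_one_iff]; simp) (by simp; ring) (by simp)
  have s5 : pr ![-1, 1 - √2] = pr ![1, 1 - √2] :=
    step .C _ _ _ _ (v2 _ _ (by simp) (by simp)) (by rw [height_eq_one_iff]; simp) (by simp; ring) (by simp)
  have s6 : pr ![1 - √2, 1] = pr ![1, 1 - √2] :=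
    step .D _ _ _ _ (v2 _ _ (by simp) (by simp)) (by rw [height_eq_one_iff]; simp) (by simp) (by simp)
  have s7 : pr ![-1, √2 - 1] = pr ![√2 - 1, -1] :=
    step .D _ _ _ _ (v1 _ _ (by simp) (by simp)) (by rw [height_eq_one_iff]; simp) (by simp) (by simp; ring)
  have main : ∀ p : Fin 2 → ℝ, IsVertex p → pr p = pr ![√2 - 1, 1] := by
    intro p hp
    have e : p = ![p 0, p 1] := by ext i; fin_cases i <;> simp
    rw [e]
    rcases isVertex_cases hp with ⟨h | h, h' | h'⟩ | ⟨h | h, h' | h'⟩ <;> rw [h, h']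
    · exact s1
    · rw [s6, ← s5, s2]
    · rw [s3, ← s4, s7, s1]
    · rw [← s4, s7, s1]
    · rw [← s5, s2]
    · rw [s7, s1]
    · exact s2
  rw [main p hp, main q hq]

theorem Identified.pr_eq {p q : Fin 2 → ℝ} (hp : p ∈ octagon) (hq : q ∈ octagon)
    (h : Identified p q) : pr p = pr q := by
  rcases h with rfl | ⟨X, h, rfl⟩ | ⟨X, h, rfl⟩ | h
  · rfl
  · exact (pr_sub_period hp h).symm
  · exact pr_sub_period hq h
  · exact pr_eq_of_isVertex h.1 h.2

theorem pr_mem_singularSet {p : Fin 2 → ℝ} (hp : p ∈ octagon) :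
    pr p ∈ singularSet ↔ IsVertex p := by
  constructor
  · rintro ⟨q, hq, X, Y, hXY, hX, hY⟩
    rw [proj_eq_pr] at hq
    exact (identified_of_pr_eq q.2 hp hq).isVertex_iff.1 (isVertex_of_abs_height q.2 hXY hX hY)
  · intro h
    exact ⟨⟨p, hp⟩, proj_eq_pr _, h.exists_heights⟩

theorem abs_height_of_identified {p q : Fin 2 → ℝ} (hp : ¬ IsVertex p) (h : Identified p q)
    (hpO : p ∈ octagon) {X : Letter} (hX : |height X p| = 1) : |height X q| = 1 := by
  have key : ∀ {Y}, |height Y p| = 1 → X = Y := fun {Y} hY => by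
    by_contra hne
    exact hp (isVertex_of_abs_height hpO hne hX hY)
  rcases h with rfl | ⟨Y, h, rfl⟩ | ⟨Y, h, rfl⟩ | h
  · exact hX
  · obtain rfl := key (Y := Y) (by rw [h]; simp)
    rw [height_sub, h, height_period]; norm_num
  · obtain rfl := key (Y := Y) (by rw [height_sub, h, height_period]; norm_num)
    rw [h]; simp
  · exact absurd h.1 hp

theorem pr_mem_side {p : Fin 2 → ℝ} (hp : p ∈ octagon) (hv : ¬ IsVertex p) {X : Letter} :
    pr p ∈ side X ↔ |height X p| = 1 := by
  constructor
  · rintro ⟨q, hq, hX⟩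
    rw [proj_eq_pr] at hq
    have hi := identified_of_pr_eq q.2 hp hq
    exact abs_height_of_identified (fun h => hv (hi.isVertex_iff.1 h)) hi q.2 hX
  · intro h
    exact ⟨⟨p, hp⟩, proj_eq_pr _, h⟩

theorem side_unique {x : Surface} (hx : x ∉ singularSet) {X Y : Letter} (hX : x ∈ side X)
    (hY : x ∈ side Y) : X = Y := by
  obtain ⟨p, hp, rfl⟩ := exists_pr x
  rw [pr_mem_singularSet hp] at hx
  rw [pr_mem_side hp hx] at hX hY
  by_contra hne
  exact hx (isVertex_of_abs_height hp hne hX hY)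


/-! ## Displacements and trajectories -/

theorem displaced_iff {x y : Surface} {u : Fin 2 → ℝ} :
    Displaced x u y ↔ ∃ p, p ∈ octagon ∧ p + u ∈ octagon ∧ pr p = x ∧ pr (p + u) = y := by
  constructor
  · rintro ⟨p, q, hp, hq, h⟩
    refine ⟨p.1, p.2, h ▸ q.2, ?_, ?_⟩
    · rw [← proj_eq_pr, hp]
    · rw [← h, ← proj_eq_pr, hq]
  · rintro ⟨p, hp, hq, h1, h2⟩
    exact ⟨⟨p, hp⟩, ⟨p + u, hq⟩, by rw [proj_eq_pr, h1], by rw [proj_eq_pr, h2], rfl⟩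

theorem displaced_pr {p u : Fin 2 → ℝ} (hp : p ∈ octagon) (hq : p + u ∈ octagon) :
    Displaced (pr p) u (pr (p + u)) :=
  displaced_iff.2 ⟨p, hp, hq, rfl, rfl⟩

theorem Displaced.symm {x y : Surface} {u : Fin 2 → ℝ} (h : Displaced x u y) :
    Displaced y (-u) x := by
  obtain ⟨p, q, hp, hq, h⟩ := h
  exact ⟨q, p, hq, hp, by rw [h]; simp⟩

/-- Two representatives of a nonsingular point differ by the period of a side. A displacement that
keeps both in the octagon must run parallel to that side, so the end points are glued by the same
period. -/
theorem Displaced.unique {x y y' : Surface} {u : Fin 2 → ℝ} (hx : x ∉ singularSet)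
    (h : Displaced x u y) (h' : Displaced x u y') : y = y' := by
  obtain ⟨p, hp, hpu, rfl, rfl⟩ := displaced_iff.1 h
  obtain ⟨q, hq, hqu, h1, rfl⟩ := displaced_iff.1 h'
  rw [pr_mem_singularSet hp] at hx
  have key : ∀ {p q : Fin 2 → ℝ} {X : Letter}, p ∈ octagon → p + u ∈ octagon → q + u ∈ octagon →
      height X p = 1 → q = p - period X → pr (p + u) = pr (q + u) := by
    intro p q X hp hpu hqu h2 hqq
    have e1 := abs_le.1 (hpu X)
    have e2 := abs_le.1 (hqu X)
    rw [hqq] at e2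
    simp only [height_add, height_sub, height_period, h2] at e1 e2
    have e3 : height X u = 0 := by linarith
    have : q + u = (p + u) - period X := by rw [hqq]; abel
    rw [this, pr_sub_period hpu (by rw [height_add, h2, e3]; norm_num)]
  rcases identified_of_pr_eq hp hq h1.symm with rfl | ⟨X, h2, h3⟩ | ⟨X, h2, h3⟩ | h2
  · rfl
  · exact key hp hpu hqu h2 h3
  · exact (key hq hqu hpu h2 h3).symm
  · exact absurd h2.1 hx

theorem Displaced.unique_left {x x' y : Surface} {u : Fin 2 → ℝ} (hy : y ∉ singularSet)
    (h : Displaced x u y) (h' : Displaced x' u y) : x = x' :=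
  Displaced.unique hy h.symm h'.symm

theorem abs_height_le_norm (X : Letter) (u : Fin 2 → ℝ) : |height X u| ≤ 2 * ‖u‖ := by
  have h0 : |u 0| ≤ ‖u‖ := norm_le_pi_norm u 0
  have h1 : |u 1| ≤ ‖u‖ := norm_le_pi_norm u 1
  have hn := norm_nonneg u
  have h2 := sqrt_two_gt
  have h3 := sqrt_two_lt
  have e : ∀ a : ℝ, |√2 / 2 * a| ≤ |a| := by
    intro a
    rw [abs_mul, abs_of_nonneg (by positivity)]
    nlinarith [abs_nonneg a]
  cases X
  · simp; linarith
  · simp only [height_B]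
    have := e (u 0 + u 1)
    have := abs_add_le (u 0) (u 1)
    linarith
  · simp; linarith
  · simp only [height_D]
    have := e (u 0 - u 1)
    have := abs_sub (u 0) (u 1)
    linarith

/-- On a side there are two representatives; the sign of `height X u` selects the one from which `u`
points into the octagon. The other heights stay below one for small `u`. -/
theorem exists_displaced {x : Surface} (hx : x ∉ singularSet) :
    ∃ ε > 0, ∀ u : Fin 2 → ℝ, ‖u‖ < ε → ∃ y, Displaced x u y := by
  obtain ⟨p, hp, rfl⟩ := exists_pr x
  rw [pr_mem_singularSet hp] at hx
  have small : ∀ q : Fin 2 → ℝ, ∃ ε > 0, ∀ X, |height X q| < 1 → ∀ u : Fin 2 → ℝ, ‖u‖ < ε →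
      |height X (q + u)| ≤ 1 := by
    intro q
    have h1 : ∀ X, ∃ ε > 0, |height X q| < 1 → ∀ u : Fin 2 → ℝ, ‖u‖ < ε →
        |height X (q + u)| ≤ 1 := by
      intro X
      by_cases h : |height X q| < 1
      · refine ⟨(1 - |height X q|) / 2, by linarith, fun _ u hu => ?_⟩
        rw [height_add]
        have := abs_add_le (height X q) (height X u)
        have := abs_height_le_norm X u
        linarith
      · exact ⟨1, one_pos, fun h' => absurd h' h⟩
    choose ε hε h using h1
    refine ⟨min (min (ε .A) (ε .B)) (min (ε .C) (ε .D)), by simp [hε], fun X hX u hu => ?_⟩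
    simp only [lt_min_iff] at hu
    apply h X hX
    cases X <;> tauto
  by_cases hs : ∃ X, |height X p| = 1
  · obtain ⟨X, hX⟩ := hs
    have hne : ∀ Y, Y ≠ X → |height Y p| < 1 := fun Y hY =>
      lt_of_le_of_ne (hp Y) fun h => hx (isVertex_of_abs_height hp hY h hX)
    wlog h1 : height X p = 1 generalizing p
    · have h2 : height X p = -1 := (abs_height_eq_one hX).resolve_left h1
      have h3 : height X (p + period X) = 1 := by rw [height_add, h2, height_period]; norm_num
      have hp' := add_period_mem hp h2
      have hv : ¬ IsVertex (p + period X) := by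
        rw [← isVertex_sub_period h3]; simpa using hx
      have := this (p + period X) hp' hv (by rw [h3]; simp)
        (fun Y hY => lt_of_le_of_ne (hp' Y) fun h =>
          hv (isVertex_of_abs_height hp' hY h (by rw [h3]; simp))) h3
      rwa [pr_add_period hp h2] at this
    have hp' := sub_period_mem hp h1
    have hX' : height X (p - period X) = -1 := by rw [height_sub, h1, height_period]; norm_num
    have hv : ¬ IsVertex (p - period X) := by rwa [isVertex_sub_period h1]
    have hne' : ∀ Y, Y ≠ X → |height Y (p - period X)| < 1 := fun Y hY =>
      lt_of_le_of_ne (hp' Y) fun h =>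
        hv (isVertex_of_abs_height hp' hY h (by rw [hX']; simp))
    obtain ⟨ε, hε, h⟩ := small p
    obtain ⟨ε', hε', h'⟩ := small (p - period X)
    refine ⟨min (min ε ε') 1, by simp [hε, hε'], fun u hu => ?_⟩
    simp only [lt_min_iff] at hu
    have hu1 := abs_le.1 (abs_height_le_norm X u)
    rcases le_total (height X u) 0 with hu0 | hu0
    · refine ⟨pr (p + u), displaced_pr hp fun Y => ?_⟩
      by_cases hY : Y = X
      · subst hY
        rw [height_add, h1, abs_le]
        constructor <;> linarith
      · exact h Y (hne Y hY) u hu.1.1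
    · refine ⟨pr (p - period X + u), pr_sub_period hp h1 ▸ displaced_pr hp' fun Y => ?_⟩
      by_cases hY : Y = X
      · subst hY
        rw [height_add, hX', abs_le]
        constructor <;> linarith
      · exact h' Y (hne' Y hY) u hu.1.2
  · push Not at hs
    obtain ⟨ε, hε, h⟩ := small p
    exact ⟨ε, hε, fun u hu => ⟨pr (p + u), displaced_pr hp fun X =>
      h X (lt_of_le_of_ne (hp X) (hs X)) u hu⟩⟩

/-- Linear trajectories with an arbitrary velocity vector. -/
def IsTraj (v : Fin 2 → ℝ) (τ : ℝ → Surface) : Prop :=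
  (∀ t, τ t ∉ singularSet) ∧
  ∀ t, ∃ ε > 0, ∀ r : ℝ, |r| < ε → Displaced (τ t) (r • v) (τ (t + r))

theorem IsTrajectory.isTraj {θ : ℝ} {τ : ℝ → Surface} (h : IsTrajectory θ τ) :
    IsTraj ![cos θ, sin θ] τ := h

/-- A path that is linear with velocity `v` on the interval `[0, R]`. -/
def LinearOn (v : Fin 2 → ℝ) (R : ℝ) (f : ℝ → Surface) : Prop :=
  ∀ r ∈ Set.Icc 0 R, ∃ ε > 0, ∀ s ∈ Set.Icc 0 R, |s - r| < ε →
    Displaced (f r) ((s - r) • v) (f s)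

/-- Continuation along the interval. At the supremum, equality comes from the left by
`Displaced.unique_left`, which needs only an earlier point to be nonsingular. So the end point may
be singular, as in `IsAffineAutomorphism.eq_of_one`. -/
theorem LinearOn.eq {v : Fin 2 → ℝ} {R : ℝ} {f g : ℝ → Surface} (hf : LinearOn v R f)
    (hg : LinearOn v R g) (hR : 0 ≤ R) (hns : ∀ r ∈ Set.Ico 0 R, f r ∉ singularSet)
    (h0 : f 0 = g 0) : f R = g R := by
  set S : Set ℝ := {r | r ∈ Set.Icc 0 R ∧ ∀ s ∈ Set.Icc 0 r, f s = g s} with hS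
  have h0S : (0 : ℝ) ∈ S := ⟨⟨le_rfl, hR⟩, fun s hs => by
    obtain rfl : s = 0 := le_antisymm hs.2 hs.1
    exact h0⟩
  have hbdd : BddAbove S := ⟨R, fun r hr => hr.1.2⟩
  set c := sSup S with hc
  have hc0 : 0 ≤ c := le_csSup hbdd h0S
  have hcR : c ≤ R := csSup_le ⟨0, h0S⟩ fun r hr => hr.1.2
  have hlt : ∀ s, 0 ≤ s → s < c → f s = g s := by
    intro s hs hsc
    obtain ⟨r, hr, hsr⟩ := exists_lt_of_lt_csSup ⟨0, h0S⟩ hsc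
    exact hr.2 s ⟨hs, hsr.le⟩
  obtain ⟨ε, hε, hfc⟩ := hf c ⟨hc0, hcR⟩
  obtain ⟨ε', hε', hgc⟩ := hg c ⟨hc0, hcR⟩
  have hcc : f c = g c := by
    rcases hc0.eq_or_lt with h | h
    · rw [← h]; exact h0
    · obtain ⟨s, hs1, hs2⟩ := exists_between
        (show max 0 (max (c - ε) (c - ε')) < c by simp [h, hε, hε'])
      simp only [max_lt_iff] at hs1
      have habs : |s - c| = c - s := by rw [abs_sub_comm]; exact abs_of_pos (by linarith)
      have hsR : s ∈ Set.Icc 0 R := ⟨hs1.1.le, by linarith⟩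
      have d1 := hfc s hsR (by rw [habs]; linarith)
      have d2 := hgc s hsR (by rw [habs]; linarith)
      rw [← hlt s hs1.1.le hs2] at d2
      exact Displaced.unique_left (hns s ⟨hs1.1.le, by linarith⟩) d1 d2
  have hcS : c ∈ S := ⟨⟨hc0, hcR⟩, fun s hs => by
    rcases hs.2.eq_or_lt with h | h
    · rw [h, hcc]
    · exact hlt s hs.1 h⟩
  rcases hcR.eq_or_lt with h | h
  · rw [← h, hcc]
  · exfalso
    obtain ⟨d, hd1, hd2⟩ := exists_between
      (show c < min R (min (c + ε) (c + ε')) by simp [h, hε, hε'])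
    simp only [lt_min_iff] at hd2
    have hdS : d ∈ S := by
      refine ⟨⟨by linarith, hd2.1.le⟩, fun s hs => ?_⟩
      rcases le_or_gt s c with hsc | hsc
      · exact hcS.2 s ⟨hs.1, hsc⟩
      · have habs : |s - c| = s - c := abs_of_pos (by linarith)
        have hsR : s ∈ Set.Icc 0 R := ⟨hs.1, by linarith [hs.2]⟩
        have d1 := hfc s hsR (by rw [habs]; linarith [hs.2])
        have d2 := hgc s hsR (by rw [habs]; linarith [hs.2])
        rw [← hcc] at d2
        exact Displaced.unique (hns c ⟨hc0, h⟩) d1 d2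
    exact absurd (le_csSup hbdd hdS) (not_le.2 hd1)

theorem linearOn_pr {p v : Fin 2 → ℝ} {R : ℝ} (hp : p ∈ octagon) (hq : p + R • v ∈ octagon) :
    LinearOn v R (fun r => pr (p + r • v)) := by
  intro r hr
  refine ⟨1, one_pos, fun s hs _ => ?_⟩
  have h1 := add_smul_mem_octagon hp hq hr.1 hr.2
  have h2 := add_smul_mem_octagon hp hq hs.1 hs.2
  have e : p + s • v = (p + r • v) + (s - r) • v := by rw [sub_smul]; abel
  show Displaced (pr (p + r • v)) ((s - r) • v) (pr (p + s • v))
  rw [e] at h2 ⊢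
  exact displaced_pr h1 h2

theorem IsTraj.linearOn {v : Fin 2 → ℝ} {τ : ℝ → Surface} (h : IsTraj v τ) (a R : ℝ) :
    LinearOn v R (fun r => τ (a + r)) := by
  intro r hr
  obtain ⟨ε, hε, H⟩ := h.2 (a + r)
  refine ⟨ε, hε, fun s hs hsr => ?_⟩
  have := H (s - r) hsr
  rwa [show a + r + (s - r) = a + s by ring] at this

theorem IsTraj.comp_mul {v : Fin 2 → ℝ} {τ : ℝ → Surface} (h : IsTraj v τ) {c : ℝ} (hc : c ≠ 0) :
    IsTraj (c • v) (fun t => τ (c * t)) := by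
  refine ⟨fun t => h.1 _, fun t => ?_⟩
  obtain ⟨ε, hε, H⟩ := h.2 (c * t)
  refine ⟨ε / |c|, div_pos hε (abs_pos.2 hc), fun r hr => ?_⟩
  have := H (c * r) (by rw [abs_mul]; rwa [lt_div_iff₀' (abs_pos.2 hc)] at hr)
  rwa [mul_comm c r, mul_smul, mul_comm r c, ← mul_add] at this

theorem IsTraj.neg {v : Fin 2 → ℝ} {τ : ℝ → Surface} (h : IsTraj v τ) :
    IsTraj (-v) (fun t => τ (-t)) := by
  simpa using h.comp_mul (c := -1) (by norm_num)

theorem IsTraj.shift {v : Fin 2 → ℝ} {τ : ℝ → Surface} (h : IsTraj v τ) (a : ℝ) :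
    IsTraj v (fun t => τ (t + a)) := by
  refine ⟨fun t => h.1 _, fun t => ?_⟩
  obtain ⟨ε, hε, H⟩ := h.2 (t + a)
  refine ⟨ε, hε, fun r hr => ?_⟩
  have := H r hr
  rwa [add_right_comm] at this

theorem IsTraj.eq_of_eq {v : Fin 2 → ℝ} {τ σ : ℝ → Surface} (hτ : IsTraj v τ) (hσ : IsTraj v σ)
    {a : ℝ} (ha : τ a = σ a) : τ = σ := by
  have key : ∀ {v : Fin 2 → ℝ} {τ σ : ℝ → Surface}, IsTraj v τ → IsTraj v σ → ∀ {a : ℝ},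
      τ a = σ a → ∀ t, a ≤ t → τ t = σ t := by
    intro v τ σ hτ hσ a ha t hat
    have := LinearOn.eq (hτ.linearOn a (t - a)) (hσ.linearOn a (t - a)) (by linarith)
      (fun r _ => hτ.1 _) (by simpa using ha)
    simpa using this
  funext t
  rcases le_total a t with h | h
  · exact key hτ hσ ha t h
  · have := key hτ.neg hσ.neg (a := -a) (by simpa using ha) (-t) (by linarith)
    simpa using this

theorem IsTraj.follow {v : Fin 2 → ℝ} {τ : ℝ → Surface} (hτ : IsTraj v τ) {a R : ℝ}
    {p : Fin 2 → ℝ} (hp : p ∈ octagon) (ha : τ a = pr p) (hq : p + R • v ∈ octagon) :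
    τ (a + R) = pr (p + R • v) := by
  have key : ∀ {v : Fin 2 → ℝ} {τ : ℝ → Surface}, IsTraj v τ → ∀ {a R : ℝ}, 0 ≤ R → τ a = pr p →
      p + R • v ∈ octagon → τ (a + R) = pr (p + R • v) := by
    intro v τ hτ a R hR ha hq
    exact LinearOn.eq (hτ.linearOn a R) (linearOn_pr hp hq) hR (fun r _ => hτ.1 _) (by simpa using ha)
  rcases le_total 0 R with h | h
  · exact key hτ h ha hq
  · have := key hτ.neg (a := -a) (R := -R) (by linarith) (by simpa using ha) (by simpa using hq)
    simpa [add_comm] using this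

theorem IsTraj.periodic {v : Fin 2 → ℝ} {τ : ℝ → Surface} (hτ : IsTraj v τ) {a P : ℝ}
    (h : τ (a + P) = τ a) : ∀ t, τ (t + P) = τ t :=
  fun t => congrFun ((hτ.shift P).eq_of_eq hτ (a := a) h) t


/-! ## Affine automorphisms -/

theorem exists_norm_mulVec_lt (M : Matrix (Fin 2) (Fin 2) ℝ) {ε : ℝ} (hε : 0 < ε) :
    ∃ δ > 0, ∀ u : Fin 2 → ℝ, ‖u‖ < δ → ‖M.mulVec u‖ < ε := by
  have hc : Continuous (fun u : Fin 2 → ℝ => M.mulVec u) := by fun_prop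
  have := Metric.continuous_iff.1 hc 0 ε hε
  obtain ⟨δ, hδ, h⟩ := this
  exact ⟨δ, hδ, fun u hu => by simpa using h u (by simpa using hu)⟩

theorem IsAffineAutomorphism.mem_singularSet {Ψ : Surface ≃ₜ Surface} {M : GL (Fin 2) ℝ}
    (h : IsAffineAutomorphism Ψ M) {x : Surface} : Ψ x ∈ singularSet ↔ x ∈ singularSet := by
  constructor
  · intro hx
    rw [← h.1] at hx
    obtain ⟨y, hy, he⟩ := hx
    rwa [← Ψ.injective he]
  · intro hx
    rw [← h.1]
    exact ⟨x, hx, rfl⟩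

theorem isAffineAutomorphism_refl : IsAffineAutomorphism (Homeomorph.refl Surface) 1 := by
  refine ⟨by simp, fun x _ => ⟨1, one_pos, fun u _ y h => ?_⟩⟩
  simpa using h

theorem IsAffineAutomorphism.comp {Ψ Φ : Surface ≃ₜ Surface} {M N : GL (Fin 2) ℝ}
    (hΨ : IsAffineAutomorphism Ψ M) (hΦ : IsAffineAutomorphism Φ N) :
    IsAffineAutomorphism (Φ.trans Ψ) (M * N) := by
  refine ⟨?_, fun x hx => ?_⟩
  · have : (Φ.trans Ψ : Surface → Surface) = Ψ ∘ Φ := rfl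
    rw [this, Set.image_comp, hΦ.1, hΨ.1]
  · obtain ⟨ε, hε, h⟩ := hΦ.2 x hx
    obtain ⟨ε', hε', h'⟩ := hΨ.2 (Φ x) (fun hs => hx (hΦ.mem_singularSet.1 hs))
    obtain ⟨δ, hδ, hd⟩ := exists_norm_mulVec_lt N.1 hε'
    refine ⟨min ε δ, lt_min hε hδ, fun u hu y hy => ?_⟩
    rw [lt_min_iff] at hu
    have := h' _ (hd u hu.2) _ (h u hu.1 y hy)
    rw [Matrix.mulVec_mulVec] at this
    simpa using this

theorem mulVec_inv_mulVec (M : GL (Fin 2) ℝ) (u : Fin 2 → ℝ) :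
    M.1.mulVec ((M⁻¹).1.mulVec u) = u := by
  rw [Matrix.mulVec_mulVec, ← Units.val_mul, mul_inv_cancel]
  simp

theorem inv_mulVec_mulVec (M : GL (Fin 2) ℝ) (u : Fin 2 → ℝ) :
    (M⁻¹).1.mulVec (M.1.mulVec u) = u := by
  rw [Matrix.mulVec_mulVec, ← Units.val_mul, inv_mul_cancel]
  simp

/-- For small `u` the preimage can be displaced by `M⁻¹ u`; the image of this displacement is one by
`u`, and displacements from a nonsingular point are unique. -/
theorem IsAffineAutomorphism.symm {Ψ : Surface ≃ₜ Surface} {M : GL (Fin 2) ℝ}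
    (h : IsAffineAutomorphism Ψ M) : IsAffineAutomorphism Ψ.symm M⁻¹ := by
  refine ⟨?_, fun x hx => ?_⟩
  · conv_lhs => rw [← h.1]
    rw [← Set.image_comp]
    simp
  · have hx' : Ψ.symm x ∉ singularSet := by
      rw [← h.mem_singularSet]; simpa using hx
    obtain ⟨ε, hε, H⟩ := h.2 _ hx'
    obtain ⟨ε', hε', H'⟩ := exists_displaced hx'
    obtain ⟨δ, hδ, hd⟩ := exists_norm_mulVec_lt (M⁻¹).1 (lt_min hε hε')
    refine ⟨δ, hδ, fun u hu y hy => ?_⟩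
    have hu' := lt_min_iff.1 (hd u hu)
    obtain ⟨z, hz⟩ := H' _ hu'.2
    have := H _ hu'.1 z hz
    rw [mulVec_inv_mulVec, Homeomorph.apply_symm_apply] at this
    rw [Displaced.unique hx hy this, Homeomorph.symm_apply_apply]
    exact hz

theorem IsAffineAutomorphism.isTraj {Ψ : Surface ≃ₜ Surface} {M : GL (Fin 2) ℝ}
    (h : IsAffineAutomorphism Ψ M) {v : Fin 2 → ℝ} {τ : ℝ → Surface} (hτ : IsTraj v τ) :
    IsTraj (M.1.mulVec v) (fun t => Ψ (τ t)) := by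
  refine ⟨fun t => by rw [h.mem_singularSet]; exact hτ.1 t, fun t => ?_⟩
  obtain ⟨ε, hε, H⟩ := h.2 _ (hτ.1 t)
  obtain ⟨ε', hε', H'⟩ := hτ.2 t
  refine ⟨min ε' (ε / (‖v‖ + 1)), lt_min hε' (by positivity), fun r hr => ?_⟩
  rw [lt_min_iff] at hr
  have := H (r • v) ?_ _ (H' r hr.1)
  · rwa [Matrix.mulVec_smul] at this
  · have hn := norm_nonneg v
    rw [lt_div_iff₀ (by positivity)] at hr
    rw [norm_smul, Real.norm_eq_abs]
    nlinarith [abs_nonneg r]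

theorem IsAffineAutomorphism.linearOn {Ψ : Surface ≃ₜ Surface} {M : GL (Fin 2) ℝ}
    (h : IsAffineAutomorphism Ψ M) {v : Fin 2 → ℝ} {R : ℝ} {f : ℝ → Surface}
    (hf : LinearOn v R f) (hns : ∀ r ∈ Set.Icc 0 R, f r ∉ singularSet) :
    LinearOn (M.1.mulVec v) R (fun r => Ψ (f r)) := by
  intro r hr
  obtain ⟨ε, hε, H⟩ := h.2 _ (hns r hr)
  obtain ⟨ε', hε', H'⟩ := hf r hr
  refine ⟨min ε' (ε / (‖v‖ + 1)), lt_min hε' (by positivity), fun s hs hsr => ?_⟩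
  rw [lt_min_iff] at hsr
  have := H ((s - r) • v) ?_ _ (H' s hs hsr.1)
  · rwa [Matrix.mulVec_smul] at this
  · have hn := norm_nonneg v
    rw [lt_div_iff₀ (by positivity)] at hsr
    rw [norm_smul, Real.norm_eq_abs]
    nlinarith [abs_nonneg (s - r)]

theorem eq_zero_of_height_eq_zero {v : Fin 2 → ℝ} {X Y : Letter} (hXY : X ≠ Y)
    (hX : height X v = 0) (hY : height Y v = 0) : v = 0 := by
  have h2 := sqrt_two_gt
  have hs : √2 / 2 ≠ 0 := by positivity
  have : v 0 = 0 ∧ v 1 = 0 := by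
    cases X <;> cases Y <;> simp only [ne_eq, not_true_eq_false] at hXY <;>
      simp only [height_A, height_B, height_C, height_D, mul_eq_zero, hs, false_or] at hX hY <;>
      constructor <;> linarith
  ext i
  fin_cases i
  · exact this.1
  · exact this.2

theorem not_isVertex_of_between {p v : Fin 2 → ℝ} {r R : ℝ} (hv : v ≠ 0) (hp : p ∈ octagon)
    (hq : p + R • v ∈ octagon) (h0 : 0 < r) (h1 : r < R) : ¬ IsVertex (p + r • v) := by
  intro h
  obtain ⟨X, Y, hXY, hX, hY⟩ := h.exists_heights
  have key : ∀ X, |height X (p + r • v)| = 1 → height X v = 0 := by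
    intro X hX
    have a1 := abs_le.1 (hp X)
    have a2 := abs_le.1 (hq X)
    rw [height_add, height_smul] at a2
    have a3 := abs_height_eq_one hX
    rw [height_add, height_smul] at a3
    rcases lt_trichotomy (height X v) 0 with h | h | h
    · rcases a3 with a3 | a3 <;> nlinarith
    · exact h
    · rcases a3 with a3 | a3 <;> nlinarith
  exact hv (eq_zero_of_height_eq_zero hXY (key X hX) (key Y hY))

theorem not_isVertex_zero : ¬ IsVertex 0 := by
  rintro (⟨-, h⟩ | ⟨h, -⟩) <;> simp at h

theorem not_isVertex_smul {p : Fin 2 → ℝ} (hp : p ∈ octagon) {r : ℝ} (h0 : 0 ≤ r) (h1 : r < 1) :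
    ¬ IsVertex (r • p) := by
  rcases h0.eq_or_lt with rfl | h0
  · simpa using not_isVertex_zero
  · rcases eq_or_ne p 0 with rfl | hne
    · simpa using not_isVertex_zero
    · simpa using not_isVertex_of_between (p := 0) (v := p) (R := 1) hne zero_mem_octagon
        (by simpa using hp) h0 h1

/-- Some vertex, subtracted from `q`, leaves a point of the octagon, which is no vertex
unless `q = 0`. -/
theorem exists_vertex_sub_mem {q : Fin 2 → ℝ} (hq : q ∈ octagon) :
    ∃ V, IsVertex V ∧ q - V ∈ octagon ∧ (IsVertex (q - V) → q = 0) := by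
  have r1 := sqrt_two_gt
  have r2 := sqrt_two_lt
  have main : ∀ q : Fin 2 → ℝ, q ∈ octagon → 0 ≤ q 0 → 0 ≤ q 1 →
      ∃ V, IsVertex V ∧ q - V ∈ octagon ∧ (IsVertex (q - V) → q = 0) := by
    intro q hq h0 h1
    obtain ⟨⟨a1, a2⟩, ⟨a3, a4⟩, ⟨a5, a6⟩, a7, a8⟩ := mem_octagon.1 hq
    have habs : |√2 - 1| = √2 - 1 := abs_of_pos (by linarith)
    rcases le_total (q 1) (q 0) with h | h
    · refine ⟨![1, √2 - 1], Or.inr ⟨by simp, by simp⟩, ?_, fun hv => ?_⟩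
      · rw [mem_octagon]
        simp only [Pi.sub_apply, Matrix.cons_val_zero, Matrix.cons_val_one]
        refine ⟨⟨?_, ?_⟩, ⟨?_, ?_⟩, ⟨?_, ?_⟩, ?_, ?_⟩ <;> linarith
      · have := isVertex_cases hv
        simp only [Pi.sub_apply, Matrix.cons_val_zero, Matrix.cons_val_one] at this
        have : q 0 = 0 ∧ q 1 = 0 := by
          rcases this with ⟨h | h, h' | h'⟩ | ⟨h | h, h' | h'⟩ <;>
            first
            | (exfalso; linarith)
            | (constructor <;> linarith)
        ext i; fin_cases i
        exacts [this.1, this.2]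
    · refine ⟨![√2 - 1, 1], Or.inl ⟨by simp, by simp⟩, ?_, fun hv => ?_⟩
      · rw [mem_octagon]
        simp only [Pi.sub_apply, Matrix.cons_val_zero, Matrix.cons_val_one]
        refine ⟨⟨?_, ?_⟩, ⟨?_, ?_⟩, ⟨?_, ?_⟩, ?_, ?_⟩ <;> linarith
      · have := isVertex_cases hv
        simp only [Pi.sub_apply, Matrix.cons_val_zero, Matrix.cons_val_one] at this
        have : q 0 = 0 ∧ q 1 = 0 := by
          rcases this with ⟨h | h, h' | h'⟩ | ⟨h | h, h' | h'⟩ <;>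
            first
            | (exfalso; linarith)
            | (constructor <;> linarith)
        ext i; fin_cases i
        exacts [this.1, this.2]
  have flip : ∀ (s t : ℝ) (p : Fin 2 → ℝ), (s = 1 ∨ s = -1) → (t = 1 ∨ t = -1) → p ∈ octagon →
      ![s * p 0, t * p 1] ∈ octagon := by
    intro s t p hs ht hp
    obtain ⟨⟨a1, a2⟩, ⟨a3, a4⟩, ⟨a5, a6⟩, a7, a8⟩ := mem_octagon.1 hp
    rw [mem_octagon]
    rcases hs with rfl | rfl <;> rcases ht with rfl | rfl <;> simp <;>
      refine ⟨⟨?_, ?_⟩, ⟨?_, ?_⟩, ⟨?_, ?_⟩, ?_, ?_⟩ <;> linarith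
  have flipv : ∀ (s t : ℝ) (p : Fin 2 → ℝ), (s = 1 ∨ s = -1) → (t = 1 ∨ t = -1) →
      IsVertex p → IsVertex ![s * p 0, t * p 1] := by
    intro s t p hs ht hp
    rcases hs with rfl | rfl <;> rcases ht with rfl | rfl <;> simpa [IsVertex] using hp
  have hsgn : ∀ x : ℝ, ∃ s : ℝ, (s = 1 ∨ s = -1) ∧ 0 ≤ s * x := fun x => by
    rcases le_total 0 x with h | h
    · exact ⟨1, by simp, by linarith⟩
    · exact ⟨-1, by simp, by linarith⟩
  -- Reflections in the axes reduce to the first quadrant. The signs `s` and `t` are their own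
  -- inverses, so the same reflection carries the vertex back.
  obtain ⟨s, hs, hs'⟩ := hsgn (q 0)
  obtain ⟨t, ht, ht'⟩ := hsgn (q 1)
  have hss : s * s = 1 := by rcases hs with rfl | rfl <;> norm_num
  have htt : t * t = 1 := by rcases ht with rfl | rfl <;> norm_num
  obtain ⟨V, hV, h1, h2⟩ := main ![s * q 0, t * q 1] (flip s t q hs ht hq) hs' ht'
  have e : q - ![s * V 0, t * V 1] = ![s * ((![s * q 0, t * q 1] - V) 0),
      t * ((![s * q 0, t * q 1] - V) 1)] := by
    ext i; fin_cases i
    · simp; linear_combination (-q 0) * hss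
    · simp; linear_combination (-q 1) * htt
  refine ⟨_, flipv s t V hs ht hV, e ▸ flip s t _ hs ht h1, fun hv => ?_⟩
  have e' : ![s * q 0, t * q 1] - V = ![s * ((q - ![s * V 0, t * V 1]) 0),
      t * ((q - ![s * V 0, t * V 1]) 1)] := by
    ext i; fin_cases i
    · simp; linear_combination (V 0) * hss
    · simp; linear_combination (V 1) * htt
  have hz := h2 (e' ▸ flipv s t _ hs ht hv)
  have z0 : s * q 0 = 0 := by simpa using congrFun hz 0
  have z1 : t * q 1 = 0 := by simpa using congrFun hz 1
  ext i; fin_cases i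
  · show q 0 = 0
    linear_combination s * z0 - q 0 * hss
  · show q 1 = 0
    linear_combination t * z1 - q 1 * htt

/-- Let `q` represent the image of the centre. If `q ≠ 0`, some segment from `q` with the
displacement of a segment from the centre to a vertex stays away from the singular point, although
`Φ` must match the two. So the centre is fixed, and rays from it carry the identity to every other
point. -/
theorem IsAffineAutomorphism.eq_of_one {Φ : Surface ≃ₜ Surface}
    (h : IsAffineAutomorphism Φ 1) (x : Surface) : Φ x = x := by
  have hns0 : pr 0 ∉ singularSet := by
    rw [pr_mem_singularSet zero_mem_octagon]; exact not_isVertex_zero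
  have h0 : Φ (pr 0) = pr 0 := by
    obtain ⟨q, hq, hqe⟩ := exists_pr (Φ (pr 0))
    have hqv : ¬ IsVertex q := by
      rw [← pr_mem_singularSet hq, hqe, h.mem_singularSet]; exact hns0
    obtain ⟨V, hV, h1, h2⟩ := exists_vertex_sub_mem hq
    by_cases hv : IsVertex (q - V)
    · rw [← hqe, h2 hv]
    · exfalso
      have hVne : -V ≠ 0 := fun h => not_isVertex_zero (h ▸ isVertex_neg.2 hV)
      have hnv : -V ∈ octagon := neg_mem_octagon hV.mem
      have hq1 : q + (1 : ℝ) • (-V) ∈ octagon := by simpa [sub_eq_add_neg] using h1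
      have l1 : LinearOn (-V) 1 (fun r => pr (0 + r • (-V))) :=
        linearOn_pr zero_mem_octagon (by simpa using hnv)
      have l2 : LinearOn ((1⁻¹ : GL (Fin 2) ℝ).1.mulVec (-V)) 1
          (fun r => Φ.symm (pr (q + r • (-V)))) := by
        refine h.symm.linearOn (linearOn_pr hq hq1) fun r hr => ?_
        rw [pr_mem_singularSet (add_smul_mem_octagon hq hq1 hr.1 hr.2)]
        rcases hr.1.eq_or_lt with h3 | h3
        · rw [← h3]; simpa using hqv
        · rcases hr.2.eq_or_lt with h4 | h4
          · rw [h4]; simpa [sub_eq_add_neg] using hv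
          · exact not_isVertex_of_between hVne hq hq1 h3 h4
      have l2' : LinearOn (-V) 1 (fun r => Φ.symm (pr (q + r • (-V)))) := by simpa using l2
      -- Both paths start at the centre with velocity `-V`; the first ends at the singular point,
      -- the second does not.
      have := l1.eq l2' zero_le_one (fun r hr => ?_) ?_
      · have e : pr (q - V) = Φ (pr (-V)) := by
          rw [← Homeomorph.symm_apply_eq]
          simpa [sub_eq_add_neg] using this.symm
        have : pr (q - V) ∈ singularSet := by
          rw [e, h.mem_singularSet, pr_mem_singularSet hnv]; exact isVertex_neg.2 hV
        rw [pr_mem_singularSet h1] at this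
        exact hv this
      · have hm := add_smul_mem_octagon zero_mem_octagon (v := -V) (R := 1) (by simpa using hnv)
          hr.1 hr.2.le
        rw [pr_mem_singularSet hm, zero_add]
        exact not_isVertex_smul hnv hr.1 hr.2
      · simp only [zero_smul, add_zero]
        rw [hqe, Homeomorph.symm_apply_apply]
  obtain ⟨p, hp, rfl⟩ := exists_pr x
  by_cases hv : IsVertex p
  · obtain ⟨q, hq, hqe⟩ := exists_pr (Φ (pr p))
    have : IsVertex q := by
      rw [← pr_mem_singularSet hq, hqe, h.mem_singularSet, pr_mem_singularSet hp]; exact hv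
    rw [← hqe]
    exact pr_eq_of_isVertex this hv
  · have hp1 : (0 : Fin 2 → ℝ) + (1 : ℝ) • p ∈ octagon := by simpa using hp
    have hns : ∀ r ∈ Set.Icc (0 : ℝ) 1, pr (0 + r • p) ∉ singularSet := fun r hr => by
      rw [pr_mem_singularSet (add_smul_mem_octagon zero_mem_octagon hp1 hr.1 hr.2), zero_add]
      rcases hr.2.eq_or_lt with h4 | h4
      · rw [h4]; simpa using hv
      · exact not_isVertex_smul hp hr.1 h4
    have l1 := linearOn_pr zero_mem_octagon hp1
    have l2 := h.linearOn l1 hns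
    simp only [Units.val_one, Matrix.one_mulVec] at l2
    have := l1.eq l2 zero_le_one (fun r hr => hns r ⟨hr.1, hr.2.le⟩) (by simpa using h0.symm)
    simpa using this.symm

theorem IsAffineAutomorphism.unique {Ψ Ψ' : Surface ≃ₜ Surface} {M : GL (Fin 2) ℝ}
    (h : IsAffineAutomorphism Ψ M) (h' : IsAffineAutomorphism Ψ' M) : Ψ' = Ψ := by
  have h1 := h.symm.comp h'
  rw [inv_mul_cancel] at h1
  ext x
  have := h1.eq_of_one x
  rw [Homeomorph.trans_apply, Homeomorph.symm_apply_eq] at this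
  exact this


/-! ## Piecewise affine maps of the surface -/

theorem continuous_proj : Continuous proj := continuous_quot_mk

theorem isClosed_octagon : IsClosed octagon := by
  have : octagon = ⋂ X, {p | |height X p| ≤ 1} := by
    ext p; simp [octagon]
  rw [this]
  refine isClosed_iInter fun X => isClosed_le ?_ continuous_const
  unfold height dotProduct
  fun_prop

section Piecewise

variable {ι : Type} [Finite ι] {M : Matrix (Fin 2) (Fin 2) ℝ} {P : ι → Set (Fin 2 → ℝ)}
  {c : ι → Fin 2 → ℝ}

theorem exists_piecewise_affine (hclosed : ∀ i, IsClosed (P i))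
    (hcov : ∀ p ∈ octagon, ∃ i, p ∈ P i)
    (hmem : ∀ i, ∀ p ∈ octagon, p ∈ P i → M.mulVec p + c i ∈ octagon)
    (hcons : ∀ i j, ∀ p ∈ octagon, p ∈ P i → p ∈ P j → pr (M.mulVec p + c i) = pr (M.mulVec p + c j))
    (hglue : ∀ p ∈ octagon, ∀ X, height X p = 1 → ∃ i j, p ∈ P i ∧ p - period X ∈ P j ∧
      pr (M.mulVec p + c i) = pr (M.mulVec (p - period X) + c j)) :
    ∃ F : Surface → Surface, Continuous F ∧
      ∀ i, ∀ p ∈ octagon, p ∈ P i → F (pr p) = pr (M.mulVec p + c i) := by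
  choose idx hidx using hcov
  let Φ : octagon → Surface := fun p => pr (M.mulVec p.1 + c (idx p.1 p.2))
  have hΦ : ∀ i (p : octagon), p.1 ∈ P i → Φ p = pr (M.mulVec p.1 + c i) := fun i p hp =>
    hcons _ _ p.1 p.2 (hidx _ _) hp
  have hcont : Continuous Φ := by
    refine LocallyFinite.continuous (f := fun i : ι => {p : octagon | p.1 ∈ P i})
      (locallyFinite_of_finite _) ?_ (fun i => (hclosed i).preimage continuous_subtype_val) ?_
    · ext p
      exact ⟨fun _ => trivial, fun _ => Set.mem_iUnion.2 ⟨_, hidx p.1 p.2⟩⟩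
    · intro i
      have hg : Continuous (fun p : {p : octagon // p.1 ∈ P i} =>
          (⟨M.mulVec p.1.1 + c i, hmem i p.1.1 p.1.2 p.2⟩ : octagon)) := by
        refine Continuous.subtype_mk ?_ _
        fun_prop
      refine continuousOn_iff_continuous_domRestrict.2 ((continuous_proj.comp hg).congr fun p => ?_)
      exact (proj_eq_pr _).trans (hΦ i p.1 p.2).symm
  have hresp : ∀ p q : octagon, glue p q → Φ p = Φ q := by
    rintro p q ⟨X, h1, h2⟩
    obtain ⟨i, j, hi, hj, h⟩ := hglue p.1 p.2 X h1
    have e : q.1 = p.1 - period X := h2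
    rw [hΦ i p hi, hΦ j q (e ▸ hj), h, e]
  refine ⟨Quot.lift Φ hresp, continuous_quot_lift hresp hcont, fun i p hp hi => ?_⟩
  rw [← proj_eq_pr ⟨p, hp⟩]
  exact hΦ i ⟨p, hp⟩ hi

/-- A nonsingular point has finitely many representatives `p`. As the pieces are closed, for small
`u` a piece containing `p + u` already contains `p`, and one affine formula governs both ends. -/
theorem piecewise_affine_displaced (hclosed : ∀ i, IsClosed (P i))
    (hcov : ∀ p ∈ octagon, ∃ i, p ∈ P i)
    (hmem : ∀ i, ∀ p ∈ octagon, p ∈ P i → M.mulVec p + c i ∈ octagon)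
    {F : Surface → Surface} (hF : ∀ i, ∀ p ∈ octagon, p ∈ P i → F (pr p) = pr (M.mulVec p + c i))
    {x : Surface} (hx : x ∉ singularSet) :
    ∃ ε > 0, ∀ u : Fin 2 → ℝ, ‖u‖ < ε → ∀ y, Displaced x u y → Displaced (F x) (M.mulVec u) (F y) := by
  obtain ⟨p₀, hp₀, hpx⟩ := exists_pr x
  have hfin : {p | p ∈ octagon ∧ pr p = x}.Finite := by
    have : {p | p ∈ octagon ∧ pr p = x} ⊆ {p₀} ∪ Set.range (fun X => p₀ - period X) ∪
        Set.range (fun X => p₀ + period X) := by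
      rintro p ⟨hp, h⟩
      rcases identified_of_pr_eq hp₀ hp (hpx.trans h.symm) with rfl | ⟨X, -, rfl⟩ | ⟨X, -, h2⟩ | h
      · simp
      · left; right; exact ⟨X, rfl⟩
      · right; exact ⟨X, by rw [h2]; simp⟩
      · rw [← hpx, pr_mem_singularSet hp₀] at hx
        exact absurd h.1 hx
    exact (((Set.finite_singleton _).union (Set.finite_range _)).union (Set.finite_range _)).subset this
  have hev : ∀ᶠ u in nhds (0 : Fin 2 → ℝ), ∀ p ∈ {p | p ∈ octagon ∧ pr p = x}, ∀ i,
      p + u ∈ P i → p ∈ P i := by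
    rw [Filter.eventually_all_finite hfin]
    intro p _
    rw [Filter.eventually_all]
    intro i
    by_cases hpi : p ∈ P i
    · exact Filter.Eventually.of_forall fun u _ => hpi
    · have h1 : ∀ᶠ q in nhds (p + 0), q ∈ (P i)ᶜ := by
        rw [add_zero]; exact (hclosed i).isOpen_compl.mem_nhds hpi
      have h2 : Filter.Tendsto (fun u => p + u) (nhds 0) (nhds (p + 0)) :=
        (continuous_const.add continuous_id).tendsto 0
      filter_upwards [h2.eventually h1] with u hu hu'
      exact absurd hu' hu
  obtain ⟨ε, hε, h⟩ := Metric.eventually_nhds_iff.1 hev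
  refine ⟨ε, hε, fun u hu y hy => ?_⟩
  obtain ⟨p, hp, hpu, h1, rfl⟩ := displaced_iff.1 hy
  obtain ⟨i, hi⟩ := hcov _ hpu
  have hpi := h (by simpa using hu) p ⟨hp, h1⟩ i hi
  rw [← h1, hF i p hp hpi, hF i _ hpu hi]
  have e : M.mulVec (p + u) + c i = M.mulVec p + c i + M.mulVec u := by
    rw [Matrix.mulVec_add]; abel
  rw [e]
  exact displaced_pr (hmem i p hp hpi) (e ▸ hmem i _ hpu hi)

end Piecewise

theorem singularSet_eq {p : Fin 2 → ℝ} (hp : IsVertex p) : singularSet = {pr p} := by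
  ext x
  obtain ⟨q, hq, rfl⟩ := exists_pr x
  rw [pr_mem_singularSet hq, Set.mem_singleton_iff]
  constructor
  · intro h; exact pr_eq_of_isVertex h hp
  · intro h; exact ((identified_of_pr_eq hq hp.mem h).isVertex_iff).2 hp

/-! ## The isometries of the octagon -/

/-- The orthogonal matrix `M` carries the sides labelled `X` to those labelled `ϖ X`. -/
def IsOctagonSymmetry (M : Matrix (Fin 2) (Fin 2) ℝ) (ϖ : Letter → Letter) : Prop :=
  M.transpose * M = 1 ∧ Function.Bijective ϖ ∧
    ∀ X, M.mulVec (normal X) = normal (ϖ X) ∨ M.mulVec (normal X) = -normal (ϖ X)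

theorem IsOctagonSymmetry.height {M : Matrix (Fin 2) (Fin 2) ℝ} {ϖ : Letter → Letter}
    (h : IsOctagonSymmetry M ϖ) (X : Letter) (p : Fin 2 → ℝ) :
    (M.mulVec (normal X) = normal (ϖ X) ∧ height (ϖ X) (M.mulVec p) = height X p) ∨
    (M.mulVec (normal X) = -normal (ϖ X) ∧ height (ϖ X) (M.mulVec p) = -height X p) := by
  have key : M.mulVec (normal X) ⬝ᵥ M.mulVec p = normal X ⬝ᵥ p := by
    rw [Matrix.dotProduct_mulVec, Matrix.vecMul_mulVec, ← Matrix.dotProduct_mulVec, h.1,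
      Matrix.one_mulVec]
  rcases h.2.2 X with h1 | h1
  · left
    exact ⟨h1, by rw [Octagon.height, ← h1, key]; rfl⟩
  · right
    refine ⟨h1, ?_⟩
    rw [Octagon.height, ← neg_neg (normal (ϖ X)), ← h1, neg_dotProduct, key]
    rfl

theorem IsOctagonSymmetry.abs_height {M : Matrix (Fin 2) (Fin 2) ℝ} {ϖ : Letter → Letter}
    (h : IsOctagonSymmetry M ϖ) (X : Letter) (p : Fin 2 → ℝ) :
    |Octagon.height (ϖ X) (M.mulVec p)| = |Octagon.height X p| := by
  rcases h.height X p with ⟨-, h1⟩ | ⟨-, h1⟩ <;> rw [h1]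
  rw [abs_neg]

theorem IsOctagonSymmetry.mem {M : Matrix (Fin 2) (Fin 2) ℝ} {ϖ : Letter → Letter}
    (h : IsOctagonSymmetry M ϖ) {p : Fin 2 → ℝ} (hp : p ∈ octagon) : M.mulVec p ∈ octagon := by
  intro Y
  obtain ⟨X, rfl⟩ := h.2.1.2 Y
  rw [h.abs_height]
  exact hp X

theorem IsOctagonSymmetry.exists_map {M : Matrix (Fin 2) (Fin 2) ℝ} {ϖ : Letter → Letter}
    (h : IsOctagonSymmetry M ϖ) : ∃ F : Surface → Surface, Continuous F ∧
      (∀ p ∈ octagon, F (pr p) = pr (M.mulVec p)) ∧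
      ∀ x, x ∉ singularSet → ∃ ε > 0, ∀ u : Fin 2 → ℝ, ‖u‖ < ε → ∀ y, Displaced x u y →
        Displaced (F x) (M.mulVec u) (F y) := by
  have hmem : ∀ i : Unit, ∀ p ∈ octagon, p ∈ (fun _ : Unit => (Set.univ : Set (Fin 2 → ℝ))) i →
      M.mulVec p + (fun _ => 0 : Unit → Fin 2 → ℝ) i ∈ octagon := by
    intro _ p hp _
    simpa using h.mem hp
  have hglue : ∀ p ∈ octagon, ∀ X, Octagon.height X p = 1 → ∃ i j : Unit, p ∈ (Set.univ : Set (Fin 2 → ℝ)) ∧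
      p - period X ∈ (Set.univ : Set (Fin 2 → ℝ)) ∧
      pr (M.mulVec p + (fun _ => 0 : Unit → Fin 2 → ℝ) i) =
        pr (M.mulVec (p - period X) + (fun _ => 0 : Unit → Fin 2 → ℝ) j) := by
    intro p hp X hX
    refine ⟨(), (), trivial, trivial, ?_⟩
    simp only [add_zero]
    rcases h.height X p with ⟨h1, h2⟩ | ⟨h1, h2⟩
    · have : M.mulVec (p - period X) = M.mulVec p - period (ϖ X) := by
        rw [Matrix.mulVec_sub, period, Matrix.mulVec_smul, h1]; rfl
      rw [this, pr_sub_period (h.mem hp) (by rw [h2, hX])]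
    · have : M.mulVec (p - period X) = M.mulVec p + period (ϖ X) := by
        rw [Matrix.mulVec_sub, period, Matrix.mulVec_smul, h1, smul_neg, sub_neg_eq_add]; rfl
      rw [this, pr_add_period (h.mem hp) (by rw [h2, hX])]
  obtain ⟨F, hF, hF'⟩ := exists_piecewise_affine (ι := Unit) (M := M) (P := fun _ => Set.univ)
    (c := fun _ => 0) (fun _ => isClosed_univ) (fun p _ => ⟨(), trivial⟩) hmem
    (fun _ _ _ _ _ _ => rfl) hglue
  refine ⟨F, hF, fun p hp => by simpa using hF' () p hp trivial, fun x hx => ?_⟩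
  exact piecewise_affine_displaced (fun _ => isClosed_univ) (fun p _ => ⟨(), trivial⟩) hmem hF' hx

theorem IsOctagonSymmetry.transpose {M : Matrix (Fin 2) (Fin 2) ℝ} {ϖ : Letter → Letter}
    (h : IsOctagonSymmetry M ϖ) : ∃ σ : Letter → Letter, IsOctagonSymmetry M.transpose σ := by
  refine ⟨(Equiv.ofBijective ϖ h.2.1).symm, ?_, Equiv.bijective _, fun Y => ?_⟩
  · rw [Matrix.transpose_transpose]
    exact mul_eq_one_comm.1 h.1
  · obtain ⟨X, rfl⟩ := h.2.1.2 Y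
    have e : (Equiv.ofBijective ϖ h.2.1).symm (ϖ X) = X :=
      (Equiv.ofBijective ϖ h.2.1).symm_apply_apply X
    rw [e]
    have e2 : M.transpose.mulVec (M.mulVec (normal X)) = normal X := by
      rw [Matrix.mulVec_mulVec, h.1, Matrix.one_mulVec]
    rcases h.2.2 X with h1 | h1
    · left; rw [← h1, e2]
    · right; rw [← neg_neg (normal (ϖ X)), ← h1, Matrix.mulVec_neg, e2]

theorem exists_isVertex : IsVertex ![1, √2 - 1] := by
  have := sqrt_two_gt
  right
  simp

theorem IsOctagonSymmetry.exists_automorphism {M : GL (Fin 2) ℝ} {ϖ : Letter → Letter}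
    (h : IsOctagonSymmetry M.1 ϖ) : ∃ Ψ : Surface ≃ₜ Surface, IsAffineAutomorphism Ψ M ∧
      ∀ x, x ∉ singularSet → ∀ X, Ψ x ∈ side (ϖ X) ↔ x ∈ side X := by
  obtain ⟨F, hF, hF', hFd⟩ := h.exists_map
  obtain ⟨σ, hσ⟩ := h.transpose
  obtain ⟨G, hG, hG', -⟩ := hσ.exists_map
  have e1 : ∀ p, M.1.transpose.mulVec (M.1.mulVec p) = p := fun p => by
    rw [Matrix.mulVec_mulVec, h.1, Matrix.one_mulVec]
  have e2 : ∀ p, M.1.mulVec (M.1.transpose.mulVec p) = p := fun p => by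
    rw [Matrix.mulVec_mulVec, mul_eq_one_comm.1 h.1, Matrix.one_mulVec]
  let Ψ : Surface ≃ₜ Surface :=
    { toFun := F
      invFun := G
      left_inv := fun x => by
        obtain ⟨p, hp, rfl⟩ := exists_pr x
        rw [hF' p hp, hG' _ (h.mem hp), e1]
      right_inv := fun x => by
        obtain ⟨p, hp, rfl⟩ := exists_pr x
        rw [hG' p hp, hF' _ (hσ.mem hp), e2]
      continuous_toFun := hF
      continuous_invFun := hG }
  have hvert : ∀ p ∈ octagon, IsVertex (M.1.mulVec p) ↔ IsVertex p := by
    intro p hp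
    constructor
    · intro hv
      obtain ⟨X, Y, hXY, hX, hY⟩ := hv.exists_heights
      obtain ⟨X, rfl⟩ := h.2.1.2 X
      obtain ⟨Y, rfl⟩ := h.2.1.2 Y
      rw [h.abs_height] at hX hY
      exact isVertex_of_abs_height hp (fun h => hXY (by rw [h])) hX hY
    · intro hv
      obtain ⟨X, Y, hXY, hX, hY⟩ := hv.exists_heights
      rw [← h.abs_height] at hX hY
      exact isVertex_of_abs_height (h.mem hp) (fun h' => hXY (h.2.1.1 h')) hX hY
  refine ⟨Ψ, ⟨?_, hFd⟩, fun x hx X => ?_⟩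
  · rw [singularSet_eq exists_isVertex, Set.image_singleton]
    show {F _} = _
    rw [hF' _ exists_isVertex.mem, pr_eq_of_isVertex ((hvert _ exists_isVertex.mem).2
      exists_isVertex) exists_isVertex]
  · obtain ⟨p, hp, rfl⟩ := exists_pr x
    rw [pr_mem_singularSet hp] at hx
    show F _ ∈ _ ↔ _
    rw [hF' p hp, pr_mem_side (h.mem hp) (by rwa [hvert p hp]), h.abs_height, pr_mem_side hp hx]

theorem val_nu (j : Fin 8) : (nu j).1 = nuMatrix j := rfl

theorem isOctagonSymmetry_nu (j : Fin 8) : IsOctagonSymmetry (nu j).1 (perm j) := by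
  have h1 := sqrt_two_mul_self
  rw [val_nu]
  refine ⟨?_, ?_, ?_⟩
  · ext a b
    fin_cases j <;> fin_cases a <;> fin_cases b <;>
      simp [nuMatrix, Matrix.mul_apply, Fin.sum_univ_two] <;> ring_nf <;> norm_num
  · fin_cases j <;> constructor <;>
      first
      | (intro X Y; cases X <;> cases Y <;> simp [perm, letterMap])
      | (intro Y; cases Y <;>
          first
          | exact ⟨.A, rfl⟩
          | exact ⟨.B, rfl⟩
          | exact ⟨.C, rfl⟩
          | exact ⟨.D, rfl⟩)
  · have ext2 : ∀ u v : Fin 2 → ℝ, u = v ↔ u 0 = v 0 ∧ u 1 = v 1 := fun u v => by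
      constructor
      · rintro rfl; simp
      · rintro ⟨h, h'⟩; ext i; fin_cases i <;> assumption
    intro X
    fin_cases j <;> cases X <;> simp only [ext2, nuMatrix, Matrix.mulVec, dotProduct,
      Fin.sum_univ_two, inv_sqrt_two, perm, normal_zero, normal_one, Pi.neg_apply] <;> simp [letterMap] <;>
      first
      | (left; linarith)
      | (right; linarith)

theorem isOctagonSymmetry_neg : IsOctagonSymmetry (-1 : GL (Fin 2) ℝ).1 id := by
  refine ⟨by simp, Function.bijective_id, fun X => Or.inr ?_⟩
  rw [Units.val_neg, Units.val_one, Matrix.neg_mulVec, Matrix.one_mulVec, id]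


/-! ## The affine automorphism with derivative `γ` -/

/-- The horizontal strips of the octagon: the central rectangle and the two trapezoids. -/
def strip : Fin 3 → Set (Fin 2 → ℝ) :=
  ![{p | -(√2 - 1) ≤ p 1 ∧ p 1 ≤ √2 - 1}, {p | √2 - 1 ≤ p 1}, {p | p 1 ≤ -(√2 - 1)}]

/-- The translation parts of the pieces of the automorphism. -/
def twist : Fin 3 → Fin 3 → (Fin 2 → ℝ) :=
  ![![![-2, 0], ![0, 0], ![2, 0]],
    ![![-2, 0], ![-2 - √2, -√2], ![-2 - 2 * √2, 0]],
    ![![2, 0], ![2 + √2, √2], ![2 + 2 * √2, 0]]]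

theorem gam_mulVec_zero (p : Fin 2 → ℝ) : gam.1.mulVec p 0 = -p 0 + 2 * (1 + √2) * p 1 := by
  simp [gam, Matrix.GeneralLinearGroup.mkOfDetNeZero, Matrix.mulVec, dotProduct, Fin.sum_univ_two]

theorem gam_mulVec_one (p : Fin 2 → ℝ) : gam.1.mulVec p 1 = p 1 := by
  simp [gam, Matrix.GeneralLinearGroup.mkOfDetNeZero, Matrix.mulVec, dotProduct, Fin.sum_univ_two]

/-- The piece of the octagon on which the automorphism is `p ↦ γ p + twist i k`. -/
def twistPiece (i : Fin 3 × Fin 3) : Set (Fin 2 → ℝ) :=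
  {p | p ∈ strip i.1 ∧ gam.1.mulVec p + twist i.1 i.2 ∈ octagon}

theorem mem_twistPiece {i k : Fin 3} {p : Fin 2 → ℝ} : p ∈ twistPiece (i, k) ↔ p ∈ strip i ∧
    (-1 ≤ -p 0 + 2 * (1 + √2) * p 1 + twist i k 0 ∧ -p 0 + 2 * (1 + √2) * p 1 + twist i k 0 ≤ 1) ∧
    (-1 ≤ p 1 + twist i k 1 ∧ p 1 + twist i k 1 ≤ 1) ∧
    (-√2 ≤ -p 0 + 2 * (1 + √2) * p 1 + twist i k 0 + (p 1 + twist i k 1) ∧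
      -p 0 + 2 * (1 + √2) * p 1 + twist i k 0 + (p 1 + twist i k 1) ≤ √2) ∧
    (-√2 ≤ -p 0 + 2 * (1 + √2) * p 1 + twist i k 0 - (p 1 + twist i k 1) ∧
      -p 0 + 2 * (1 + √2) * p 1 + twist i k 0 - (p 1 + twist i k 1) ≤ √2) := by
  rw [twistPiece, Set.mem_ofPred_eq, mem_octagon]
  simp only [Pi.add_apply, gam_mulVec_zero, gam_mulVec_one]

theorem isClosed_twistPiece (i : Fin 3 × Fin 3) : IsClosed (twistPiece i) := by
  obtain ⟨i, k⟩ := i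
  refine IsClosed.inter ?_ (isClosed_octagon.preimage (by fun_prop))
  fin_cases i
  · exact (isClosed_le continuous_const (continuous_apply 1)).inter
      (isClosed_le (continuous_apply 1) continuous_const)
  · exact isClosed_le continuous_const (continuous_apply 1)
  · exact isClosed_le (continuous_apply 1) continuous_const

theorem ext_fin_two {p q : Fin 2 → ℝ} (h0 : p 0 = q 0) (h1 : p 1 = q 1) : p = q := by
  ext i; fin_cases i <;> assumption

theorem sqrt_two_mul_mono {a b : ℝ} (h : a ≤ b) : √2 * a ≤ √2 * b :=
  mul_le_mul_of_nonneg_left h (by positivity)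

theorem exists_twistPiece_middle {p : Fin 2 → ℝ} (hp : p ∈ octagon) (h : p ∈ strip 0) :
    ∃ k, p ∈ twistPiece (0, k) := by
  have r0 := sqrt_two_mul_self
  have r1 := sqrt_two_gt
  have r2 := sqrt_two_lt
  obtain ⟨⟨a1, a2⟩, ⟨a3, a4⟩, ⟨a5, a6⟩, a7, a8⟩ := mem_octagon.1 hp
  have h' : -(√2 - 1) ≤ p 1 ∧ p 1 ≤ √2 - 1 := h
  have m1 := sqrt_two_mul_mono h'.1
  have m2 := sqrt_two_mul_mono h'.2
  rcases le_total (-p 0 + 2 * (1 + √2) * p 1) (-1) with c | c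
  · refine ⟨2, mem_twistPiece.2 ⟨h, ?_⟩⟩
    simp [twist]
    refine ⟨⟨?_, ?_⟩, ⟨?_, ?_⟩, ⟨?_, ?_⟩, ?_, ?_⟩ <;> linarith
  · rcases le_total (-p 0 + 2 * (1 + √2) * p 1) 1 with c | c
    · refine ⟨1, mem_twistPiece.2 ⟨h, ?_⟩⟩
      simp [twist]
      refine ⟨⟨?_, ?_⟩, ⟨?_, ?_⟩, ⟨?_, ?_⟩, ?_, ?_⟩ <;> linarith
    · refine ⟨0, mem_twistPiece.2 ⟨h, ?_⟩⟩
      simp [twist]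
      refine ⟨⟨?_, ?_⟩, ⟨?_, ?_⟩, ⟨?_, ?_⟩, ?_, ?_⟩ <;> linarith

theorem mem_twistPiece_top_zero {p : Fin 2 → ℝ} (hp : p ∈ octagon) (h : p ∈ strip 1)
    (c : -p 0 + 2 * (1 + √2) * p 1 - 2 ≤ √2 - p 1) : p ∈ twistPiece (1, 0) := by
  have r0 := sqrt_two_mul_self
  have r1 := sqrt_two_gt
  have r2 := sqrt_two_lt
  obtain ⟨⟨a1, a2⟩, ⟨a3, a4⟩, ⟨a5, a6⟩, a7, a8⟩ := mem_octagon.1 hp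
  have h' : √2 - 1 ≤ p 1 := h
  have m1 := sqrt_two_mul_mono h'
  refine mem_twistPiece.2 ⟨h, ?_⟩
  simp [twist]
  refine ⟨⟨?_, ?_⟩, ⟨?_, ?_⟩, ⟨?_, ?_⟩, ?_, ?_⟩ <;> linarith

theorem mem_twistPiece_top_one {p : Fin 2 → ℝ} (hp : p ∈ octagon) (h : p ∈ strip 1)
    (c : √2 - p 1 ≤ -p 0 + 2 * (1 + √2) * p 1 - 2) (c' : -p 0 + 2 * (1 + √2) * p 1 - 2 ≤ √2 + p 1) :
    p ∈ twistPiece (1, 1) := by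
  have r0 := sqrt_two_mul_self
  have r1 := sqrt_two_gt
  have r2 := sqrt_two_lt
  obtain ⟨⟨a1, a2⟩, ⟨a3, a4⟩, ⟨a5, a6⟩, a7, a8⟩ := mem_octagon.1 hp
  have h' : √2 - 1 ≤ p 1 := h
  refine mem_twistPiece.2 ⟨h, ?_⟩
  simp [twist]
  refine ⟨⟨?_, ?_⟩, ⟨?_, ?_⟩, ⟨?_, ?_⟩, ?_, ?_⟩ <;> linarith

theorem mem_twistPiece_top_two {p : Fin 2 → ℝ} (hp : p ∈ octagon) (h : p ∈ strip 1)
    (c : √2 + p 1 ≤ -p 0 + 2 * (1 + √2) * p 1 - 2) : p ∈ twistPiece (1, 2) := by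
  have r0 := sqrt_two_mul_self
  have r1 := sqrt_two_gt
  have r2 := sqrt_two_lt
  obtain ⟨⟨a1, a2⟩, ⟨a3, a4⟩, ⟨a5, a6⟩, a7, a8⟩ := mem_octagon.1 hp
  have h' : √2 - 1 ≤ p 1 := h
  have m1 := sqrt_two_mul_mono a4
  refine mem_twistPiece.2 ⟨h, ?_⟩
  simp [twist]
  refine ⟨⟨?_, ?_⟩, ⟨?_, ?_⟩, ⟨?_, ?_⟩, ?_, ?_⟩ <;> linarith

theorem exists_twistPiece_top {p : Fin 2 → ℝ} (hp : p ∈ octagon) (h : p ∈ strip 1) :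
    ∃ k, p ∈ twistPiece (1, k) := by
  rcases le_total (-p 0 + 2 * (1 + √2) * p 1 - 2) (√2 - p 1) with c | c
  · exact ⟨0, mem_twistPiece_top_zero hp h c⟩
  · rcases le_total (-p 0 + 2 * (1 + √2) * p 1 - 2) (√2 + p 1) with c' | c'
    · exact ⟨1, mem_twistPiece_top_one hp h c c'⟩
    · exact ⟨2, mem_twistPiece_top_two hp h c'⟩

theorem neg_mem_strip {p : Fin 2 → ℝ} : -p ∈ strip 1 ↔ p ∈ strip 2 := by
  show √2 - 1 ≤ -p 1 ↔ p 1 ≤ -(√2 - 1)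
  constructor <;> intro h <;> linarith

theorem twist_neg (k : Fin 3) : twist 2 k = -twist 1 k := by
  fin_cases k <;> simp [twist] <;> ring

theorem neg_mem_twistPiece {p : Fin 2 → ℝ} {k : Fin 3} :
    -p ∈ twistPiece (1, k) ↔ p ∈ twistPiece (2, k) := by
  rw [twistPiece, twistPiece, Set.mem_ofPred_eq, Set.mem_ofPred_eq, neg_mem_strip, twist_neg,
    Matrix.mulVec_neg]
  have : -gam.1.mulVec p + twist 1 k = -(gam.1.mulVec p + -twist 1 k) := by abel
  rw [this]
  refine and_congr_right fun _ => ⟨fun h => ?_, neg_mem_octagon⟩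
  simpa using neg_mem_octagon h

theorem exists_twistPiece {p : Fin 2 → ℝ} (hp : p ∈ octagon) : ∃ i, p ∈ twistPiece i := by
  rcases le_total (p 1) (-(√2 - 1)) with h | h
  · obtain ⟨k, hk⟩ := exists_twistPiece_top (neg_mem_octagon hp) (neg_mem_strip.2 h)
    exact ⟨(2, k), neg_mem_twistPiece.1 hk⟩
  · rcases le_total (p 1) (√2 - 1) with h' | h'
    · obtain ⟨k, hk⟩ := exists_twistPiece_middle hp ⟨h, h'⟩
      exact ⟨(0, k), hk⟩
    · obtain ⟨k, hk⟩ := exists_twistPiece_top hp h'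
      exact ⟨(1, k), hk⟩

theorem pr_eq_of_eq_sub_period {p q : Fin 2 → ℝ} (hp : p ∈ octagon) (hq : q ∈ octagon) (X : Letter)
    (h : q = p - period X) : pr p = pr q := by
  have h1 := abs_le.1 (hp X)
  have h2 := abs_le.1 (hq X)
  rw [h, height_sub, height_period] at h2
  rw [h, pr_sub_period hp (by linarith)]

theorem twist_zero_zero (k : Fin 3) : twist 0 k 1 = 0 := by
  fin_cases k <;> rfl

theorem isVertex_of_right {p : Fin 2 → ℝ} (h0 : p 0 = 1 ∨ p 0 = -1)
    (h1 : p 1 = √2 - 1 ∨ p 1 = 1 - √2) : IsVertex p := by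
  have r1 := sqrt_two_gt
  right
  refine ⟨by rcases h0 with h | h <;> simp [h], ?_⟩
  rcases h1 with h | h <;> rw [h]
  · exact abs_of_pos (by linarith)
  · rw [abs_sub_comm]; exact abs_of_pos (by linarith)

theorem isVertex_of_top {p : Fin 2 → ℝ} (h1 : p 0 = √2 - 1 ∨ p 0 = 1 - √2)
    (h0 : p 1 = 1 ∨ p 1 = -1) : IsVertex p := by
  have r1 := sqrt_two_gt
  left
  refine ⟨?_, by rcases h0 with h | h <;> simp [h]⟩
  rcases h1 with h | h <;> rw [h]
  · exact abs_of_pos (by linarith)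
  · rw [abs_sub_comm]; exact abs_of_pos (by linarith)

/-- The image of `p` under the piece of index `i`. -/
def twistImage (i : Fin 3 × Fin 3) (p : Fin 2 → ℝ) : Fin 2 → ℝ := gam.1.mulVec p + twist i.1 i.2

theorem twistImage_zero (i : Fin 3 × Fin 3) (p : Fin 2 → ℝ) :
    twistImage i p 0 = -p 0 + 2 * (1 + √2) * p 1 + twist i.1 i.2 0 := by
  simp only [twistImage, Pi.add_apply, gam_mulVec_zero]

theorem twistImage_one (i : Fin 3 × Fin 3) (p : Fin 2 → ℝ) :
    twistImage i p 1 = p 1 + twist i.1 i.2 1 := by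
  simp only [twistImage, Pi.add_apply, gam_mulVec_one]

theorem twistImage_neg (k : Fin 3) (p : Fin 2 → ℝ) :
    twistImage (1, k) (-p) = -twistImage (2, k) p := by
  simp only [twistImage, twist_neg, Matrix.mulVec_neg]
  abel

theorem pr_neg_eq {p q : Fin 2 → ℝ} (hp : p ∈ octagon) (hq : q ∈ octagon)
    (h : pr (-p) = pr (-q)) : pr p = pr q := by
  have h1 := identified_of_pr_eq (neg_mem_octagon hp) (neg_mem_octagon hq) h
  refine Identified.pr_eq hp hq ?_
  rcases h1 with h1 | ⟨X, h1, h2⟩ | ⟨X, h1, h2⟩ | h1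
  · exact Or.inl (neg_injective h1)
  · refine Or.inr (Or.inr (Or.inl ⟨X, ?_, ?_⟩))
    · have : height X (-q) = -1 := by rw [h2, height_sub, h1, height_period]; norm_num
      rw [height_neg] at this; linarith
    · rw [← neg_neg p, ← neg_neg q, h2]; abel
  · refine Or.inr (Or.inl ⟨X, ?_, ?_⟩)
    · have : height X (-p) = -1 := by rw [h2, height_sub, h1, height_period]; norm_num
      rw [height_neg] at this; linarith
    · rw [← neg_neg q, ← neg_neg p, h2]; abel
  · exact Or.inr (Or.inr (Or.inr ⟨isVertex_neg.1 h1.1, isVertex_neg.1 h1.2⟩))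

/-- Neighbouring translation parts differ by the period of `C`, so the two images are glued; the
outer two pieces are disjoint. -/
theorem twistImage_middle_eq {p : Fin 2 → ℝ} {k l : Fin 3}
    (h1 : p ∈ twistPiece (0, k)) (h2 : p ∈ twistPiece (0, l)) :
    pr (twistImage (0, k) p) = pr (twistImage (0, l) p) := by
  have hk : twistImage (0, k) p ∈ octagon := h1.2
  have hl : twistImage (0, l) p ∈ octagon := h2.2
  have c1 := (mem_twistPiece.1 h1).2.1
  have c2 := (mem_twistPiece.1 h2).2.1
  have key : ∀ k l : Fin 3, twist 0 k 0 = twist 0 l 0 + 2 →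
      pr (twistImage (0, k) p) = pr (twistImage (0, l) p) ∨ ¬ (p ∈ twistPiece (0, k) ∧
        p ∈ twistPiece (0, l)) := by
    intro k l h
    by_cases hkl : p ∈ twistPiece (0, k) ∧ p ∈ twistPiece (0, l)
    · refine Or.inl (pr_eq_of_eq_sub_period hkl.1.2 hkl.2.2 .C (ext_fin_two ?_ ?_))
      · simp [twistImage_zero, h]; ring
      · simp [twistImage_one, twist_zero_zero]
    · exact Or.inr hkl
  have k1 : twist 0 1 0 = twist 0 0 0 + 2 := by simp [twist]
  have k2 : twist 0 2 0 = twist 0 1 0 + 2 := by simp [twist]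
  fin_cases k <;> fin_cases l <;> simp only [Fin.zero_eta, Fin.mk_one, Fin.reduceFinMk] at *
  · exact ((key _ _ k1).resolve_right (not_not_intro ⟨h2, h1⟩)).symm
  · exfalso; simp [twist] at c1 c2; linarith
  · exact (key _ _ k1).resolve_right (not_not_intro ⟨h1, h2⟩)
  · exact ((key _ _ k2).resolve_right (not_not_intro ⟨h2, h1⟩)).symm
  · exfalso; simp [twist] at c1 c2; linarith
  · exact (key _ _ k2).resolve_right (not_not_intro ⟨h1, h2⟩)

/-- Here the successive translation parts differ by the periods of `B` and `D`, and again the outer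
two pieces are disjoint. -/
theorem twistImage_top_eq {p : Fin 2 → ℝ} {k l : Fin 3}
    (h1 : p ∈ twistPiece (1, k)) (h2 : p ∈ twistPiece (1, l)) :
    pr (twistImage (1, k) p) = pr (twistImage (1, l) p) := by
  have r1 := sqrt_two_gt
  have c1 := (mem_twistPiece.1 h1).2.1
  have c2 := (mem_twistPiece.1 h2).2.1
  have key : ∀ (X : Letter) (k l : Fin 3), twist 1 l = twist 1 k - period X →
      p ∈ twistPiece (1, k) → p ∈ twistPiece (1, l) →
      pr (twistImage (1, k) p) = pr (twistImage (1, l) p) := by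
    intro X k l h h1 h2
    refine pr_eq_of_eq_sub_period h1.2 h2.2 X ?_
    simp only [twistImage, h]; abel
  have k1 : twist 1 1 = twist 1 0 - period .B :=
    ext_fin_two (by simp [twist]) (by simp [twist])
  have k2 : twist 1 2 = twist 1 1 - period .D :=
    ext_fin_two (by simp [twist]; ring) (by simp [twist])
  fin_cases k <;> fin_cases l <;> simp only [Fin.zero_eta, Fin.mk_one, Fin.reduceFinMk] at *
  · exact key _ _ _ k1 h1 h2
  · exfalso; simp [twist] at c1 c2; linarith
  · exact (key _ _ _ k1 h2 h1).symm
  · exact key _ _ _ k2 h1 h2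
  · exfalso; simp [twist] at c1 c2; linarith
  · exact (key _ _ _ k2 h2 h1).symm

/-- On the common edge the shear contributes `2 * (1 + √2) * (√2 - 1) = 2`, so the two formulas
agree, or agree modulo the period of `C`. The piece `(1, 1)` meets the edge only at its left end,
where both images are vertices. -/
theorem twistImage_middle_top_eq {p : Fin 2 → ℝ} {k l : Fin 3}
    (h1 : p ∈ twistPiece (0, k)) (h2 : p ∈ twistPiece (1, l)) :
    pr (twistImage (0, k) p) = pr (twistImage (1, l) p) := by
  have r0 := sqrt_two_mul_self
  have r1 := sqrt_two_gt
  have c1 := (mem_twistPiece.1 h1).2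
  have c2 := (mem_twistPiece.1 h2).2
  have hy : p 1 = √2 - 1 := le_antisymm h1.1.2 h2.1
  have hm : 2 * (1 + √2) * (√2 - 1) = 2 := by linarith
  rw [hy, hm] at c1 c2
  obtain ⟨⟨a1, a2⟩, -, -, -⟩ := c1
  obtain ⟨⟨b1, b2⟩, ⟨b3, b4⟩, ⟨b5, b6⟩, b7, b8⟩ := c2
  have v0 : p 0 = -1 → IsVertex (twistImage (0, k) p) := by
    intro h
    apply isVertex_of_right
    · rw [twistImage_zero, hy, hm, h]
      rw [h] at a1 a2
      fin_cases k <;> simp [twist] at * <;> first | (left; linarith) | (exfalso; linarith)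
    · left; rw [twistImage_one, hy, twist_zero_zero]; ring
  fin_cases l <;> simp only [Fin.zero_eta, Fin.mk_one, Fin.reduceFinMk] at *
  · fin_cases k <;> simp only [Fin.zero_eta, Fin.mk_one, Fin.reduceFinMk] at *
    · congr 1
    · refine pr_eq_of_eq_sub_period h1.2 h2.2 .C (ext_fin_two ?_ ?_) <;>
        simp [twistImage_zero, twistImage_one, twist]; ring
    · exfalso; simp [twist] at *; linarith
  · have h : p 0 = -1 := by
      have : p 0 ≤ -1 := by simp [twist] at *; linarith
      have : -1 ≤ p 0 := by
        simp [twist] at b1 b2 b3 b4 b5 b6 b7 b8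
        fin_cases k <;> simp [twist] at a1 a2 <;> linarith
      linarith
    refine pr_eq_of_isVertex (v0 h) (isVertex_of_top (Or.inr ?_) (Or.inr ?_))
    · rw [twistImage_zero, hy, hm, h]; simp [twist]; ring
    · rw [twistImage_one, hy]; simp [twist]; ring
  · exfalso
    simp [twist] at b1 b2 b3 b4 b5 b6 b7 b8
    fin_cases k <;> simp [twist] at a1 a2 <;> linarith

theorem neg_mem_twistPiece_middle {p : Fin 2 → ℝ} {k : Fin 3} :
    p ∈ twistPiece (0, k) → ∃ l, -p ∈ twistPiece (0, l) ∧
      twistImage (0, l) (-p) = -twistImage (0, k) p := by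
  intro h
  have hs : -p ∈ strip 0 := by
    have : -(√2 - 1) ≤ p 1 ∧ p 1 ≤ √2 - 1 := h.1
    show -(√2 - 1) ≤ -p 1 ∧ -p 1 ≤ √2 - 1
    constructor <;> linarith
  have e : ∃ l, twist 0 l = -twist 0 k := by
    fin_cases k
    · exact ⟨2, by simp [twist]⟩
    · exact ⟨1, by simp [twist]⟩
    · exact ⟨0, by simp [twist]⟩
  obtain ⟨l, hl⟩ := e
  have e2 : twistImage (0, l) (-p) = -twistImage (0, k) p := by
    simp only [twistImage, hl, Matrix.mulVec_neg]; abel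
  exact ⟨l, ⟨hs, by
    have : twistImage (0, l) (-p) ∈ octagon := e2 ▸ neg_mem_octagon h.2
    exact this⟩, e2⟩

theorem twistImage_eq {p : Fin 2 → ℝ} {i j : Fin 3 × Fin 3} (h1 : p ∈ twistPiece i)
    (h2 : p ∈ twistPiece j) : pr (twistImage i p) = pr (twistImage j p) := by
  have r1 := sqrt_two_gt
  obtain ⟨i, k⟩ := i
  obtain ⟨j, l⟩ := j
  have mb : ∀ k l, p ∈ twistPiece (0, k) → p ∈ twistPiece (2, l) →
      pr (twistImage (0, k) p) = pr (twistImage (2, l) p) := by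
    intro k l h1 h2
    obtain ⟨k', h3, h4⟩ := neg_mem_twistPiece_middle h1
    refine pr_neg_eq h1.2 h2.2 ?_
    rw [← h4, ← twistImage_neg]
    exact twistImage_middle_top_eq h3 (neg_mem_twistPiece.2 h2)
  have tb : ∀ k l, p ∈ twistPiece (1, k) → p ∈ twistPiece (2, l) → False := by
    intro k l h1 h2
    have a : √2 - 1 ≤ p 1 := h1.1
    have b : p 1 ≤ -(√2 - 1) := h2.1
    linarith
  fin_cases i <;> fin_cases j
  · exact twistImage_middle_eq h1 h2
  · exact twistImage_middle_top_eq h1 h2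
  · exact mb _ _ h1 h2
  · exact (twistImage_middle_top_eq h2 h1).symm
  · exact twistImage_top_eq h1 h2
  · exact (tb _ _ h1 h2).elim
  · exact (mb _ _ h2 h1).symm
  · exact (tb _ _ h2 h1).elim
  · refine pr_neg_eq h1.2 h2.2 ?_
    have := twistImage_top_eq (neg_mem_twistPiece.2 h1) (neg_mem_twistPiece.2 h2)
    rwa [twistImage_neg, twistImage_neg] at this

theorem mem_twistPiece_of_eq {i j : Fin 3 × Fin 3} {p q : Fin 2 → ℝ} (h : p ∈ twistPiece i)
    (hq : q ∈ strip j.1) (e : twistImage i p = twistImage j q) : q ∈ twistPiece j :=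
  ⟨hq, by
    have h' : twistImage i p ∈ octagon := h.2
    rw [e] at h'
    exact h'⟩

/-- A point of the side `B` and the opposite point have the same image. -/
theorem exists_twistPiece_B {p : Fin 2 → ℝ} (hp : p ∈ octagon) (h : p 0 + p 1 = √2) :
    ∃ k l, ((k = 0 ∧ l = 1) ∨ (k = 1 ∧ l = 0)) ∧ p ∈ twistPiece (1, k) ∧
      p - period .B ∈ twistPiece (2, l) ∧ twistImage (1, k) p = twistImage (2, l) (p - period .B) := by
  have r0 := sqrt_two_mul_self
  have r1 := sqrt_two_gt
  have r2 := sqrt_two_lt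
  obtain ⟨⟨a1, a2⟩, ⟨a3, a4⟩, ⟨a5, a6⟩, a7, a8⟩ := mem_octagon.1 hp
  have hs : p ∈ strip 1 := show √2 - 1 ≤ p 1 by linarith
  have hs' : p - period .B ∈ strip 2 := by
    show p 1 - period .B 1 ≤ -(√2 - 1)
    simp; linarith
  have m1 := sqrt_two_mul_mono a4
  have hm : √2 * p 0 = 2 - √2 * p 1 := by
    have : √2 * (p 0 + p 1) = 2 := by rw [h, r0]
    linarith
  rcases le_total (-p 0 + 2 * (1 + √2) * p 1 - 2) (√2 - p 1) with c | c
  · have hk := mem_twistPiece_top_zero hp hs c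
    have e : twistImage (1, 0) p = twistImage (2, 1) (p - period .B) := by
      apply ext_fin_two
      · simp [twistImage_zero, twist]; linarith
      · simp [twistImage_one, twist]
    exact ⟨0, 1, by simp, hk, mem_twistPiece_of_eq hk hs' e, e⟩
  · have hk := mem_twistPiece_top_one hp hs c (by linarith)
    have e : twistImage (1, 1) p = twistImage (2, 0) (p - period .B) := by
      apply ext_fin_two
      · simp [twistImage_zero, twist]; linarith
      · simp [twistImage_one, twist]; ring
    exact ⟨1, 0, by simp, hk, mem_twistPiece_of_eq hk hs' e, e⟩

theorem exists_twistPiece_D {p : Fin 2 → ℝ} (hp : p ∈ octagon) (h : p 0 - p 1 = √2) :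
    ∃ k l, ((k = 1 ∧ l = 2) ∨ (k = 2 ∧ l = 1)) ∧ p ∈ twistPiece (2, k) ∧
      p - period .D ∈ twistPiece (1, l) ∧ twistImage (2, k) p = twistImage (1, l) (p - period .D) := by
  have r0 := sqrt_two_mul_self
  have r1 := sqrt_two_gt
  have r2 := sqrt_two_lt
  obtain ⟨⟨a1, a2⟩, ⟨a3, a4⟩, ⟨a5, a6⟩, a7, a8⟩ := mem_octagon.1 hp
  have hs : p ∈ strip 2 := show p 1 ≤ -(√2 - 1) by linarith
  have hs' : p - period .D ∈ strip 1 := by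
    show √2 - 1 ≤ p 1 - period .D 1
    simp; linarith
  have m1 := sqrt_two_mul_mono (show p 1 ≤ 1 - √2 by linarith)
  have hm : √2 * p 0 = 2 + √2 * p 1 := by
    have : √2 * (p 0 - p 1) = 2 := by rw [h, r0]
    linarith
  rcases le_total (-1) (√2 * p 1) with c | c
  · have hk : p ∈ twistPiece (2, 1) := by
      rw [← neg_mem_twistPiece]
      refine mem_twistPiece_top_one (neg_mem_octagon hp) (neg_mem_strip.2 hs) ?_ ?_
      · simp; linarith
      · simp; linarith
    have e : twistImage (2, 1) p = twistImage (1, 2) (p - period .D) := by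
      apply ext_fin_two
      · simp [twistImage_zero, twist]; linarith
      · simp [twistImage_one, twist]
    exact ⟨1, 2, by simp, hk, mem_twistPiece_of_eq hk hs' e, e⟩
  · have hk : p ∈ twistPiece (2, 2) := by
      rw [← neg_mem_twistPiece]
      refine mem_twistPiece_top_two (neg_mem_octagon hp) (neg_mem_strip.2 hs) ?_
      simp; linarith
    have e : twistImage (2, 2) p = twistImage (1, 1) (p - period .D) := by
      apply ext_fin_two
      · simp [twistImage_zero, twist]; linarith
      · simp [twistImage_one, twist]
    exact ⟨2, 1, by simp, hk, mem_twistPiece_of_eq hk hs' e, e⟩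

/-- The side `C` is mapped to the two halves of a line through the central rectangle. -/
theorem exists_twistPiece_C {p : Fin 2 → ℝ} (hp : p ∈ octagon) (h : p 0 = 1) :
    ∃ k l, ((k = 1 ∧ l = 0) ∨ (k = 2 ∧ l = 1)) ∧ p ∈ twistPiece (0, k) ∧
      p - period .C ∈ twistPiece (0, l) ∧ twistImage (0, k) p = twistImage (0, l) (p - period .C) := by
  have r0 := sqrt_two_mul_self
  have r1 := sqrt_two_gt
  have r2 := sqrt_two_lt
  obtain ⟨⟨a1, a2⟩, ⟨a3, a4⟩, ⟨a5, a6⟩, a7, a8⟩ := mem_octagon.1 hp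
  have hs : p ∈ strip 0 := by
    show -(√2 - 1) ≤ p 1 ∧ p 1 ≤ √2 - 1
    constructor <;> linarith
  have hs' : p - period .C ∈ strip 0 := by
    show -(√2 - 1) ≤ p 1 - period .C 1 ∧ p 1 - period .C 1 ≤ √2 - 1
    simp; constructor <;> linarith
  have m1 := sqrt_two_mul_mono (show p 1 ≤ √2 - 1 by linarith)
  have m2 := sqrt_two_mul_mono (show -(√2 - 1) ≤ p 1 by linarith)
  rcases le_total (-p 0 + 2 * (1 + √2) * p 1) (-1) with c | c
  · have hk : p ∈ twistPiece (0, 2) := by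
      refine mem_twistPiece.2 ⟨hs, ?_⟩
      simp [twist]
      refine ⟨⟨?_, ?_⟩, ⟨?_, ?_⟩, ⟨?_, ?_⟩, ?_, ?_⟩ <;> linarith
    have e : twistImage (0, 2) p = twistImage (0, 1) (p - period .C) := by
      apply ext_fin_two
      · simp [twistImage_zero, twist]; ring
      · simp [twistImage_one, twist]
    exact ⟨2, 1, by simp, hk, mem_twistPiece_of_eq hk hs' e, e⟩
  · have hk : p ∈ twistPiece (0, 1) := by
      refine mem_twistPiece.2 ⟨hs, ?_⟩
      simp [twist]
      refine ⟨⟨?_, ?_⟩, ⟨?_, ?_⟩, ⟨?_, ?_⟩, ?_, ?_⟩ <;> linarith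
    have e : twistImage (0, 1) p = twistImage (0, 0) (p - period .C) := by
      apply ext_fin_two
      · simp [twistImage_zero, twist]; ring
      · simp [twistImage_one, twist]
    exact ⟨1, 0, by simp, hk, mem_twistPiece_of_eq hk hs' e, e⟩

theorem mem_twistPiece_A {p : Fin 2 → ℝ} (hp : p ∈ octagon) (h : p 1 = 1) :
    p ∈ twistPiece (1, 2) ∧ p - period .A ∈ twistPiece (2, 2) ∧
      twistImage (1, 2) p = ![-p 0, 1] ∧ twistImage (2, 2) (p - period .A) = ![-p 0, -1] := by
  have r0 := sqrt_two_mul_self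
  have r1 := sqrt_two_gt
  have r2 := sqrt_two_lt
  obtain ⟨⟨a1, a2⟩, ⟨a3, a4⟩, ⟨a5, a6⟩, a7, a8⟩ := mem_octagon.1 hp
  have hs : p ∈ strip 1 := show √2 - 1 ≤ p 1 by linarith
  refine ⟨mem_twistPiece_top_two hp hs (by rw [h]; linarith), ?_, ?_, ?_⟩
  · rw [← neg_mem_twistPiece]
    refine mem_twistPiece_top_two (neg_mem_octagon (sub_period_mem hp (by simpa using h))) ?_ ?_
    · show √2 - 1 ≤ -(p 1 - period .A 1)
      simp; linarith
    · simp [h]; linarith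
  · apply ext_fin_two
    · rw [twistImage_zero, h]; simp [twist]; ring
    · rw [twistImage_one, h]; simp [twist]
  · apply ext_fin_two
    · rw [twistImage_zero]; simp [h, twist]; ring
    · rw [twistImage_one]; simp [h, twist]; norm_num

/-- The lines carrying the images of the sides `B`, `C`, `D` under the automorphism. -/
def cutForm : Letter → (Fin 2 → ℝ) → ℝ
  | .A, _ => 1
  | .B, p => (3 + 2 * √2) * p 1 - p 0 - 2 - √2
  | .C, p => 2 * (1 + √2) * p 1 - p 0 + 1
  | .D, p => (1 + 2 * √2) * p 1 - p 0 + 2 + √2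

/-- The image of the interior of the side `X` in the octagon. -/
def OnCut (X : Letter) (s : Fin 2 → ℝ) : Prop := cutForm X s = 0 ∨ cutForm X (-s) = 0

/-- The rectangle is a horizontal cylinder of circumference $2$ and height $2(\sqrt2-1)$; the two
trapezoids form one of circumference $2\sqrt2$ and height $2-\sqrt2$. The ratios are $1+\sqrt2$ and
$2(1+\sqrt2)$. Hence $\gamma$, the reflection $x\mapsto-x$ followed by a shear, twists the first
cylinder twice and the second once, and closes up on the surface. -/
theorem exists_gam_map : ∃ F : Surface → Surface, Continuous F ∧
    (∀ i, ∀ p ∈ octagon, p ∈ twistPiece i → F (pr p) = pr (twistImage i p)) ∧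
    ∀ x, x ∉ singularSet → ∃ ε > 0, ∀ u : Fin 2 → ℝ, ‖u‖ < ε → ∀ y, Displaced x u y →
        Displaced (F x) (gam.1.mulVec u) (F y) := by
  have hmem : ∀ i, ∀ p ∈ octagon, p ∈ twistPiece i →
      gam.1.mulVec p + (fun i : Fin 3 × Fin 3 => twist i.1 i.2) i ∈ octagon :=
    fun i p _ h => h.2
  have hglue : ∀ p ∈ octagon, ∀ X, height X p = 1 → ∃ i j, p ∈ twistPiece i ∧
      p - period X ∈ twistPiece j ∧
      pr (gam.1.mulVec p + (fun i : Fin 3 × Fin 3 => twist i.1 i.2) i) =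
        pr (gam.1.mulVec (p - period X) + (fun i : Fin 3 × Fin 3 => twist i.1 i.2) j) := by
    intro p hp X hX
    rw [height_eq_one_iff] at hX
    cases X
    · obtain ⟨h1, h2, h3, h4⟩ := mem_twistPiece_A hp hX
      refine ⟨_, _, h1, h2, ?_⟩
      show pr (twistImage (1, 2) p) = pr (twistImage (2, 2) (p - period .A))
      refine pr_eq_of_eq_sub_period h1.2 h2.2 .A ?_
      show twistImage _ _ = twistImage _ _ - _
      rw [h3, h4]
      apply ext_fin_two <;> simp
      norm_num
    · obtain ⟨k, l, -, h1, h2, h3⟩ := exists_twistPiece_B hp hX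
      exact ⟨_, _, h1, h2, congrArg pr h3⟩
    · obtain ⟨k, l, -, h1, h2, h3⟩ := exists_twistPiece_C hp hX
      exact ⟨_, _, h1, h2, congrArg pr h3⟩
    · obtain ⟨k, l, -, h1, h2, h3⟩ := exists_twistPiece_D hp hX
      exact ⟨_, _, h1, h2, congrArg pr h3⟩
  obtain ⟨F, hF, hF'⟩ := exists_piecewise_affine isClosed_twistPiece
    (fun p hp => exists_twistPiece hp) hmem
    (fun i j p _ h1 h2 => twistImage_eq h1 h2) hglue
  exact ⟨F, hF, hF', fun x hx => piecewise_affine_displaced isClosed_twistPiece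
    (fun p hp => exists_twistPiece hp) hmem hF' hx⟩

/-- Since $\gamma^2=1$, only the strip of the image matters. Every piece undoes itself, except that
`(1, 1)` and `(2, 1)` undo each other, since they move a trapezoid to the opposite one. -/
theorem exists_twistPiece_inverse {p : Fin 2 → ℝ} {i : Fin 3 × Fin 3} (hp : p ∈ octagon)
    (h : p ∈ twistPiece i) : ∃ j, twistImage i p ∈ twistPiece j ∧ twistImage j (twistImage i p) = p := by
  have r0 := sqrt_two_mul_self
  have r1 := sqrt_two_gt
  have top : ∀ p k, p ∈ octagon → p ∈ twistPiece (1, k) →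
      ∃ j, twistImage (1, k) p ∈ twistPiece j ∧ twistImage j (twistImage (1, k) p) = p := by
    intro p k hp h
    have hs : √2 - 1 ≤ p 1 := h.1
    have key : ∀ j : Fin 3 × Fin 3, twistImage (1, k) p ∈ strip j.1 →
        twistImage j (twistImage (1, k) p) = p →
        ∃ j, twistImage (1, k) p ∈ twistPiece j ∧ twistImage j (twistImage (1, k) p) = p := by
      intro j h1 h2
      refine ⟨j, ⟨h1, ?_⟩, h2⟩
      have : twistImage j (twistImage (1, k) p) ∈ octagon := by rwa [h2]
      exact this
    fin_cases k
    · refine key (1, 0) ?_ ?_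
      · show √2 - 1 ≤ twistImage (1, 0) p 1
        rw [twistImage_one]; simpa [twist] using hs
      · apply ext_fin_two <;> simp [twistImage_zero, twistImage_one, twist]; ring
    · refine key (2, 1) ?_ ?_
      · show twistImage (1, 1) p 1 ≤ -(√2 - 1)
        rw [twistImage_one]
        have := (mem_octagon.1 hp).2.1.2
        simp [twist]; linarith
      · apply ext_fin_two <;> simp [twistImage_zero, twistImage_one, twist]
        linarith
    · refine key (1, 2) ?_ ?_
      · show √2 - 1 ≤ twistImage (1, 2) p 1
        rw [twistImage_one]; simpa [twist] using hs
      · apply ext_fin_two <;> simp [twistImage_zero, twistImage_one, twist]; ring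
  obtain ⟨i, k⟩ := i
  fin_cases i
  · have e : twistImage (0, k) (twistImage (0, k) p) = p := by
      apply ext_fin_two
      · simp [twistImage_zero, twistImage_one, twist_zero_zero]; ring
      · simp [twistImage_one, twist_zero_zero]
    refine ⟨(0, k), ⟨?_, ?_⟩, e⟩
    · have hs : -(√2 - 1) ≤ p 1 ∧ p 1 ≤ √2 - 1 := h.1
      show -(√2 - 1) ≤ twistImage (0, k) p 1 ∧ twistImage (0, k) p 1 ≤ √2 - 1
      rw [twistImage_one, twist_zero_zero, add_zero]
      exact hs
    · have : twistImage (0, k) (twistImage (0, k) p) ∈ octagon := by rwa [e]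
      exact this
  · exact top p k hp h
  · obtain ⟨⟨j, l⟩, h1, h2⟩ := top (-p) k (neg_mem_octagon hp) (neg_mem_twistPiece.2 h)
    rw [twistImage_neg] at h1 h2
    show ∃ j, twistImage (2, k) p ∈ twistPiece j ∧ twistImage j (twistImage (2, k) p) = p
    have h1s := h1.1
    fin_cases j
    · obtain ⟨l', h3, h4⟩ := neg_mem_twistPiece_middle h1
      rw [neg_neg] at h3 h4
      refine ⟨_, h3, ?_⟩
      rw [h4]
      show -twistImage (0, l) _ = p
      rw [show twistImage (0, l) (-twistImage (2, k) p) = -p from h2, neg_neg]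
    · refine ⟨(2, l), neg_mem_twistPiece.1 h1, ?_⟩
      have : twistImage (1, l) (-twistImage (2, k) p) = -p := h2
      rw [twistImage_neg] at this
      exact neg_injective this
    · refine ⟨(1, l), ?_, ?_⟩
      · have h1' : -twistImage (2, k) p ∈ twistPiece (2, l) := h1
        rw [← neg_mem_twistPiece, neg_neg] at h1'
        exact h1'
      · have : twistImage (2, l) (-twistImage (2, k) p) = -p := h2
        have e := twistImage_neg l (-twistImage (2, k) p)
        rw [this, neg_neg, neg_neg] at e
        exact e

/-- As `Ψ` is an involution, `OnCut` describes the image of a side as well as its preimage. The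
horizontal sides are parallel to the shear and need a separate clause; for them `cutForm` never
vanishes. -/
theorem exists_gam_automorphism : ∃ Ψ : Surface ≃ₜ Surface, IsAffineAutomorphism Ψ gam ∧
    (∀ x, Ψ (Ψ x) = x) ∧ (∀ x ∈ side .A, Ψ x ∈ side .A) ∧
    (∀ X, ∀ s ∈ octagon, OnCut X s → Ψ (pr s) ∈ side X) ∧
    (∀ X, X ≠ .A → ∀ x ∈ side X, ∃ s ∈ octagon, pr s = Ψ x ∧ OnCut X s) := by
  have r0 := sqrt_two_mul_self
  have r1 := sqrt_two_gt
  have r2 := sqrt_two_lt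
  obtain ⟨F, hF, hF', hFd⟩ := exists_gam_map
  have hinv : ∀ x, F (F x) = x := by
    intro x
    obtain ⟨p, hp, rfl⟩ := exists_pr x
    obtain ⟨i, hi⟩ := exists_twistPiece hp
    obtain ⟨j, h1, h2⟩ := exists_twistPiece_inverse hp hi
    rw [hF' i p hp hi, hF' j _ (show twistImage i p ∈ octagon from hi.2) h1, h2]
  let Ψ : Surface ≃ₜ Surface :=
    { toFun := F, invFun := F, left_inv := hinv, right_inv := hinv,
      continuous_toFun := hF, continuous_invFun := hF }
  have hrep : ∀ X, ∀ x ∈ side X, ∃ p ∈ octagon, pr p = x ∧ height X p = 1 := by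
    rintro X x ⟨p, hp, h⟩
    rw [proj_eq_pr] at hp
    rcases abs_height_eq_one h with h | h
    · exact ⟨p.1, p.2, hp, h⟩
    · exact ⟨_, add_period_mem p.2 h, by rw [pr_add_period p.2 h, hp],
        by rw [height_add, h, height_period]; norm_num⟩
  have hside : ∀ X p, p ∈ octagon → |height X p| = 1 → pr p ∈ side X := fun X p hp h =>
    ⟨⟨p, hp⟩, proj_eq_pr _, h⟩
  refine ⟨Ψ, ⟨?_, hFd⟩, hinv, ?_, ?_, ?_⟩
  · rw [singularSet_eq exists_isVertex, Set.image_singleton]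
    show {F _} = _
    obtain ⟨k, l, hkl, h1, -, -⟩ := exists_twistPiece_C exists_isVertex.mem (by simp)
    rw [hF' _ _ exists_isVertex.mem h1]
    congr 1
    refine pr_eq_of_isVertex (isVertex_of_right ?_ ?_) exists_isVertex
    · have c := (mem_twistPiece.1 h1).2.1
      rw [twistImage_zero]
      rcases hkl with ⟨rfl, -⟩ | ⟨rfl, -⟩
      · left; simp [twist]; linarith
      · simp [twist] at c; linarith
    · left
      rw [twistImage_one, twist_zero_zero]; simp
  · intro x hx
    obtain ⟨p, hp, rfl, h⟩ := hrep _ _ hx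
    obtain ⟨h1, -, h3, -⟩ := mem_twistPiece_A hp (by simpa using h)
    show F _ ∈ _
    rw [hF' _ _ hp h1]
    refine hside _ _ h1.2 ?_
    rw [h3]; simp
  · have main : ∀ X, ∀ s ∈ octagon, cutForm X s = 0 → ∃ i, s ∈ twistPiece i ∧ -s ∈ twistPiece
        (i.1 * 2, if i.1 = 0 then 2 - i.2 else i.2) ∧ |height X (twistImage i s)| = 1 ∧
        |height X (twistImage (i.1 * 2, if i.1 = 0 then 2 - i.2 else i.2) (-s))| = 1 := by
      intro X s hs h
      obtain ⟨⟨a1, a2⟩, ⟨a3, a4⟩, ⟨a5, a6⟩, a7, a8⟩ := mem_octagon.1 hs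
      cases X <;> simp only [cutForm] at h
      · norm_num at h
      · have b : √2 - 1 ≤ s 1 := by nlinarith
        have hi := mem_twistPiece_top_zero hs b (by linarith)
        have e : twistImage (1, 0) s = - twistImage (2, 0) (-s) := by
          rw [← twistImage_neg, neg_neg]
        have hh : height .B (twistImage (1, 0) s) = 1 := by
          rw [height_eq_one_iff]
          simp [twistImage_zero, twistImage_one, twist]; linarith
        refine ⟨(1, 0), hi, ?_, by rw [hh]; simp, ?_⟩
        · exact neg_mem_twistPiece.1 (by rwa [neg_neg])
        · rw [e, height_neg] at hh
          show |height _ (twistImage (2, 0) (-s))| = 1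
          rw [← abs_neg, hh]; simp
      · have b : -(√2 - 1) ≤ s 1 ∧ s 1 ≤ √2 - 1 := by constructor <;> nlinarith
        have hi : s ∈ twistPiece (0, 1) := by
          refine mem_twistPiece.2 ⟨b, ?_⟩
          simp [twist]
          refine ⟨⟨?_, ?_⟩, ⟨?_, ?_⟩, ⟨?_, ?_⟩, ?_, ?_⟩ <;> linarith
        obtain ⟨l, h3, h4⟩ := neg_mem_twistPiece_middle hi
        have e : twistImage (0, 1) (-s) = - twistImage (0, 1) s := by
          apply ext_fin_two
          · simp [twistImage_zero, twist]; ring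
          · simp [twistImage_one, twist]
        have hh : height .C (twistImage (0, 1) s) = -1 := by
          rw [height_eq_neg_one_iff]
          simp [twistImage_zero, twist]; linarith
        refine ⟨(0, 1), hi, ?_, by rw [hh]; simp, ?_⟩
        · show -s ∈ twistPiece (0, 1)
          refine ⟨h3.1, ?_⟩
          have : twistImage (0, 1) (-s) ∈ octagon := e ▸ neg_mem_octagon hi.2
          exact this
        · show |height _ (twistImage (0, 1) (-s))| = 1
          rw [e, height_neg, hh]; simp
      · have b : √2 - 1 ≤ (-s) 1 := by
          show √2 - 1 ≤ -s 1
          nlinarith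
        have b' : √2 - 1 ≤ -s 1 := b
        have hi := mem_twistPiece_top_one (neg_mem_octagon hs) b (by simp; linarith) (by simp; linarith)
        have e : twistImage (1, 1) (-s) = - twistImage (2, 1) s := twistImage_neg _ _
        have hh : height .D (twistImage (1, 1) (-s)) = 1 := by
          rw [height_eq_one_iff]
          simp [twistImage_zero, twistImage_one, twist]; linarith
        refine ⟨(2, 1), neg_mem_twistPiece.1 hi, hi, ?_, ?_⟩
        · rw [e, height_neg] at hh
          rw [← abs_neg, hh]; simp
        · show |height _ (twistImage (1, 1) (-s))| = 1
          rw [hh]; simp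
    intro X s hs h
    show F _ ∈ _
    rcases h with h | h
    · obtain ⟨i, h1, -, h2, -⟩ := main X s hs h
      rw [hF' i s hs h1]
      exact hside _ _ h1.2 h2
    · obtain ⟨i, -, h1, -, h2⟩ := main X (-s) (neg_mem_octagon hs) h
      rw [neg_neg] at h1 h2
      rw [hF' _ s hs h1]
      exact hside _ _ h1.2 h2
  · intro X hX x hx
    obtain ⟨p, hp, rfl, h⟩ := hrep _ _ hx
    show ∃ s ∈ octagon, pr s = F (pr p) ∧ OnCut X s
    rw [height_eq_one_iff] at h
    cases X
    · exact absurd rfl hX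
    · obtain ⟨k, l, hkl, h1, -, -⟩ := exists_twistPiece_B hp h
      refine ⟨_, h1.2, (hF' _ _ hp h1).symm, ?_⟩
      show OnCut .B (twistImage (1, k) p)
      have hp0 : p 0 = √2 - p 1 := by linarith
      rcases hkl with ⟨rfl, -⟩ | ⟨rfl, -⟩
      · left
        simp [cutForm, twistImage_zero, twistImage_one, twist, hp0]; ring
      · right
        simp [cutForm, twistImage_zero, twistImage_one, twist, hp0]; linarith
    · obtain ⟨k, l, hkl, h1, -, -⟩ := exists_twistPiece_C hp h
      refine ⟨_, h1.2, (hF' _ _ hp h1).symm, ?_⟩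
      show OnCut .C (twistImage (0, k) p)
      rcases hkl with ⟨rfl, -⟩ | ⟨rfl, -⟩
      · right
        simp [cutForm, twistImage_zero, twistImage_one, twist, h]
      · left
        simp [cutForm, twistImage_zero, twistImage_one, twist, h]; ring
    · obtain ⟨k, l, hkl, h1, -, -⟩ := exists_twistPiece_D hp h
      refine ⟨_, h1.2, (hF' _ _ hp h1).symm, ?_⟩
      show OnCut .D (twistImage (2, k) p)
      have hp0 : p 0 = √2 + p 1 := by linarith
      rcases hkl with ⟨rfl, -⟩ | ⟨rfl, -⟩
      · right
        simp [cutForm, twistImage_zero, twistImage_one, twist, hp0]; linarith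
      · left
        simp [cutForm, twistImage_zero, twistImage_one, twist, hp0]; linarith


/-! ## The chords of a trajectory -/

theorem eventually_abs_height_lt {p v : Fin 2 → ℝ} (hp : p ∈ octagon)
    (h : ∀ X, height X p = 1 → height X v < 0) (h' : ∀ X, height X p = -1 → 0 < height X v) :
    ∃ ε : ℝ, 0 < ε ∧ ∀ r : ℝ, 0 < r → r < ε → ∀ X, |height X (p + r • v)| < 1 := by
  have key : ∀ X, ∃ ε : ℝ, 0 < ε ∧ ∀ r : ℝ, 0 < r → r < ε → |height X (p + r • v)| < 1 := by
    intro X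
    have hX := abs_le.1 (hp X)
    set k := |height X v| + 1 with hk
    have hk0 : 0 < k := by positivity
    have b1 := neg_abs_le (height X v)
    have b2 := le_abs_self (height X v)
    rcases hX.2.eq_or_lt with h1 | h1
    · have hn := h X h1
      refine ⟨1 / k, by positivity, fun r hr hr' => ?_⟩
      rw [lt_div_iff₀ hk0] at hr'
      rw [height_add, height_smul, h1, abs_lt]
      constructor <;> nlinarith
    · rcases hX.1.eq_or_lt with h2 | h2
      · have hn := h' X h2.symm
        refine ⟨1 / k, by positivity, fun r hr hr' => ?_⟩
        rw [lt_div_iff₀ hk0] at hr'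
        rw [height_add, height_smul, ← h2, abs_lt]
        constructor <;> nlinarith
      · refine ⟨min (1 - height X p) (1 + height X p) / k, ?_, fun r hr hr' => ?_⟩
        · exact div_pos (lt_min (by linarith) (by linarith)) hk0
        rw [lt_div_iff₀ hk0, lt_min_iff] at hr'
        rw [height_add, height_smul, abs_lt]
        constructor <;> nlinarith
  choose ε hε H using key
  refine ⟨min (min (ε .A) (ε .B)) (min (ε .C) (ε .D)), by simp [hε], fun r hr hr' X => ?_⟩
  simp only [lt_min_iff] at hr'
  apply H X r hr
  cases X <;> tauto

theorem not_isVertex_of_abs_height_lt {p : Fin 2 → ℝ} (h : ∀ X, |height X p| < 1) :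
    ¬ IsVertex p := by
  intro hv
  obtain ⟨X, -, -, hX, -⟩ := hv.exists_heights
  exact absurd hX (h X).ne

theorem pr_notMem_side {p : Fin 2 → ℝ} (h : ∀ X, |height X p| < 1) (X : Letter) :
    pr p ∉ side X := by
  rw [pr_mem_side (fun X => (h X).le) (not_isVertex_of_abs_height_lt h)]
  exact (h X).ne

/-- Every nonsingular point has a representative from which the octagon can be entered in a given
transverse direction. -/
theorem exists_pr_inward {x : Surface} (hx : x ∉ singularSet) {v : Fin 2 → ℝ}
    (hv : ∀ X, height X v ≠ 0) : ∃ p ∈ octagon, pr p = x ∧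
      (∀ X, height X p = 1 → height X v < 0) ∧ (∀ X, height X p = -1 → 0 < height X v) := by
  obtain ⟨p, hp, rfl⟩ := exists_pr x
  rw [pr_mem_singularSet hp] at hx
  by_cases hs : ∃ X, |height X p| = 1
  · obtain ⟨X, hX⟩ := hs
    have uniq : ∀ {q : Fin 2 → ℝ} {Y}, q ∈ octagon → ¬ IsVertex q → |height X q| = 1 →
        |height Y q| = 1 → Y = X := by
      intro q Y hq hqv h1 h2
      by_contra hne
      exact hqv (isVertex_of_abs_height hq hne h2 h1)
    have build : ∀ q ∈ octagon, ¬ IsVertex q → |height X q| = 1 → pr q = pr p →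
        height X q * height X v < 0 → ∃ p' ∈ octagon, pr p' = pr p ∧
      (∀ X, height X p' = 1 → height X v < 0) ∧ (∀ X, height X p' = -1 → 0 < height X v) := by
      intro q hq hqv h1 h2 h3
      refine ⟨q, hq, h2, fun Y hY => ?_, fun Y hY => ?_⟩
      · obtain rfl := uniq hq hqv h1 (by rw [hY]; simp)
        rw [hY] at h3; linarith
      · obtain rfl := uniq hq hqv h1 (by rw [hY]; simp)
        rw [hY] at h3; linarith
    rcases abs_height_eq_one hX with h1 | h1
    · rcases lt_or_gt_of_ne (hv X) with h2 | h2
      · exact build p hp hx hX rfl (by rw [h1]; linarith)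
      · have h3 : height X (p - period X) = -1 := by rw [height_sub, h1, height_period]; norm_num
        exact build _ (sub_period_mem hp h1) (by rwa [isVertex_sub_period h1]) (by rw [h3]; simp)
          (pr_sub_period hp h1) (by rw [h3]; linarith)
    · rcases lt_or_gt_of_ne (hv X) with h2 | h2
      · have h3 : height X (p + period X) = 1 := by rw [height_add, h1, height_period]; norm_num
        exact build _ (add_period_mem hp h1)
          (by rw [← isVertex_sub_period h3]; simpa using hx) (by rw [h3]; simp)
          (pr_add_period hp h1) (by rw [h3]; linarith)
      · exact build p hp hx hX rfl (by rw [h1]; linarith)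
  · push Not at hs
    refine ⟨p, hp, rfl, fun X hX => ?_, fun X hX => ?_⟩
    · exact absurd (by rw [hX]; simp) (hs X)
    · exact absurd (by rw [hX]; simp) (hs X)

/-- The crossing times of a transverse trajectory do not accumulate from the right. -/
theorem IsTraj.exists_no_crossing {v : Fin 2 → ℝ} {τ : ℝ → Surface} (h : IsTraj v τ)
    (hv : ∀ X, height X v ≠ 0) (a : ℝ) :
    ∃ ε > 0, ∀ r, a < r → r < a + ε → ∀ X, τ r ∉ side X := by
  obtain ⟨p, hp, hpa, h1, h2⟩ := exists_pr_inward (h.1 a) hv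
  obtain ⟨ε, hε, H⟩ := eventually_abs_height_lt hp h1 h2
  refine ⟨ε, hε, fun r hr hr' X => ?_⟩
  have H' := H (r - a) (by linarith) (by linarith)
  have := h.follow hp hpa.symm (R := r - a) (fun X => (H' X).le)
  rw [show r = a + (r - a) by ring, this]
  exact pr_notMem_side H' X

theorem exists_exit {p v : Fin 2 → ℝ} (hp : p ∈ octagon) (hv : ∀ X, 0 < height X v) :
    ∃ R : ℝ, 0 ≤ R ∧ p + R • v ∈ octagon ∧ ∃ X, height X (p + R • v) = 1 := by
  have hne : (Finset.univ : Finset Letter).Nonempty := ⟨.A, Finset.mem_univ _⟩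
  obtain ⟨X, -, hX⟩ := Finset.exists_min_image Finset.univ
    (fun X => (1 - height X p) / height X v) hne
  have h0 : ∀ Y, 0 ≤ (1 - height Y p) / height Y v := fun Y =>
    div_nonneg (by linarith [(abs_le.1 (hp Y)).2]) (hv Y).le
  refine ⟨_, h0 X, fun Y => ?_, X, ?_⟩
  · have h1 := hX Y (Finset.mem_univ _)
    rw [le_div_iff₀ (hv Y)] at h1
    have h2 := mul_nonneg (h0 X) (hv Y).le
    have h3 := (abs_le.1 (hp Y)).1
    rw [height_add, height_smul, abs_le]
    constructor <;> linarith
  · rw [height_add, height_smul, div_mul_cancel₀ _ (hv X).ne']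
    ring

/-- The trajectory `τ` crosses the sides of the octagon at the times `t n`, the side crossed having
the label `w n`, and its `n`-th chord starts at the point `e n` of the octagon. -/
structure IsCoding (v : Fin 2 → ℝ) (τ : ℝ → Surface) (w : Word) (t : ℤ → ℝ)
    (e : ℤ → (Fin 2 → ℝ)) : Prop where
  isTraj : IsTraj v τ
  pos : ∀ X, 0 < height X v
  mono : StrictMono t
  range : Set.range t = {r | ∃ X, τ r ∈ side X}
  mem : ∀ n, e n ∈ octagon
  pr_eq : ∀ n, τ (t n) = pr (e n)
  height_entry : ∀ n, height (w n) (e n) = -1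
  exit_mem : ∀ n, e n + (t (n + 1) - t n) • v ∈ octagon
  height_exit : ∀ n, height (w (n + 1)) (e n + (t (n + 1) - t n) • v) = 1
  next : ∀ n, e (n + 1) = e n + (t (n + 1) - t n) • v - period (w (n + 1))

theorem abs_height_lt_of_between {p v : Fin 2 → ℝ} {r R : ℝ} (hv : ∀ X, 0 < height X v)
    (hp : p ∈ octagon) (hq : p + R • v ∈ octagon) (h0 : 0 < r) (h1 : r < R) (X : Letter) :
    |height X (p + r • v)| < 1 := by
  have h2 := abs_le.1 (hp X)
  have h3 := abs_le.1 (hq X)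
  have := hv X
  rw [height_add, height_smul] at *
  rw [abs_lt]
  constructor <;> nlinarith

theorem eq_of_height_eq_neg_one {p q : Fin 2 → ℝ} (hp : p ∈ octagon) (hq : q ∈ octagon)
    (hv : ¬ IsVertex p) (h : pr p = pr q) {X : Letter} (h1 : height X p = height X q)
    (h2 : |height X p| = 1) : p = q := by
  have hi := identified_of_pr_eq hp hq h
  have hvq : ¬ IsVertex q := fun h => hv (hi.isVertex_iff.2 h)
  rcases hi with h | ⟨Y, h3, h4⟩ | ⟨Y, h3, h4⟩ | h
  · exact h
  · obtain rfl : X = Y := by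
      by_contra hne
      exact hv (isVertex_of_abs_height hp hne h2 (by rw [h3]; simp))
    rw [h4, height_sub, height_period] at h1; linarith
  · obtain rfl : X = Y := by
      by_contra hne
      exact hvq (isVertex_of_abs_height hq hne (h1 ▸ h2) (by rw [h3]; simp))
    rw [h4, height_sub, height_period] at h1; linarith
  · exact absurd h.1 hv

theorem isCuttingSequence_iff {τ : ℝ → Surface} {w : Word} : IsCuttingSequence τ w ↔
    ∃ t : ℤ → ℝ, StrictMono t ∧ Set.range t = {r | ∃ X, τ r ∈ side X} ∧
      ∀ n, τ (t n) ∈ side (w n) := by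
  simp [IsCuttingSequence, IsCuttingSequenceWrt]

/-- From the representative on the entry side the chord is followed until it leaves the octagon.
This happens at a crossing time later than `t n`; inside the chord all heights are below one, so no
crossing intervenes and the time is `t (n + 1)`. -/
theorem IsCuttingSequence.exists_isCoding {v : Fin 2 → ℝ} {τ : ℝ → Surface} (h : IsTraj v τ)
    (hv : ∀ X, 0 < height X v) {w : Word} (hw : IsCuttingSequence τ w) :
    ∃ t e, IsCoding v τ w t e := by
  obtain ⟨t, ht, hr, hl⟩ := isCuttingSequence_iff.1 hw
  have hns : ∀ {p}, p ∈ octagon → ∀ {a}, τ a = pr p → ¬ IsVertex p := fun hp a h' => by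
    rw [← pr_mem_singularSet hp, ← h']; exact h.1 a
  have hex : ∀ n, ∃ p ∈ octagon, τ (t n) = pr p ∧ height (w n) p = -1 := by
    intro n
    obtain ⟨p, hp, hX⟩ := hl n
    rw [proj_eq_pr] at hp
    rcases abs_height_eq_one hX with h1 | h1
    · exact ⟨_, sub_period_mem p.2 h1, by rw [pr_sub_period p.2 h1, hp],
        by rw [height_sub, h1, height_period]; norm_num⟩
    · exact ⟨p.1, p.2, hp.symm, h1⟩
  choose e he hpr hm using hex
  have hexit : ∀ n, e n + (t (n + 1) - t n) • v ∈ octagon ∧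
      height (w (n + 1)) (e n + (t (n + 1) - t n) • v) = 1 := by
    intro n
    obtain ⟨R, hR, hRm, X, hX⟩ := exists_exit (he n) hv
    have hR0 : 0 < R := by
      refine lt_of_le_of_ne hR fun h0 => ?_
      rw [← h0, zero_smul, add_zero] at hX
      have hXn : X ≠ w n := by rintro rfl; linarith [hm n]
      exact hns (he n) (hpr n) (isVertex_of_abs_height (he n) hXn (by rw [hX]; simp)
        (by rw [hm n]; simp))
    have hf := h.follow (he n) (hpr n) hRm
    have hside : τ (t n + R) ∈ side X := by
      rw [hf, pr_mem_side hRm (hns hRm hf), hX]; simp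
    obtain ⟨m, hmR⟩ : t n + R ∈ Set.range t := by rw [hr]; exact ⟨X, hside⟩
    have hnm : n < m := ht.lt_iff_lt.1 (by rw [hmR]; linarith)
    have hm1 : m = n + 1 := by
      by_contra hne
      have h1 : t n < t (n + 1) := ht (by omega)
      have h2 : t (n + 1) < t m := ht (by omega)
      have h3 := abs_height_lt_of_between hv (he n) hRm (r := t (n + 1) - t n)
        (by linarith) (by linarith)
      have h4 := h.follow (he n) (hpr n) (R := t (n + 1) - t n) (fun X => (h3 X).le)
      have h5 := hl (n + 1)
      rw [show t (n + 1) = t n + (t (n + 1) - t n) by ring, h4] at h5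
      exact pr_notMem_side h3 _ h5
    subst hm1
    have hRe : t (n + 1) - t n = R := by linarith
    rw [hRe]
    refine ⟨hRm, ?_⟩
    have : X = w (n + 1) := side_unique (h.1 _) (hmR ▸ hside) (hl (n + 1))
    rwa [← this]
  refine ⟨t, e, h, hv, ht, hr, he, hpr, hm, fun n => (hexit n).1, fun n => (hexit n).2,
    fun n => ?_⟩
  obtain ⟨h1, h2⟩ := hexit n
  have h3 := h.follow (he n) (hpr n) h1
  rw [add_sub_cancel] at h3
  refine eq_of_height_eq_neg_one (he _) (sub_period_mem h1 h2) (hns (he _) (hpr _)) ?_ (X := w (n + 1))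
    ?_ ?_
  · rw [pr_sub_period h1 h2, ← h3, hpr]
  · rw [hm, height_sub, h2, height_period]; norm_num
  · rw [hm]; simp

namespace IsCoding

variable {v : Fin 2 → ℝ} {τ : ℝ → Surface} {w : Word} {t : ℤ → ℝ} {e : ℤ → (Fin 2 → ℝ)}

theorem lt_succ (h : IsCoding v τ w t e) (n : ℤ) : t n < t (n + 1) := h.mono (by omega)

theorem not_isVertex (h : IsCoding v τ w t e) {p : Fin 2 → ℝ} (hp : p ∈ octagon) {a : ℝ}
    (ha : τ a = pr p) : ¬ IsVertex p := by
  rw [← pr_mem_singularSet hp, ← ha]; exact h.isTraj.1 a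

theorem chord_mem (h : IsCoding v τ w t e) {n : ℤ} {a : ℝ} (h0 : t n ≤ a) (h1 : a ≤ t (n + 1)) :
    e n + (a - t n) • v ∈ octagon :=
  add_smul_mem_octagon (h.mem n) (h.exit_mem n) (by linarith) (by linarith)

theorem chord (h : IsCoding v τ w t e) {n : ℤ} {a : ℝ} (h0 : t n ≤ a) (h1 : a ≤ t (n + 1)) :
    τ a = pr (e n + (a - t n) • v) := by
  have := h.isTraj.follow (h.mem n) (h.pr_eq n) (h.chord_mem h0 h1)
  rwa [add_sub_cancel] at this

theorem exit_eq (h : IsCoding v τ w t e) (n : ℤ) :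
    e n + (t (n + 1) - t n) • v = e (n + 1) + period (w (n + 1)) := by
  rw [h.next]; abel

theorem chord_succ (h : IsCoding v τ w t e) (n : ℤ) (a : ℝ) :
    e (n + 1) + (a - t (n + 1)) • v = e n + (a - t n) • v - period (w (n + 1)) := by
  rw [h.next, show a - t n = (t (n + 1) - t n) + (a - t (n + 1)) by ring, add_smul]
  abel

/-- The supremum of the crossing times would be a point at which they accumulate from the left; for
the reversed trajectory this contradicts `IsTraj.exists_no_crossing`. -/
theorem not_bddAbove (h : IsCoding v τ w t e) (M : ℝ) : ∃ n, M < t n := by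
  by_contra hne
  push Not at hne
  have hb : BddAbove (Set.range t) := ⟨M, by rintro _ ⟨n, rfl⟩; exact hne n⟩
  set c := sSup (Set.range t) with hc
  obtain ⟨ε, hε, H⟩ := h.isTraj.neg.exists_no_crossing
    (fun X => by rw [height_neg]; exact neg_ne_zero.2 (h.pos X).ne') (-c)
  obtain ⟨_, ⟨n, rfl⟩, hn⟩ := exists_lt_of_lt_csSup (Set.range_nonempty t)
    (show c - ε < c by linarith)
  have h1 : t n < c := (h.lt_succ n).trans_le (le_csSup hb ⟨_, rfl⟩)
  have h2 : t n ∈ Set.range t := ⟨n, rfl⟩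
  rw [h.range] at h2
  obtain ⟨X, hX⟩ := h2
  refine H (-t n) (by linarith) (by linarith) X ?_
  simpa using hX

theorem not_bddBelow (h : IsCoding v τ w t e) (M : ℝ) : ∃ n, t n < M := by
  by_contra hne
  push Not at hne
  have hb : BddBelow (Set.range t) := ⟨M, by rintro _ ⟨n, rfl⟩; exact hne n⟩
  set c := sInf (Set.range t) with hc
  obtain ⟨ε, hε, H⟩ := h.isTraj.exists_no_crossing (fun X => (h.pos X).ne') c
  obtain ⟨_, ⟨n, rfl⟩, hn⟩ := exists_lt_of_csInf_lt (Set.range_nonempty t)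
    (show c < c + ε by linarith)
  have h1 : c < t n := (csInf_le hb ⟨n - 1, rfl⟩).trans_lt (h.mono (by omega))
  have h2 : t n ∈ Set.range t := ⟨n, rfl⟩
  rw [h.range] at h2
  obtain ⟨X, hX⟩ := h2
  exact H (t n) h1 (by linarith) X hX

theorem exists_mem_Ico (h : IsCoding v τ w t e) (a : ℝ) : ∃ n, t n ≤ a ∧ a < t (n + 1) := by
  obtain ⟨m, hm⟩ := h.not_bddBelow a
  obtain ⟨M, hM⟩ := h.not_bddAbove a
  obtain ⟨n, h1, h2⟩ := Int.exists_greatest_of_bdd (P := fun n => t n ≤ a)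
    ⟨M, fun z hz => by
      by_contra hne
      exact absurd (h.mono (not_le.1 hne)) (not_lt.2 (hz.trans hM.le))⟩ ⟨m, hm.le⟩
  refine ⟨n, h1, ?_⟩
  by_contra hne
  have := h2 (n + 1) (not_lt.1 hne)
  omega

/-- At a crossing time the given representative can be the start of one chord or the end of the
preceding one, which is why both inequalities are weak. -/
theorem exists_chord (h : IsCoding v τ w t e) {a : ℝ} {s : Fin 2 → ℝ} (hs : s ∈ octagon)
    (ha : τ a = pr s) : ∃ n, t n ≤ a ∧ a ≤ t (n + 1) ∧ s = e n + (a - t n) • v := by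
  obtain ⟨n, h1, h2⟩ := h.exists_mem_Ico a
  have hp := h.chord_mem h1 h2.le
  have hc := h.chord h1 h2.le
  rcases h1.eq_or_lt with h3 | h3
  · have hcs : pr (e n) = pr s := by rw [← h.pr_eq, h3, ha]
    have hv := h.not_isVertex (h.mem n) (h.pr_eq n)
    rcases identified_of_pr_eq (h.mem n) hs hcs with h4 | ⟨X, h4, h5⟩ | ⟨X, h4, h5⟩ | h4
    · exact ⟨n, h1, h2.le, by rw [h3, sub_self, zero_smul, add_zero, h4]⟩
    · exfalso
      have hX : X = w n := by
        by_contra hne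
        exact hv (isVertex_of_abs_height (h.mem n) hne (by rw [h4]; simp)
          (by rw [h.height_entry]; simp))
      rw [hX, h.height_entry] at h4; norm_num at h4
    · have hX : X = w n := by
        by_contra hne
        refine hv (isVertex_of_abs_height (h.mem n) hne ?_ (by rw [h.height_entry]; simp))
        rw [h5, height_sub, h4, height_period]; norm_num
      refine ⟨n - 1, ?_, by simp [h3], ?_⟩
      · rw [← h3]; exact h.mono.monotone (by omega)
      · have := h.exit_eq (n - 1)
        rw [sub_add_cancel, h3] at this
        rw [this, h5, hX]; abel
    · exact absurd h4.1 hv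
  · have h4 := abs_height_lt_of_between h.pos (h.mem n) (h.exit_mem n) (r := a - t n)
      (by linarith) (by linarith)
    rcases identified_of_pr_eq hp hs (hc.symm.trans ha) with h5 | ⟨X, h5, h6⟩ | ⟨X, h5, h6⟩ | h5
    · exact ⟨n, h1, h2.le, h5.symm⟩
    · exact absurd (h4 X) (by rw [h5]; simp)
    · refine absurd (h4 X) ?_
      rw [h6, height_sub, h5, height_period]; norm_num
    · exact absurd h5.1 (not_isVertex_of_abs_height_lt h4)

end IsCoding

/-! ## Periodicity -/

/-- Periodic trajectories. -/
def IsPeriodicTraj (τ : ℝ → Surface) : Prop := ∃ P, 0 < P ∧ ∀ s, τ (s + P) = τ s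

theorem IsTraj.isPeriodicTraj {v : Fin 2 → ℝ} {τ : ℝ → Surface} (h : IsTraj v τ) {a b : ℝ}
    (hab : a ≠ b) (heq : τ a = τ b) : IsPeriodicTraj τ := by
  rcases lt_or_gt_of_ne hab with h1 | h1
  · exact ⟨b - a, by linarith, h.periodic (a := a) (by rw [add_sub_cancel, heq])⟩
  · exact ⟨a - b, by linarith, h.periodic (a := b) (by rw [add_sub_cancel, heq])⟩

theorem eq_add_of_strictMono_surjective {m : ℤ → ℤ} (hm : StrictMono m)
    (hs : Function.Surjective m) : ∀ n, m n = m 0 + n := by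
  have step : ∀ n, m (n + 1) = m n + 1 := by
    intro n
    obtain ⟨k, hk⟩ := hs (m n + 1)
    have h1 : n < k := hm.lt_iff_lt.1 (by omega)
    have h2 : m (n + 1) ≤ m k := hm.monotone (by omega)
    have h3 : m n < m (n + 1) := hm (by omega)
    omega
  intro n
  induction n using Int.induction_on with
  | zero => simp
  | succ n ih => rw [step, ih]; ring
  | pred n ih => have := step (-n - 1); rw [sub_add_cancel, ih] at this; omega

/-- Translation by the period is a monotone bijection of the crossing times, hence a shift of their
indices. -/
theorem IsCuttingSequence.isPeriodic {τ : ℝ → Surface} {w : Word} (hw : IsCuttingSequence τ w)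
    (hns : ∀ a, τ a ∉ singularSet) (h : IsPeriodicTraj τ) : IsPeriodic w := by
  obtain ⟨t, ht, hr, hl⟩ := isCuttingSequence_iff.1 hw
  obtain ⟨P, hP, hper⟩ := h
  have h1 : ∀ n, ∃ m, t m = t n + P := by
    intro n
    have : t n + P ∈ Set.range t := by
      rw [hr]; exact ⟨w n, by rw [hper]; exact hl n⟩
    exact this
  choose m hm using h1
  have hmono : StrictMono m := fun a b hab => ht.lt_iff_lt.1 (by
    rw [hm, hm]; linarith [ht hab])
  have hsurj : Function.Surjective m := by
    intro k
    have : t k - P ∈ Set.range t := by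
      rw [hr]
      refine ⟨w k, ?_⟩
      rw [← hper, sub_add_cancel]; exact hl k
    obtain ⟨n, hn⟩ := this
    exact ⟨n, ht.injective (by rw [hm, hn]; ring)⟩
  have heq := eq_add_of_strictMono_surjective hmono hsurj
  refine ⟨m 0, ?_, fun n => ?_⟩
  · exact ht.lt_iff_lt.1 (by rw [hm]; linarith)
  · have h2 := hl (n + m 0)
    rw [add_comm n, ← heq, hm, hper] at h2
    rw [add_comm n, ← heq]
    exact side_unique (hns _) h2 (hl n)

/-- The area form. -/
def cross (u p : Fin 2 → ℝ) : ℝ := u 0 * p 1 - u 1 * p 0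

theorem cross_add (u p q : Fin 2 → ℝ) : cross u (p + q) = cross u p + cross u q := by
  simp [cross]; ring

theorem cross_sub (u p q : Fin 2 → ℝ) : cross u (p - q) = cross u p - cross u q := by
  simp [cross]; ring

theorem cross_smul_self (u : Fin 2 → ℝ) (r : ℝ) : cross u (r • u) = 0 := by
  simp [cross]; ring

theorem eq_of_cross_eq {u p q : Fin 2 → ℝ} {X : Letter} (hu : height X u ≠ 0)
    (h : cross u p = cross u q) (h' : height X p = height X q) : p = q := by
  have key : ∀ i, height X u * (p i - q i) = 0 := by
    intro i
    simp only [cross] at h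
    simp only [height, dotProduct, Fin.sum_univ_two] at *
    fin_cases i
    · show (normal X 0 * u 0 + normal X 1 * u 1) * (p 0 - q 0) = 0
      linear_combination (u 0) * h' - (normal X 1) * h
    · show (normal X 0 * u 0 + normal X 1 * u 1) * (p 1 - q 1) = 0
      linear_combination (u 1) * h' + (normal X 0) * h
  ext i
  have := (mul_eq_zero.1 (key i)).resolve_left hu
  linarith

theorem eq_zero_of_forall_nat_mul_le {d M : ℝ} (h : ∀ m : ℕ, |(m : ℝ) * d| ≤ M) : d = 0 := by
  by_contra hd
  obtain ⟨m, hm⟩ := exists_nat_gt (M / |d|)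
  rw [div_lt_iff₀ (abs_pos.2 hd)] at hm
  have := h m
  rw [abs_mul, Nat.abs_cast] at this
  linarith

theorem abs_cross_le {p : Fin 2 → ℝ} (hp : p ∈ octagon) (u : Fin 2 → ℝ) :
    |cross u p| ≤ |u 0| + |u 1| := by
  have h0 := hp .C
  have h1 := hp .A
  simp only [height_A, height_C] at h0 h1
  calc |cross u p| ≤ |u 0 * p 1| + |u 1 * p 0| := abs_sub _ _
    _ ≤ _ := by
      rw [abs_mul, abs_mul]
      nlinarith [abs_nonneg (u 0), abs_nonneg (u 1)]

namespace IsCoding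

variable {v : Fin 2 → ℝ} {τ : ℝ → Surface} {w : Word} {t : ℤ → ℝ} {e : ℤ → (Fin 2 → ℝ)}

/-- The flow preserves the coordinate transverse to `v`; only the gluing changes it, by an amount
that depends on the letter alone. -/
theorem cross_succ (h : IsCoding v τ w t e) (n : ℤ) :
    cross v (e (n + 1)) = cross v (e n) - cross v (period (w (n + 1))) := by
  rw [h.next, cross_sub, cross_add, cross_smul_self, add_zero]

theorem isPeriodicTraj_of_cross_eq (h : IsCoding v τ w t e) {m n : ℤ} (hmn : m ≠ n)
    (hw : w m = w n) (hc : cross v (e m) = cross v (e n)) : IsPeriodicTraj τ := by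
  refine h.isTraj.isPeriodicTraj (a := t m) (b := t n) (fun h' => hmn (h.mono.injective h')) ?_
  rw [h.pr_eq, h.pr_eq, eq_of_cross_eq (h.pos (w m)).ne' hc
    (by rw [h.height_entry, hw, h.height_entry])]

/-- A trajectory returning with constant drift is periodic. -/
theorem isPeriodicTraj_of_drift (h : IsCoding v τ w t e) {n p : ℤ} (hp : p ≠ 0) {d : ℝ}
    (hd : ∀ m : ℕ, w (n + m * p) = w n ∧ cross v (e (n + m * p)) = cross v (e n) + m * d) :
    IsPeriodicTraj τ := by
  -- All entry points lie in the bounded octagon, so a constant drift vanishes.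
  have hd0 : d = 0 := by
    refine eq_zero_of_forall_nat_mul_le (M := (|v 0| + |v 1|) + (|v 0| + |v 1|)) fun m => ?_
    have h1 := (hd m).2
    rw [show (m : ℝ) * d = cross v (e (n + m * p)) - cross v (e n) by linarith]
    refine (abs_sub _ _).trans (add_le_add ?_ ?_) <;> exact abs_cross_le (h.mem _) _
  have h1 := hd 1
  rw [hd0] at h1
  exact h.isPeriodicTraj_of_cross_eq (m := n + (1 : ℕ) * p) (n := n) (by simpa using hp) h1.1 (by simpa using h1.2)

/-- Over one period of the word the transverse coordinate always changes by the same amount, since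
the changes depend only on the letters. This is the constant drift of the preceding lemma. -/
theorem isPeriodicTraj (h : IsCoding v τ w t e) (hw : IsPeriodic w) : IsPeriodicTraj τ := by
  obtain ⟨p, hp, hper⟩ := hw
  have hstep : ∀ n : ℤ, ∀ j : ℕ, cross v (e (n + p + j)) - cross v (e (n + p)) =
      cross v (e (n + j)) - cross v (e n) := by
    intro n j
    induction j with
    | zero => simp
    | succ j ih =>
      push_cast
      have e1 := h.cross_succ (n + p + j)
      have e2 := h.cross_succ (n + j)
      have e3 : w (n + p + j + 1) = w (n + j + 1) := by
        rw [← hper (n + j + 1)]; congr 1; ring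
      rw [← add_assoc, ← add_assoc, e1, e2, e3]
      linarith
  have hwm : ∀ m : ℕ, w (0 + m * p) = w 0 := by
    intro m
    induction m with
    | zero => simp
    | succ m ih => rw [← ih, ← hper (0 + m * p)]; congr 1; push_cast; ring
  obtain ⟨k, rfl⟩ : ∃ k : ℕ, p = k := ⟨p.toNat, by omega⟩
  refine h.isPeriodicTraj_of_drift (n := 0) (p := k) hp.ne'
    (d := cross v (e k) - cross v (e 0)) fun m => ⟨hwm m, ?_⟩
  have hdr : ∀ m : ℕ, cross v (e (m * k + k)) - cross v (e (m * k)) =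
      cross v (e k) - cross v (e 0) := by
    intro m
    induction m with
    | zero => simp
    | succ m ih =>
      have := hstep (m * k) k
      push_cast
      rw [← ih, show ((m : ℤ) + 1) * k = m * k + k by ring]
      linarith
  induction m with
  | zero => simp
  | succ m ih =>
    have := hdr m
    push_cast
    rw [show (0 : ℤ) + ((m : ℤ) + 1) * k = m * k + k by ring]
    rw [zero_add] at ih
    linarith

end IsCoding


/-! ## Directions of the first sector -/

instance : DecidableRel edge₀ := fun X Y => by
  cases X <;> cases Y <;> unfold edge₀ <;> infer_instance

instance (j : Fin 8) : DecidableRel (edge j) := fun X Y => by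
  unfold edge; infer_instance

/-- The open sector of the directions with angle between `0` and `π/8`. -/
def Sector (v : Fin 2 → ℝ) : Prop := 0 < v 1 ∧ (1 + √2) * v 1 < v 0

theorem Sector.height_pos {v : Fin 2 → ℝ} (h : Sector v) (X : Letter) : 0 < height X v := by
  obtain ⟨h1, h2⟩ := h
  have r1 := sqrt_two_gt
  have : v 1 < v 0 := by nlinarith
  cases X <;> simp only [height_A, height_B, height_C, height_D]
  · exact h1
  · exact mul_pos (by positivity) (by linarith)
  · linarith
  · exact mul_pos (by positivity) (by linarith)

theorem edge₀_symm {X Y : Letter} : edge₀ X Y → edge₀ Y X := by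
  cases X <;> cases Y <;> simp [edge₀]

/-- The transitions of the trajectories in the directions of the first sector. -/
theorem Sector.edge₀ {v p : Fin 2 → ℝ} (hv : Sector v) {R : ℝ} (hR : 0 < R) (hp : p ∈ octagon)
    (hq : p + R • v ∈ octagon) {X Y : Letter} (hY : height Y p = -1)
    (hX : height X (p + R • v) = 1) : edge₀ Y X := by
  have r0 := sqrt_two_mul_self
  have r1 := sqrt_two_gt
  have r2 := sqrt_two_lt
  rw [height_eq_neg_one_iff] at hY
  rw [height_eq_one_iff] at hX
  rw [mem_octagon] at hp hq
  simp only [Pi.add_apply, Pi.smul_apply, smul_eq_mul] at hX hq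
  set a := R * v 0 with ha
  set b := R * v 1 with hb
  have h1 : 0 < b := mul_pos hR hv.1
  have h2 : (1 + √2) * b < a := by
    have := mul_lt_mul_of_pos_left hv.2 hR
    rw [hb, ha]; linarith
  -- The sector inequality multiplied by `√2`. For `linarith` the products with `√2` are independent
  -- unknowns, so such multiples have to be supplied.
  have h3 : 0 < √2 * a - √2 * b - 2 * b := by
    have : 0 < √2 * (a - (1 + √2) * b) := mul_pos (by positivity) (by linarith)
    linear_combination this - b * r0
  have h4 : 1.414 * b < √2 * b := mul_lt_mul_of_pos_right r1 h1
  obtain ⟨⟨a1, a2⟩, ⟨a3, a4⟩, ⟨a5, a6⟩, a7, a8⟩ := hp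
  obtain ⟨⟨b1, b2⟩, ⟨b3, b4⟩, ⟨b5, b6⟩, b7, b8⟩ := hq
  cases X <;> cases Y <;> simp only at hX hY <;> simp only [Octagon.edge₀]
  · linarith
  · linarith
  · have := sqrt_two_mul_mono (show 2 - √2 ≤ b by linarith)
    linarith
  · linarith
  · have e1 : √2 * (p 0 + a + (p 1 + b)) = 2 := by rw [hX, r0]
    have e2 : √2 * (p 0 + p 1) = -2 := by rw [hY]; linarith
    have := sqrt_two_mul_mono (show 2 * √2 - 2 ≤ b by linarith)
    linarith
  · have := sqrt_two_mul_mono (show 2 - √2 ≤ b by linarith)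
    linarith
  · linarith
  · linarith
  · linarith

theorem IsCoding.admissible {v : Fin 2 → ℝ} {τ : ℝ → Surface} {w : Word} {t : ℤ → ℝ}
    {e : ℤ → (Fin 2 → ℝ)} (h : IsCoding v τ w t e) (hv : Sector v) (n : ℤ) :
    Octagon.edge₀ (w n) (w (n + 1)) :=
  hv.edge₀ (sub_pos.2 (h.lt_succ n)) (h.mem n) (h.exit_mem n) (h.height_entry n) (h.height_exit n)

/-! ## The positions of the chords with respect to the cuts -/

/-- The linear part of `cutForm`. -/
def cutLin : Letter → (Fin 2 → ℝ) → ℝ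
  | .A, _ => 0
  | .B, p => (3 + 2 * √2) * p 1 - p 0
  | .C, p => 2 * (1 + √2) * p 1 - p 0
  | .D, p => (1 + 2 * √2) * p 1 - p 0

theorem cutForm_add_smul (X : Letter) (p v : Fin 2 → ℝ) (r : ℝ) :
    cutForm X (p + r • v) = cutForm X p + r * cutLin X v := by
  cases X <;> simp [cutForm, cutLin] <;> ring

/-- Translated by the period of `X`, the second half of the cut lies on the line of the first. In
the development across `X` the cut is thus straight. -/
theorem cutForm_neg_sub_period {X : Letter} (hX : X ≠ .A) (p : Fin 2 → ℝ) :
    -cutForm X (-(p - period X)) = cutForm X p := by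
  have r0 := sqrt_two_mul_self
  cases X <;> simp [cutForm] at hX ⊢ <;> linarith

/-- The letters `Y` such that the chords entering through `Y` and exiting through `X` enter above
the cut of `X`. -/
def above : Letter → Letter → Bool
  | .B, .D => true
  | .C, .C => true
  | .D, .B => true
  | _, _ => false

/-- Each of `B`, `C`, `D` has exactly two neighbours in the diagram (`C` being one of its own), and
`above` tells them apart. -/
theorem edge₀_above {X Y Z : Letter} (hX : X ≠ .A) (hY : edge₀ X Y) (hZ : edge₀ X Z) :
    Y = Z ↔ above X Y = above X Z := by
  revert hX hY hZ
  cases X <;> cases Y <;> cases Z <;> decide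

/-- The cut separates the two possible entry sides and touches them at most in vertices. The strict
inequality comes from a height that reaches $\pm1$ on this side only at a vertex. -/
theorem cutForm_entry {X Y : Letter} (hX : X ≠ .A) (h : edge₀ X Y) {p : Fin 2 → ℝ}
    (hp : p ∈ octagon) (hv : ¬ IsVertex p) (hY : height Y p = -1) :
    if above X Y = true then 0 < cutForm X p else cutForm X p < 0 := by
  have r0 := sqrt_two_mul_self
  have r1 := sqrt_two_gt
  have r2 := sqrt_two_lt
  have hne : ∀ Z, Z ≠ Y → |height Z p| < 1 := fun Z hZ => lt_of_le_of_ne (hp Z) fun h =>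
    hv (isVertex_of_abs_height hp hZ h (by rw [hY]; simp))
  have lt1 : ∀ Z, Z ≠ Y → height Z p < 1 := fun Z hZ => (abs_lt.1 (hne Z hZ)).2
  have lt2 : ∀ Z, Z ≠ Y → -1 < height Z p := fun Z hZ => (abs_lt.1 (hne Z hZ)).1
  have hmul : ∀ x : ℝ, -1 < √2 / 2 * x → 0 < √2 + x := by
    intro x h; nlinarith
  have scale : ∀ {x : ℝ}, 0 < x → 0 < √2 * x := fun hx => mul_pos (by positivity) hx
  rw [height_eq_neg_one_iff] at hY
  cases X <;> cases Y <;> simp [Octagon.edge₀] at h <;> simp [above, cutForm] at hX hY ⊢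
  · have h1 := hmul _ (by simpa using lt2 .D (by simp))
    have h2 := scale h1
    simp only [hY] at h2 ⊢
    linarith
  · have h1 := lt2 .C (by simp)
    rw [height_C] at h1
    have h2 := scale (neg_lt_iff_pos_add.1 h1)
    have h3 : p 1 = p 0 + √2 := by linarith
    simp only [h3] at h2 ⊢
    linarith
  · have h1 := lt2 .C (by simp)
    rw [height_C] at h1
    have h2 := scale (neg_lt_iff_pos_add.1 h1)
    have h3 : p 1 = -√2 - p 0 := by linarith
    simp only [h3] at h2 ⊢
    linarith
  · have h1 := hmul _ (by simpa using lt2 .B (by simp))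
    have h2 := scale h1
    simp only [hY] at h2 ⊢
    linarith
  · have h1 := hmul _ (by simpa using lt2 .B (by simp))
    have h2 := scale h1
    simp only [hY] at h2 ⊢
    linarith
  · have h1 := lt2 .A (by simp)
    rw [height_A] at h1
    have h2 := scale (neg_lt_iff_pos_add.1 h1)
    have h3 : p 0 = -√2 - p 1 := by linarith
    simp only [h3] at h2 ⊢
    linarith

theorem cutForm_exit {X Z : Letter} (hX : X ≠ .A) (h : edge₀ X Z) {p : Fin 2 → ℝ}
    (hp : p ∈ octagon) (hv : ¬ IsVertex p) (hZ : height Z p = 1) :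
    if above X Z = true then -cutForm X (-p) < 0 else 0 < -cutForm X (-p) := by
  have := cutForm_entry hX h (neg_mem_octagon hp) (by rwa [isVertex_neg]) (by rw [height_neg, hZ])
  split_ifs at this ⊢ <;> linarith

/-- A chord meeting the first half of the cut of `X` exits through `X`. -/
theorem Sector.exit_eq {v s : Fin 2 → ℝ} (hv : Sector v) {X Z : Letter} (hX : X ≠ .A)
    (hs : s ∈ octagon) (hc : cutForm X s = 0) {ρ : ℝ} (hρ : 0 ≤ ρ) (hq : s + ρ • v ∈ octagon)
    (hqv : ¬ IsVertex (s + ρ • v)) (hZ : height Z (s + ρ • v) = 1) : Z = X := by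
  have r0 := sqrt_two_mul_self
  have r1 := sqrt_two_gt
  have r2 := sqrt_two_lt
  set a := ρ * v 0 with ha
  set b := ρ * v 1 with hb
  set q := s + ρ • v with hqdef
  have hq0 : q 0 = s 0 + a := by simp [hqdef, ha]
  have hq1 : q 1 = s 1 + b := by simp [hqdef, hb]
  have h1 : 0 ≤ b := mul_nonneg hρ hv.1.le
  have h2 : (1 + √2) * b ≤ a := by
    have := mul_le_mul_of_nonneg_left hv.2.le hρ
    rw [hb, ha]; linarith
  have h3 : 0 ≤ √2 * a - √2 * b - 2 * b := by
    have : 0 ≤ √2 * (a - (1 + √2) * b) := mul_nonneg (by positivity) (by linarith)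
    linear_combination this - b * r0
  by_contra hne
  have lt : height X q < 1 := lt_of_le_of_ne (abs_le.1 (hq X)).2 fun h =>
    hqv (isVertex_of_abs_height hq hne (by rw [hZ]; simp) (by rw [h]; simp))
  rw [height_eq_one_iff] at hZ
  rw [mem_octagon] at hs hq
  simp only [hq0, hq1] at hZ hq
  obtain ⟨⟨a1, a2⟩, ⟨a3, a4⟩, ⟨a5, a6⟩, a7, a8⟩ := hs
  obtain ⟨⟨b1, b2⟩, ⟨b3, b4⟩, ⟨b5, b6⟩, b7, b8⟩ := hq
  have hmul' : ∀ x : ℝ, √2 / 2 * x < 1 → x < √2 := by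
    intro x h; nlinarith
  have sc := @sqrt_two_mul_mono
  have scl : ∀ {x y : ℝ}, x < y → √2 * x < √2 * y := fun h =>
    mul_lt_mul_of_pos_left h (by positivity)
  cases X <;> cases Z <;> simp only [ne_eq, reduceCtorEq, not_false_eq_true, not_true_eq_false,
    cutForm, hq0, hq1, height_B, height_C, height_D] at hX hne hZ lt hc
  · have k : √2 - 1 ≤ s 1 := by by_contra hk; have := scl (not_le.1 hk); linarith
    have := hmul' _ lt
    have := sc k
    have e : √2 * (s 1 + b) = √2 := by rw [hZ, mul_one]
    linarith
  · have k : √2 - 1 ≤ s 1 := by by_contra hk; have := scl (not_le.1 hk); linarith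
    have := hmul' _ lt
    linarith
  · have k : √2 - 1 ≤ s 1 := by by_contra hk; have := scl (not_le.1 hk); linarith
    linarith
  · have k : s 1 ≤ 0 := by by_contra hk; have := scl (not_le.1 hk); linarith
    have := sc (show 1 ≤ b by linarith)
    linarith
  · have k : 1 - √2 ≤ s 1 := by by_contra hk; have := scl (not_le.1 hk); linarith
    have := sc k
    have := sc (show √2 - 1 ≤ s 1 + b by linarith)
    linarith
  · have k : 1 - √2 ≤ s 1 := by by_contra hk; have := scl (not_le.1 hk); linarith
    linarith
  · have k : s 1 ≤ 0 := by by_contra hk; have := scl (not_le.1 hk); linarith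
    have := sc a3
    have := sc (show 1 ≤ b by linarith)
    linarith
  · have := hmul' _ lt
    have := sc a3
    have := sc (show √2 - 1 ≤ s 1 + b by linarith)
    linarith
  · have := hmul' _ lt
    have := sc a3
    have := sc (show 1 - √2 ≤ s 1 + b by linarith)
    linarith

/-- A chord meeting the second half of the cut of `X` enters through `X`. -/
theorem Sector.entry_eq {v s : Fin 2 → ℝ} (hv : Sector v) {X Z : Letter} (hX : X ≠ .A)
    (hs : s ∈ octagon) (hc : cutForm X (-s) = 0) {p : Fin 2 → ℝ} {ρ : ℝ} (hρ : 0 ≤ ρ)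
    (hp : p ∈ octagon) (hsp : s = p + ρ • v) (hpv : ¬ IsVertex p) (hZ : height Z p = -1) :
    Z = X := by
  have e : -s + ρ • v = -p := by rw [hsp]; abel
  refine hv.exit_eq hX (neg_mem_octagon hs) hc hρ ?_ ?_ ?_ <;> rw [e]
  · exact neg_mem_octagon hp
  · rwa [isVertex_neg]
  · rw [height_neg, hZ]; simp

/-- The first half of the cut of `Y` lies on one side of the second half of the cut of `X`. -/
theorem cutForm_neg_of_cutForm_eq_zero {X Y : Letter} (hX : X ≠ .A) (hY : Y ≠ .A)
    (h : Octagon.edge₀ X Y) {s : Fin 2 → ℝ} (hs : s ∈ octagon) (hc : cutForm Y s = 0) :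
    if above X Y = true then -cutForm X (-s) < 0 else 0 < -cutForm X (-s) := by
  have r0 := sqrt_two_mul_self
  have r1 := sqrt_two_gt
  have r2 := sqrt_two_lt
  obtain ⟨⟨a1, a2⟩, ⟨a3, a4⟩, ⟨a5, a6⟩, a7, a8⟩ := mem_octagon.1 hs
  cases X <;> cases Y <;> simp [Octagon.edge₀] at h <;> simp [above, cutForm] at hX hY hc ⊢
  · linarith
  · nlinarith
  · linarith
  · linarith
  · nlinarith

/-! ## Crossings of the sheared octagon -/

theorem exists_zero_of_affine {g : ℝ → ℝ} {l a b : ℝ} (hg : ∀ x y, g y = g x + (y - x) * l)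
    (hab : a < b) (h : g a * g b < 0) : ∃ c, a < c ∧ c < b ∧ g c = 0 := by
  have h1 := hg a b
  have key : ∀ l, l ≠ 0 → g b = g a + (b - a) * l → b - (a - g a / l) = g b / l := by
    intro l hl h1
    rw [h1]; field_simp; ring
  rcases mul_neg_iff.1 h with ⟨h2, h3⟩ | ⟨h2, h3⟩
  · have hl : l < 0 := by
      by_contra hl
      have := mul_nonneg (sub_pos.2 hab).le (not_lt.1 hl)
      linarith
    refine ⟨a - g a / l, ?_, ?_, ?_⟩
    · linarith [div_neg_of_pos_of_neg h2 hl]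
    · linarith [div_pos_of_neg_of_neg h3 hl, key l hl.ne h1]
    · rw [hg a, sub_sub_cancel_left, neg_mul, div_mul_cancel₀ _ hl.ne, add_neg_cancel]
  · have hl : 0 < l := by
      by_contra hl
      have := mul_nonpos_of_nonneg_of_nonpos (sub_pos.2 hab).le (not_lt.1 hl)
      linarith
    refine ⟨a - g a / l, ?_, ?_, ?_⟩
    · linarith [div_neg_of_neg_of_pos h2 hl]
    · linarith [div_pos h3 hl, key l hl.ne' h1]
    · rw [hg a]; field_simp; ring

namespace IsCoding

variable {v : Fin 2 → ℝ} {τ : ℝ → Surface} {w : Word} {t : ℤ → ℝ} {e : ℤ → (Fin 2 → ℝ)}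

/-- The position of the developed trajectory with respect to the cut of the letter `w n`. -/
def cutPos (_ : IsCoding v τ w t e) (n : ℤ) (a : ℝ) : ℝ :=
  cutForm (w n) (e (n - 1) + (a - t (n - 1)) • v)

theorem cutPos_affine (h : IsCoding v τ w t e) (n : ℤ) (a b : ℝ) :
    h.cutPos n b = h.cutPos n a + (b - a) * cutLin (w n) v := by
  simp only [cutPos, cutForm_add_smul]
  ring

/-- Read in the next copy of the octagon, the line is the second half of the cut. So one affine
function of time serves for both chords adjacent to the crossing of `w n`. -/
theorem cutPos_eq_neg (h : IsCoding v τ w t e) {n : ℤ} (hn : w n ≠ .A) (a : ℝ) :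
    h.cutPos n a = -cutForm (w n) (-(e n + (a - t n) • v)) := by
  have := h.chord_succ (n - 1) a
  rw [sub_add_cancel] at this
  rw [this, cutForm_neg_sub_period hn]
  rfl

theorem cutPos_entry (h : IsCoding v τ w t e) (hv : Sector v) {n : ℤ} (hn : w n ≠ .A) :
    if above (w n) (w (n - 1)) = true then 0 < h.cutPos n (t (n - 1))
      else h.cutPos n (t (n - 1)) < 0 := by
  have h1 := h.admissible hv (n - 1)
  rw [sub_add_cancel] at h1
  have := cutForm_entry hn (edge₀_symm h1) (h.mem (n - 1))
    (h.not_isVertex (h.mem _) (h.pr_eq _)) (h.height_entry _)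
  simpa [cutPos] using this

theorem cutPos_exit (h : IsCoding v τ w t e) (hv : Sector v) {n : ℤ} (hn : w n ≠ .A) :
    if above (w n) (w (n + 1)) = true then h.cutPos n (t (n + 1)) < 0
      else 0 < h.cutPos n (t (n + 1)) := by
  have := cutForm_exit hn (h.admissible hv n) (h.exit_mem n)
    (h.not_isVertex (h.exit_mem n) (h.chord (h.lt_succ n).le le_rfl)) (h.height_exit n)
  rwa [← h.cutPos_eq_neg hn] at this

theorem sandwiched_iff (h : IsCoding v τ w t e) (hv : Sector v) {n : ℤ} (hn : w n ≠ .A) :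
    w (n - 1) = w (n + 1) ↔ above (w n) (w (n - 1)) = above (w n) (w (n + 1)) := by
  have h1 := h.admissible hv (n - 1)
  rw [sub_add_cancel] at h1
  exact edge₀_above hn (edge₀_symm h1) (h.admissible hv n)

/-- A neighbour lying above the cut at the entry lies below it when it is the exit side. The same
neighbour before and after therefore forces a change of sign. -/
theorem cutPos_mul_neg (h : IsCoding v τ w t e) (hv : Sector v) {n : ℤ} (hn : w n ≠ .A)
    (hs : w (n - 1) = w (n + 1)) : h.cutPos n (t (n - 1)) * h.cutPos n (t (n + 1)) < 0 := by
  have h1 := h.cutPos_entry hv hn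
  have h2 := h.cutPos_exit hv hn
  rw [← hs] at h2
  split_ifs at h1 h2
  · exact mul_neg_of_pos_of_neg h1 h2
  · exact mul_neg_of_neg_of_pos h1 h2

theorem exists_crossing (h : IsCoding v τ w t e) (hv : Sector v) {n : ℤ}
    (hs : w (n - 1) = w (n + 1)) : ∃ c, t (n - 1) < c ∧ c < t (n + 1) ∧
      (w n = .A → c = t n) ∧ (w n ≠ .A → h.cutPos n c = 0) := by
  have lt := h.lt_succ
  by_cases hn : w n = .A
  · exact ⟨t n, by have := lt (n - 1); rwa [sub_add_cancel] at this, lt n, fun _ => rfl,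
      fun h => absurd hn h⟩
  · obtain ⟨c, h1, h2, h3⟩ := exists_zero_of_affine (h.cutPos_affine n)
      (h.mono (show n - 1 < n + 1 by omega)) (h.cutPos_mul_neg hv hn hs)
    exact ⟨c, h1, h2, fun h => absurd h hn, fun _ => h3⟩

theorem crossing_unique (h : IsCoding v τ w t e) (hv : Sector v) {n : ℤ}
    (hs : w (n - 1) = w (n + 1)) {c c' : ℝ} (h1 : w n = .A → c = t n)
    (h2 : w n ≠ .A → h.cutPos n c = 0) (h1' : w n = .A → c' = t n)
    (h2' : w n ≠ .A → h.cutPos n c' = 0) : c = c' := by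
  by_cases hn : w n = .A
  · rw [h1 hn, h1' hn]
  · have e := h.cutPos_affine n c c'
    rw [h2 hn, h2' hn, zero_add] at e
    rcases mul_eq_zero.1 e.symm with e | e
    · linarith
    · have e' := h.cutPos_affine n (t (n - 1)) (t (n + 1))
      have := h.cutPos_mul_neg hv hn hs
      rw [e, mul_zero, add_zero] at e'
      rw [e'] at this
      nlinarith [mul_self_nonneg (h.cutPos n (t (n - 1)))]

/-- At time `c'` the trajectory is on the first half of the next cut, which lies entirely on the
exit side of the present one. So the present cut has already been crossed, by affinity of `cutPos`.
-/
theorem crossing_lt_succ (h : IsCoding v τ w t e) (hv : Sector v) {n : ℤ}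
    (hs : w (n - 1) = w (n + 1)) {c c' : ℝ}
    (h1 : w n = .A → c = t n) (h2 : w n ≠ .A → h.cutPos n c = 0) (hc : c < t (n + 1))
    (h1' : w (n + 1) = .A → c' = t (n + 1)) (h2' : w (n + 1) ≠ .A → h.cutPos (n + 1) c' = 0)
    (hc' : t n < c') : c < c' := by
  by_cases hn : w n = .A
  · rwa [h1 hn]
  by_cases hn' : w (n + 1) = .A
  · rwa [h1' hn']
  by_contra hle
  push Not at hle
  have z := h2 hn
  have z' := h2' hn'
  have hmem := h.chord_mem (n := n) (a := c') hc'.le (hle.trans hc.le)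
  have e1 : cutForm (w (n + 1)) (e n + (c' - t n) • v) = 0 := by
    have : n + 1 - 1 = n := by ring
    rw [cutPos, this] at z'
    exact z'
  have h3 := cutForm_neg_of_cutForm_eq_zero hn hn' (h.admissible hv n) hmem e1
  rw [← h.cutPos_eq_neg hn] at h3
  have h4 := h.cutPos_entry hv hn
  rw [hs] at h4
  have a1 := h.cutPos_affine n (t (n - 1)) c
  have a2 := h.cutPos_affine n (t (n - 1)) c'
  have l1 : t (n - 1) < t n := h.mono (by omega)
  split_ifs at h3 h4 <;> nlinarith

/-- `Sector.exit_eq` and `Sector.entry_eq` show that the chord through the cut ends or starts on the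
side `X`. An affine function with a zero between two times at which it does not vanish changes sign,
so the two neighbours of that letter coincide. -/
theorem exists_sandwiched_of_crossing (h : IsCoding v τ w t e) (hv : Sector v) {a : ℝ}
    {X : Letter} (hX : X ≠ .A) {s : Fin 2 → ℝ} (hs : s ∈ octagon) (ha : τ a = pr s)
    (hc : OnCut X s) : ∃ n, w n = X ∧ w (n - 1) = w (n + 1) ∧ h.cutPos n a = 0 := by
  obtain ⟨m, h1, h2, h3⟩ := h.exists_chord hs ha
  have key : ∀ n, w n = X → h.cutPos n a = 0 → t (n - 1) ≤ a → a ≤ t (n + 1) →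
      ∃ n, w n = X ∧ w (n - 1) = w (n + 1) ∧ h.cutPos n a = 0 := by
    intro n hn hz l1 l2
    refine ⟨n, hn, ?_, hz⟩
    have hA : w n ≠ .A := hn ▸ hX
    rw [h.sandwiched_iff hv hA]
    have g1 := h.cutPos_entry hv hA
    have g2 := h.cutPos_exit hv hA
    have a1 := h.cutPos_affine n (t (n - 1)) a
    have a2 := h.cutPos_affine n a (t (n + 1))
    rw [hz] at a1 a2
    by_contra hne
    have p1 := fun hl : 0 ≤ cutLin (w n) v => mul_nonneg (sub_nonneg.2 l1) hl
    have p2 := fun hl : 0 ≤ cutLin (w n) v => mul_nonneg (sub_nonneg.2 l2) hl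
    have p3 := fun hl : cutLin (w n) v ≤ 0 => mul_nonpos_of_nonneg_of_nonpos (sub_nonneg.2 l1) hl
    have p4 := fun hl : cutLin (w n) v ≤ 0 => mul_nonpos_of_nonneg_of_nonpos (sub_nonneg.2 l2) hl
    split_ifs at g1 g2 with c1 c2 c2
    · exact hne (c1.trans c2.symm)
    · rcases le_total 0 (cutLin (w n) v) with hl | hl
      · linarith [p1 hl]
      · linarith [p4 hl]
    · rcases le_total 0 (cutLin (w n) v) with hl | hl
      · linarith [p2 hl]
      · linarith [p3 hl]
    · rw [Bool.not_eq_true] at c1 c2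
      exact hne (c1.trans c2.symm)
  rcases hc with hc | hc
  · have : w (m + 1) = X := by
      have e1 : s + (t (m + 1) - a) • v = e m + (t (m + 1) - t m) • v := by
        rw [h3, add_assoc, ← add_smul]; congr 2; ring
      refine hv.exit_eq hX hs hc (ρ := t (m + 1) - a) (by linarith) ?_ ?_ ?_ <;> rw [e1]
      · exact h.exit_mem m
      · exact h.not_isVertex (h.exit_mem m) (h.chord (h.lt_succ m).le le_rfl)
      · exact h.height_exit m
    refine key (m + 1) this ?_ (by simpa using h1) (h2.trans (h.lt_succ _).le)
    rw [cutPos, this, add_sub_cancel_right, ← h3, hc]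
  · have : w m = X := hv.entry_eq hX hs hc (ρ := a - t m) (by linarith) (h.mem m) h3
      (h.not_isVertex (h.mem m) (h.pr_eq m)) (h.height_entry m)
    refine key m this ?_ ((h.mono.monotone (by omega)).trans h1) h2
    rw [h.cutPos_eq_neg (this ▸ hX), ← h3, this, hc, neg_zero]

/-- The derived sequence of the cutting sequence of a trajectory with direction in the first
sector is the cutting sequence of the same trajectory with respect to the sheared octagon. -/
theorem isCuttingSequenceWrt (h : IsCoding v τ w t e) (hv : Sector v) {Ψ : Surface ≃ₜ Surface}
    (hΨ : ∀ x, Ψ (Ψ x) = x) (hA : ∀ x ∈ side .A, Ψ x ∈ side .A)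
    (hcut : ∀ X, ∀ s ∈ octagon, OnCut X s → Ψ (pr s) ∈ side X)
    (hcut' : ∀ X, X ≠ .A → ∀ x ∈ side X, ∃ s ∈ octagon, pr s = Ψ x ∧ OnCut X s)
    {w' : Word} (hw' : IsDerived w w') : IsCuttingSequenceWrt Ψ τ w' := by
  obtain ⟨i, hi, hir, hiw⟩ := hw'
  have hsw : ∀ k, w (i k - 1) = w (i k + 1) := fun k => by
    have : i k ∈ Set.range i := ⟨k, rfl⟩
    rw [hir] at this
    exact this
  choose c c1 c2 c3 c4 using fun k => h.exists_crossing hv (hsw k)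
  have himg : ∀ X x, Ψ x ∈ side X → x ∈ Ψ '' side X := fun X x hx => ⟨Ψ x, hx, hΨ x⟩
  have hpr : ∀ n a, w n ≠ .A → t (n - 1) ≤ a → a ≤ t (n + 1) → h.cutPos n a = 0 →
      τ a ∈ Ψ '' side (w n) := by
    intro n a hn l1 l2 hz
    apply himg
    rcases le_total a (t n) with l3 | l3
    · have l4 : a ≤ t (n - 1 + 1) := by rwa [sub_add_cancel]
      rw [h.chord l1 l4]
      exact hcut _ _ (h.chord_mem l1 l4) (Or.inl hz)
    · rw [h.chord l3 l2]
      refine hcut _ _ (h.chord_mem l3 l2) (Or.inr ?_)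
      rw [h.cutPos_eq_neg hn] at hz
      linarith
  have hmem : ∀ k, τ (c k) ∈ Ψ '' side (w' k) := by
    intro k
    rw [hiw]
    by_cases hk : w (i k) = .A
    · rw [hk, c3 k hk]
      refine himg _ _ (hA _ ?_)
      have : t (i k) ∈ Set.range t := ⟨_, rfl⟩
      rw [h.pr_eq]
      exact ⟨⟨_, h.mem (i k)⟩, proj_eq_pr _, by rw [← hk, h.height_entry]; simp⟩
    · exact hpr _ _ hk (c1 k).le (c2 k).le (c4 k hk)
  refine ⟨c, ?_, ?_, hmem⟩
  · intro k l hkl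
    have hik := hi hkl
    -- Only adjacent indices need `crossing_lt_succ`: otherwise `c k < t (i k + 1) ≤ t (i l - 1) < c
    -- l`.
    rcases (show i k + 1 ≤ i l from hik).eq_or_lt with h1 | h1
    · have e1 := c2 k
      have e2 := c1 l
      have e3 := c3 l
      have e4 := c4 l
      rw [← h1] at e2 e3 e4
      rw [add_sub_cancel_right] at e2
      exact h.crossing_lt_succ hv (hsw k) (c3 k) (c4 k) e1 e3 e4 e2
    · exact (c2 k).trans_le ((h.mono.monotone (by omega)).trans (c1 l).le)
  · ext a
    constructor
    · rintro ⟨k, rfl⟩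
      exact ⟨_, hmem k⟩
    · rintro ⟨X, x, hx, hxa⟩
      have key : ∀ n, w (n - 1) = w (n + 1) → (w n = .A → a = t n) →
          (w n ≠ .A → h.cutPos n a = 0) → a ∈ Set.range c := by
        intro n hn h1 h2
        have : n ∈ Set.range i := by rw [hir]; exact hn
        obtain ⟨k, rfl⟩ := this
        exact ⟨k, h.crossing_unique hv hn (c3 k) (c4 k) h1 h2⟩
      by_cases hX : X = .A
      · have ha : τ a ∈ side .A := by rw [← hxa]; exact hA _ (hX ▸ hx)
        have : a ∈ Set.range t := by rw [h.range]; exact ⟨_, ha⟩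
        obtain ⟨n, rfl⟩ := this
        have hn : w n = .A := by
          refine side_unique (h.isTraj.1 (t n)) ?_ ha
          rw [h.pr_eq]
          exact ⟨⟨_, h.mem n⟩, proj_eq_pr _, by rw [h.height_entry]; simp⟩
        -- The only neighbour of `A` is `D`, so `A` is always sandwiched.
        refine key n ?_ (fun _ => rfl) (fun h' => absurd hn h')
        have d1 := h.admissible hv (n - 1)
        have d2 := h.admissible hv n
        rw [sub_add_cancel] at d1
        rw [hn] at d1 d2
        revert d1 d2
        generalize w (n - 1) = Y
        generalize w (n + 1) = Z
        cases Y <;> cases Z <;> simp [Octagon.edge₀]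
      · obtain ⟨s, hs, h1, h2⟩ := hcut' X hX x hx
        obtain ⟨n, hn, h3, h4⟩ := h.exists_sandwiched_of_crossing hv hX hs
          (a := a) (by rw [h1, hxa]) h2
        exact key n h3 (fun h' => absurd (hn.symm.trans h') hX) (fun _ => h4)

end IsCoding

/-! ## Existence of derived sequences -/

/-- `A` is always sandwiched, and a letter that is not has two different neighbours, one of them
closer to `A` in the chain. So every window of radius three contains a sandwiched index; these
indices are unbounded both ways and order isomorphic to the integers. -/
theorem exists_isDerived {w : Word} (hw : ∀ n, edge₀ (w n) (w (n + 1))) :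
    ∃ w', IsDerived w w' := by
  let S : Set ℤ := {n | w (n - 1) = w (n + 1)}
  have mk : ∀ n Z, w n = Z → ∀ m, m = n → w m = Z := fun n Z h m hm => hm ▸ h
  have nb : ∀ n, edge₀ (w n) (w (n - 1)) := fun n => by
    have := hw (n - 1)
    rw [sub_add_cancel] at this
    exact edge₀_symm this
  have hA : ∀ n, w n = .A → n ∈ S := by
    intro n hn
    have h1 := nb n
    have h2 := hw n
    show w (n - 1) = w (n + 1)
    rw [hn] at h1 h2
    revert h1 h2
    generalize w (n - 1) = Y
    generalize w (n + 1) = Z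
    cases Y <;> cases Z <;> simp [edge₀]
  have hD : ∀ n, w n = .D → ∃ m ∈ S, |m - n| ≤ 1 := by
    intro n hn
    have h1 := nb n
    have h2 := hw n
    by_cases c1 : w (n - 1) = .A
    · exact ⟨n - 1, hA _ c1, by simp⟩
    by_cases c2 : w (n + 1) = .A
    · exact ⟨n + 1, hA _ c2, by simp⟩
    refine ⟨n, ?_, by simp⟩
    show w (n - 1) = w (n + 1)
    rw [hn] at h1 h2
    revert h1 h2 c1 c2
    generalize w (n - 1) = Y
    generalize w (n + 1) = Z
    cases Y <;> cases Z <;> simp [edge₀]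
  have hB : ∀ n, w n = .B → ∃ m ∈ S, |m - n| ≤ 2 := by
    intro n hn
    have h1 := nb n
    have h2 := hw n
    by_cases c1 : w (n - 1) = .D
    · obtain ⟨m, hm, hm'⟩ := hD _ c1
      exact ⟨m, hm, by rw [abs_le] at *; constructor <;> omega⟩
    by_cases c2 : w (n + 1) = .D
    · obtain ⟨m, hm, hm'⟩ := hD _ c2
      exact ⟨m, hm, by rw [abs_le] at *; constructor <;> omega⟩
    refine ⟨n, ?_, by simp⟩
    show w (n - 1) = w (n + 1)
    rw [hn] at h1 h2
    revert h1 h2 c1 c2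
    generalize w (n - 1) = Y
    generalize w (n + 1) = Z
    cases Y <;> cases Z <;> simp [edge₀]
  have hall : ∀ n, ∃ m ∈ S, |m - n| ≤ 3 := by
    intro n
    have wk : ∀ k : ℤ, |k - n| ≤ 1 → (∃ m ∈ S, |m - k| ≤ 2) → ∃ m ∈ S, |m - n| ≤ 3 := by
      rintro k hk ⟨m, hm, hm'⟩
      exact ⟨m, hm, by rw [abs_le] at *; constructor <;> omega⟩
    have wk1 : ∀ k : ℤ, (∃ m ∈ S, |m - k| ≤ 1) → ∃ m ∈ S, |m - k| ≤ 2 := by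
      rintro k ⟨m, hm, hm'⟩
      exact ⟨m, hm, by linarith⟩
    rcases h : w n with _ | _ | _ | _
    · exact ⟨n, hA n h, by simp⟩
    · exact wk n (by simp) (hB n h)
    · have h1 := nb n
      have h2 := hw n
      by_cases c1 : w (n - 1) = .B
      · exact wk _ (by simp) (hB _ c1)
      by_cases c2 : w (n + 1) = .B
      · exact wk _ (by simp) (hB _ c2)
      refine ⟨n, ?_, by simp⟩
      show w (n - 1) = w (n + 1)
      rw [h] at h1 h2
      revert h1 h2 c1 c2
      generalize w (n - 1) = Y
      generalize w (n + 1) = Z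
      cases Y <;> cases Z <;> simp [edge₀]
    · exact wk n (by simp) (wk1 _ (hD n h))
  have : Nonempty S := let ⟨m, hm, _⟩ := hall 0; ⟨⟨m, hm⟩⟩
  have : NoMaxOrder S := ⟨fun a => by
    obtain ⟨m, hm, hm'⟩ := hall (a.1 + 4)
    refine ⟨⟨m, hm⟩, ?_⟩
    show a.1 < m
    rw [abs_le] at hm'; omega⟩
  have : NoMinOrder S := ⟨fun a => by
    obtain ⟨m, hm, hm'⟩ := hall (a.1 - 4)
    refine ⟨⟨m, hm⟩, ?_⟩
    show m < a.1
    rw [abs_le] at hm'; omega⟩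
  classical
  let : LocallyFiniteOrder S := inferInstance
  let : SuccOrder S := LinearLocallyFiniteOrder.succOrder S
  let : PredOrder S := LinearLocallyFiniteOrder.predOrder S
  let f : S ≃o ℤ := orderIsoIntOfLinearSuccPredArch
  refine ⟨fun k => w (f.symm k).1, fun k => (f.symm k).1, ?_, ?_, fun _ => rfl⟩
  · intro a b hab
    exact f.symm.strictMono hab
  · ext n
    constructor
    · rintro ⟨k, rfl⟩
      exact (f.symm k).2
    · intro hn
      exact ⟨f ⟨n, hn⟩, by simp⟩


/-! ## Periodic directions -/

theorem IsPeriodicTraj.of_comp_mul {τ : ℝ → Surface} {c : ℝ} (hc : c ≠ 0)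
    (h : IsPeriodicTraj fun s => τ (c * s)) : IsPeriodicTraj τ := by
  obtain ⟨P, hP, H⟩ := h
  have key : ∀ s, τ (s + c * P) = τ s := fun s => by
    have : τ (c * (s / c + P)) = τ (c * (s / c)) := H (s / c)
    rwa [mul_add, mul_div_cancel₀ _ hc] at this
  rcases lt_or_gt_of_ne hc with h | h
  · refine ⟨-(c * P), by nlinarith, fun s => ?_⟩
    rw [← key, neg_add_cancel_right]
  · exact ⟨c * P, by positivity, key⟩

theorem IsPeriodicTraj.of_comp {τ : ℝ → Surface} (Φ : Surface ≃ₜ Surface)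
    (h : IsPeriodicTraj fun s => Φ (τ s)) : IsPeriodicTraj τ := by
  obtain ⟨P, hP, H⟩ := h
  exact ⟨P, hP, fun s => Φ.injective (H s)⟩

theorem IsTraj.follow_to {v : Fin 2 → ℝ} {τ : ℝ → Surface} (hτ : IsTraj v τ) {a : ℝ}
    {p q : Fin 2 → ℝ} (hp : p ∈ octagon) (ha : τ a = pr p) (R : ℝ) (hq : q ∈ octagon)
    (h0 : q 0 = p 0 + R * v 0) (h1 : q 1 = p 1 + R * v 1) : τ (a + R) = pr q := by
  have e : q = p + R • v := ext_fin_two (by simpa using h0) (by simpa using h1)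
  rw [e]
  exact hτ.follow hp ha (e ▸ hq)

theorem IsTraj.follow_through {v : Fin 2 → ℝ} {τ : ℝ → Surface} (hτ : IsTraj v τ) {a : ℝ}
    {p : Fin 2 → ℝ} (hp : p ∈ octagon) (ha : τ a = pr p) (R : ℝ) (X : Letter) (q : Fin 2 → ℝ)
    (hq : q ∈ octagon) (hX : height X q = -1) (h0 : q 0 = p 0 + R * v 0 - period X 0)
    (h1 : q 1 = p 1 + R * v 1 - period X 1) : τ (a + R) = pr q := by
  rw [← pr_add_period hq hX]
  refine hτ.follow_to hp ha R (add_period_mem hq hX) ?_ ?_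
  · simp only [Pi.add_apply, h0]; ring
  · simp only [Pi.add_apply, h1]; ring

theorem vec_mem_octagon {a b : ℝ} (h1 : -1 ≤ a) (h2 : a ≤ 1) (h3 : -1 ≤ b) (h4 : b ≤ 1)
    (h5 : -√2 ≤ a + b) (h6 : a + b ≤ √2) (h7 : -√2 ≤ a - b) (h8 : a - b ≤ √2) :
    ![a, b] ∈ octagon :=
  mem_octagon.2 ⟨⟨h1, h2⟩, ⟨h3, h4⟩, ⟨h5, h6⟩, h7, h8⟩

/-- The two values are the circumferences of the cylinders: the rectangle closes up across `C`, and
the trapezoids across `B` and `D`. A line in the lower trapezoid is first followed into the upper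
one. -/
theorem IsTraj.horizontal_period {τ : ℝ → Surface} (h : IsTraj ![1, 0] τ) :
    (∀ s, τ (s + 2) = τ s) ∨ ∀ s, τ (s + 2 * √2) = τ s := by
  have r0 := sqrt_two_mul_self
  have r1 := sqrt_two_gt
  have r2 := sqrt_two_lt
  have top : ∀ a p, p ∈ octagon → τ a = pr p → √2 - 1 ≤ p 1 →
      ∀ s, τ (s + 2 * √2) = τ s := by
    intro a p hp ha hy
    obtain ⟨⟨a1, a2⟩, ⟨a3, a4⟩, ⟨a5, a6⟩, a7, a8⟩ := mem_octagon.1 hp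
    have m1 : ![-p 1, p 1 - √2] ∈ octagon := by apply vec_mem_octagon <;> linarith
    have m2 : ![p 1 - √2, p 1] ∈ octagon := by apply vec_mem_octagon <;> linarith
    have s1 := h.follow_through hp ha (√2 - p 1 - p 0) .B _ m1
      (by rw [height_eq_neg_one_iff]; simp; ring) (by simp) (by simp)
    have s2 := h.follow_through m1 s1 (2 * p 1) .D _ m2
      (by rw [height_eq_neg_one_iff]; simp) (by simp; ring) (by simp)
    have s3 := h.follow_to m2 s2 (p 0 - p 1 + √2) hp (by simp) (by simp)
    refine h.periodic (a := a) ?_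
    rw [ha, ← s3]
    congr 1
    ring
  obtain ⟨p, hp, ha⟩ := exists_pr (τ 0)
  obtain ⟨⟨a1, a2⟩, ⟨a3, a4⟩, ⟨a5, a6⟩, a7, a8⟩ := mem_octagon.1 hp
  rcases le_total (√2 - 1) (p 1) with hy | hy
  · exact .inr (top 0 p hp ha.symm hy)
  rcases le_total (p 1) (1 - √2) with hy' | hy'
  · have m1 : ![p 1, p 1 + √2] ∈ octagon := by apply vec_mem_octagon <;> linarith
    have s1 := h.follow_through hp ha.symm (√2 + p 1 - p 0) .D _ m1
      (by rw [height_eq_neg_one_iff]; simp) (by simp) (by simp)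
    exact .inr (top _ _ m1 s1 (by simp; linarith))
  · have m1 : ![-1, p 1] ∈ octagon := by apply vec_mem_octagon <;> linarith
    have s1 := h.follow_through hp ha.symm (1 - p 0) .C _ m1
      (by rw [height_eq_neg_one_iff]; simp) (by simp; ring) (by simp)
    have s2 := h.follow_to m1 s1 (p 0 + 1) hp (by simp) (by simp)
    refine .inl (h.periodic (a := 0) ?_)
    rw [← ha, ← s2]
    congr 1
    ring

theorem IsTraj.isPeriodicTraj_of_horizontal {τ : ℝ → Surface} (h : IsTraj ![1, 0] τ) :
    IsPeriodicTraj τ :=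
  h.horizontal_period.elim (fun H => ⟨2, by norm_num, H⟩) fun H => ⟨2 * √2, by positivity, H⟩

/-- The quantity `L = p0 - (1 + √2) * p1` is constant along chords in direction $\pi/8$. The chords
with `|L| ≥ 2` form one cylinder, crossing `A` and `D`; those with `|L| ≤ 2` form the other,
crossing `B` and `C`. Positive `L` is reduced to negative `L` by following one chord. -/
theorem IsTraj.diagonal_period {τ : ℝ → Surface} (h : IsTraj ![1 + √2, 1] τ) :
    (∀ s, τ (s + (2 - √2)) = τ s) ∨ ∀ s, τ (s + √2) = τ s := by
  have r0 := sqrt_two_mul_self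
  have r1 := sqrt_two_gt
  have r2 := sqrt_two_lt
  have sc := @sqrt_two_mul_mono
  have thr : ∀ {a R p0 p1 q0 q1 : ℝ} (X : Letter), ![p0, p1] ∈ octagon → τ a = pr ![p0, p1] →
      ![q0, q1] ∈ octagon → height X ![q0, q1] = -1 →
      q0 = p0 + R * (1 + √2) - period X 0 → q1 = p1 + R - period X 1 → τ (a + R) = pr ![q0, q1] := by
    intro a R p0 p1 q0 q1 X hp ha hq hX h0 h1
    exact h.follow_through hp ha R X _ hq hX h0 (by simpa using h1)
  have fin : ∀ {a b R p0 p1 q0 q1 : ℝ} (P : ℝ), ![p0, p1] ∈ octagon → τ a = pr ![p0, p1] →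
      ![q0, q1] ∈ octagon → τ b = pr ![q0, q1] → p0 = q0 + R * (1 + √2) → p1 = q1 + R →
      b + R = a + P → ∀ s, τ (s + P) = τ s := by
    intro a b R p0 p1 q0 q1 P hp ha hq hb h0 h1 hab
    have := h.follow_to hq hb R hp h0 (by simpa using h1)
    exact h.periodic (a := a) (by rw [← hab, this, ha])
  have top : ∀ a p0 p1, ![p0, p1] ∈ octagon → τ a = pr ![p0, p1] → p0 - (1 + √2) * p1 ≤ -2 →
      ∀ s, τ (s + (2 - √2)) = τ s := by
    intro a p0 p1 hp ha hy
    obtain ⟨⟨a1, a2⟩, ⟨a3, a4⟩, ⟨a5, a6⟩, a7, a8⟩ := mem_octagon.1 hp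
    simp at a1 a2 a3 a4 a5 a6 a7 a8
    obtain ⟨L, hL⟩ : ∃ L, L = p0 - (1 + √2) * p1 := ⟨_, rfl⟩
    rw [← hL] at hy
    have c1 := sc a4
    have c3 := sc hy
    have c4 : -2 * √2 ≤ L := by linarith
    have c5 := sc c4
    have m1 : ![L + 1 + √2, -1] ∈ octagon := by apply vec_mem_octagon <;> linarith
    have m2 : ![-1 - L * √2 / 2 - √2, -1 - L * √2 / 2] ∈ octagon := by
      apply vec_mem_octagon <;> linarith
    have s1 := thr (R := 1 - p1) .A hp ha m1 (by rw [height_eq_neg_one_iff]; simp)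
      (by rw [period_zero]; linear_combination hL) (by rw [period_one]; ring)
    have s2 := thr (R := -L * √2 / 2 - √2) .D m1 s1 m2
      (by rw [height_eq_neg_one_iff]; simp)
      (by rw [period_zero]; linear_combination (L / 2 + 1) * r0) (by rw [period_one]; ring)
    exact fin (2 - √2) (R := p1 + 1 + L * √2 / 2) hp ha m2 s2
      (by linear_combination (-(L / 2)) * r0 - hL) (by ring) (by ring)
  have mid : ∀ a p0 p1, ![p0, p1] ∈ octagon → τ a = pr ![p0, p1] → -2 ≤ p0 - (1 + √2) * p1 →
      p0 - (1 + √2) * p1 ≤ 0 → ∀ s, τ (s + √2) = τ s := by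
    intro a p0 p1 hp ha hy hy'
    obtain ⟨L, hL⟩ : ∃ L, L = p0 - (1 + √2) * p1 := ⟨_, rfl⟩
    rw [← hL] at hy hy'
    have c1 := sc hy
    have c2 := sc hy'
    have c3 := mul_nonneg (neg_nonneg.2 hy') (show 0 ≤ 2 - √2 by linarith)
    have c4 := mul_nonneg (neg_le_iff_add_nonneg.1 hy) (show 0 ≤ 2 - √2 by linarith)
    have c5 := mul_nonneg (neg_nonneg.2 hy') (show 0 ≤ √2 - 1 by linarith)
    have c6 := mul_nonneg (neg_le_iff_add_nonneg.1 hy) (show 0 ≤ √2 - 1 by linarith)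
    have m1 : ![1 + L * (2 - √2) / 2 - √2, -(1 + L * (2 - √2) / 2)] ∈ octagon := by
      apply vec_mem_octagon <;> linarith
    have m2 : ![-1, (-1 - L) * (√2 - 1)] ∈ octagon := by
      apply vec_mem_octagon <;> linarith
    have s1 := thr (R := √2 - (1 + L * (2 - √2) / 2) - p1) .B hp ha m1
      (by rw [height_eq_neg_one_iff]; simp; ring)
      (by rw [period_zero]; linear_combination (-(1 + L / 2)) * r0 + hL) (by rw [period_one]; ring)
    have s2 := thr (R := (-1 - L) * (√2 - 1) + (1 + L * (2 - √2) / 2)) .C m1 s1 m2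
      (by rw [height_eq_neg_one_iff]; simp)
      (by rw [period_zero]; linear_combination (1 + 3 * L / 2) * r0) (by rw [period_one]; ring)
    exact fin √2 (R := p1 - (-1 - L) * (√2 - 1)) hp ha m2 s2
      (by linear_combination (-(1 + L)) * r0 - hL) (by ring) (by ring)
  obtain ⟨p, hp, ha⟩ := exists_pr (τ 0)
  obtain ⟨p0, p1, rfl⟩ : ∃ p0 p1, p = ![p0, p1] :=
    ⟨p 0, p 1, ext_fin_two (by simp) (by simp)⟩
  rcases le_total (p0 - (1 + √2) * p1) (-2) with hy | hy
  · exact .inl (top 0 _ _ hp ha.symm hy)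
  rcases le_total (p0 - (1 + √2) * p1) 0 with hy' | hy'
  · exact .inr (mid 0 _ _ hp ha.symm hy hy')
  obtain ⟨⟨a1, a2⟩, ⟨a3, a4⟩, ⟨a5, a6⟩, a7, a8⟩ := mem_octagon.1 hp
  simp at a1 a2 a3 a4 a5 a6 a7 a8
  obtain ⟨L, hL⟩ : ∃ L, L = p0 - (1 + √2) * p1 := ⟨_, rfl⟩
  rw [← hL] at hy hy'
  have c2 := sc hy'
  rcases le_total L 2 with hz | hz
  · have c1 := sc hz
    have c3 := mul_nonneg hy' (show 0 ≤ √2 - 1 by linarith)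
    have c4 := mul_nonneg (sub_nonneg.2 hz) (show 0 ≤ √2 - 1 by linarith)
    have m1 : ![-1, (1 - L) * (√2 - 1)] ∈ octagon := by
      apply vec_mem_octagon <;> linarith
    have s1 := thr (R := (1 - L) * (√2 - 1) - p1) .C hp ha.symm m1
      (by rw [height_eq_neg_one_iff]; simp)
      (by rw [period_zero]; linear_combination (-(1 - L)) * r0 + hL) (by rw [period_one]; ring)
    have e : -1 - (1 + √2) * ((1 - L) * (√2 - 1)) = L - 2 := by
      linear_combination (-(1 - L)) * r0
    exact .inr (mid _ _ _ m1 s1 (by rw [e]; linarith) (by rw [e]; linarith))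
  · have c1 := sc hz
    have c4 := sc a3
    have c5 : L ≤ 2 * √2 := by linarith
    have c6 := sc c5
    have m1 : ![1 - L * √2 / 2, 1 - L * √2 / 2 + √2] ∈ octagon := by
      apply vec_mem_octagon <;> linarith
    have s1 := thr (R := 1 - L * √2 / 2 - p1) .D hp ha.symm m1
      (by rw [height_eq_neg_one_iff]; simp)
      (by rw [period_zero]; linear_combination (L / 2) * r0 + hL) (by rw [period_one]; ring)
    have e : 1 - L * √2 / 2 - (1 + √2) * (1 - L * √2 / 2 + √2) = L - 2 * √2 - 2 := by
      linear_combination (L / 2 - 1) * r0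
    exact .inl (top _ _ _ m1 s1 (by rw [e]; linarith))

theorem IsTraj.isPeriodicTraj_of_diagonal {τ : ℝ → Surface} (h : IsTraj ![1 + √2, 1] τ) :
    IsPeriodicTraj τ :=
  h.diagonal_period.elim (fun H => ⟨2 - √2, by linarith [sqrt_two_lt], H⟩)
    fun H => ⟨√2, by positivity, H⟩

/-! ## The sectors -/

/-- The directions of the lines of the first sector. -/
def InSector (v : Fin 2 → ℝ) : Prop := 0 < v 1 * (v 0 - (1 + √2) * v 1)

theorem inSector_iff {v : Fin 2 → ℝ} : InSector v ↔ Sector v ∨ Sector (-v) := by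
  simp only [InSector, Sector, Pi.neg_apply, mul_pos_iff]
  constructor
  · rintro (⟨h1, h2⟩ | ⟨h1, h2⟩)
    · exact Or.inl ⟨h1, by linarith⟩
    · exact Or.inr ⟨by linarith, by linarith⟩
  · rintro (⟨h1, h2⟩ | ⟨h1, h2⟩)
    · exact Or.inl ⟨h1, by linarith⟩
    · exact Or.inr ⟨by linarith, by linarith⟩

theorem nu_mulVec_zero (j : Fin 8) (p : Fin 2 → ℝ) : (nu j).1.mulVec p 0 =
    ![p 0, √2 / 2 * (p 0 + p 1), √2 / 2 * (p 0 + p 1), p 1, p 1, √2 / 2 * (-p 0 + p 1),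
      √2 / 2 * (-p 0 + p 1), -p 0] j := by
  rw [val_nu]
  fin_cases j <;> simp [nuMatrix, Matrix.mulVec, dotProduct, Fin.sum_univ_two] <;>
    (try rw [← one_div, inv_sqrt_two]) <;> ring

theorem nu_mulVec_one (j : Fin 8) (p : Fin 2 → ℝ) : (nu j).1.mulVec p 1 =
    ![p 1, √2 / 2 * (p 0 - p 1), √2 / 2 * (-p 0 + p 1), p 0, -p 0, √2 / 2 * (p 0 + p 1),
      √2 / 2 * (-p 0 - p 1), p 1] j := by
  rw [val_nu]
  fin_cases j <;> simp [nuMatrix, Matrix.mulVec, dotProduct, Fin.sum_univ_two] <;>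
    (try rw [← one_div, inv_sqrt_two]) <;> ring

theorem exists_inSector (v : Fin 2 → ℝ) :
    ∃ j, InSector ((nu j).1.mulVec v) ∨ (nu j).1.mulVec v 1 = 0 ∨
      (nu j).1.mulVec v 0 = (1 + √2) * (nu j).1.mulVec v 1 := by
  have r0 := sqrt_two_mul_self
  have r1 := sqrt_two_gt
  have r2 := sqrt_two_lt
  have hs : 0 < √2 / 2 := by positivity
  wlog hy : 0 ≤ v 1 generalizing v
  · obtain ⟨j, hj⟩ := this (-v) (by simp; linarith)
    refine ⟨j, ?_⟩
    simp only [InSector, Matrix.mulVec_neg, Pi.neg_apply] at hj ⊢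
    rcases hj with h | h | h
    · left; linarith
    · right; left; linarith
    · right; right; linarith
  rcases hy.eq_or_lt with hy | hy
  · exact ⟨0, Or.inr (Or.inl (by rw [nu_mulVec_one]; simpa using hy.symm))⟩
  have build : ∀ j : Fin 8, ∀ a b, (nu j).1.mulVec v 0 = a → (nu j).1.mulVec v 1 = b → 0 ≤ b →
      (1 + √2) * b ≤ a → ∃ j, InSector ((nu j).1.mulVec v) ∨ (nu j).1.mulVec v 1 = 0 ∨
      (nu j).1.mulVec v 0 = (1 + √2) * (nu j).1.mulVec v 1 := by
    intro j a b ha hb h0 h1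
    refine ⟨j, ?_⟩
    rw [InSector, ha, hb]
    rcases h0.eq_or_lt with h | h
    · exact Or.inr (Or.inl h.symm)
    rcases h1.eq_or_lt with h' | h'
    · exact Or.inr (Or.inr h'.symm)
    · exact Or.inl (mul_pos h (by linarith))
  have rot : ∀ x y : ℝ, (1 + √2) * (√2 / 2 * (x - y)) ≤ √2 / 2 * (x + y) ↔ x ≤ (1 + √2) * y := by
    intro x y
    have e : √2 / 2 * (x + y) - (1 + √2) * (√2 / 2 * (x - y)) = (1 + √2) * y - x := by
      linear_combination (y - x) / 2 * r0
    constructor <;> intro h <;> linarith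
  rcases le_total ((1 + √2) * v 1) (v 0) with h | h
  · exact build 0 _ _ (nu_mulVec_zero _ _) (nu_mulVec_one _ _) hy.le h
  rcases le_total (v 1) (v 0) with h2 | h2
  · exact build 1 _ _ (nu_mulVec_zero _ _) (nu_mulVec_one _ _)
      (mul_nonneg hs.le (by linarith)) ((rot _ _).2 h)
  rcases le_total (v 1) ((1 + √2) * v 0) with h3 | h3
  · refine build 2 _ _ (nu_mulVec_zero _ _) (nu_mulVec_one _ _)
      (mul_nonneg hs.le (by linarith)) ?_
    have := (rot _ _).2 h3
    show (1 + √2) * (√2 / 2 * (-v 0 + v 1)) ≤ √2 / 2 * (v 0 + v 1)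
    rwa [neg_add_eq_sub, add_comm (v 0)]
  rcases le_total 0 (v 0) with h4 | h4
  · exact build 3 _ _ (nu_mulVec_zero _ _) (nu_mulVec_one _ _) h4 h3
  rcases le_total ((1 + √2) * -v 0) (v 1) with h5 | h5
  · exact build 4 _ _ (nu_mulVec_zero _ _) (nu_mulVec_one _ _) (by simpa using h4) h5
  rcases le_total (-v 0) (v 1) with h6 | h6
  · refine build 5 _ _ (nu_mulVec_zero _ _) (nu_mulVec_one _ _)
      (mul_nonneg hs.le (by linarith)) ?_
    have := (rot _ _).2 h5
    show (1 + √2) * (√2 / 2 * (v 0 + v 1)) ≤ √2 / 2 * (-v 0 + v 1)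
    rwa [show v 0 + v 1 = v 1 - -v 0 by ring, show -v 0 + v 1 = v 1 + -v 0 by ring]
  rcases le_total (-v 0) ((1 + √2) * v 1) with h7 | h7
  · exact build 6 _ _ (nu_mulVec_zero _ _) (nu_mulVec_one _ _)
      (mul_nonneg hs.le (by linarith)) ((rot _ _).2 h7)
  · exact build 7 _ _ (nu_mulVec_zero _ _) (nu_mulVec_one _ _) hy.le h7

theorem exists_nu_automorphism (j : Fin 8) : ∃ Φ : Surface ≃ₜ Surface,
    IsAffineAutomorphism Φ (nu j) ∧
      ∀ x, x ∉ singularSet → ∀ X, Φ x ∈ side (perm j X) ↔ x ∈ side X :=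
  (isOctagonSymmetry_nu j).exists_automorphism

/-- On a boundary line of the sector the trajectory, moved by $\nu_j$ and rescaled, would run in one
of the two completely periodic directions. A vanishing velocity would make it constant. -/
theorem IsTraj.not_parallel {v : Fin 2 → ℝ} {τ : ℝ → Surface} (h : IsTraj v τ)
    (hper : ¬ IsPeriodicTraj τ) (j : Fin 8) : (nu j).1.mulVec v 1 ≠ 0 ∧
      (nu j).1.mulVec v 0 ≠ (1 + √2) * (nu j).1.mulVec v 1 := by
  obtain ⟨Φ, hΦ, -⟩ := exists_nu_automorphism j
  set u := (nu j).1.mulVec v with hu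
  have hτ : IsTraj u fun s => Φ (τ s) := hΦ.isTraj h
  have key : ∀ c : ℝ, c ≠ 0 → ∀ u', u = c • u' →
      (∀ {τ : ℝ → Surface}, IsTraj u' τ → IsPeriodicTraj τ) → False := by
    intro c hc u' huu hP
    refine hper (IsPeriodicTraj.of_comp Φ (IsPeriodicTraj.of_comp_mul (inv_ne_zero hc) (hP ?_)))
    have := hτ.comp_mul (inv_ne_zero hc)
    rwa [huu, smul_smul, inv_mul_cancel₀ hc, one_smul] at this
  have hu0 : u ≠ 0 := by
    intro h0
    rw [h0] at hτ
    obtain ⟨p, hp, ha⟩ := exists_pr (Φ (τ 0))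
    have := hτ.follow hp ha.symm (R := 1) (by simpa using hp)
    rw [smul_zero, add_zero, ha] at this
    exact hper (IsPeriodicTraj.of_comp Φ (hτ.isPeriodicTraj (by norm_num) this))
  constructor <;> intro h1
  · refine key (u 0) (fun h0 => hu0 (ext_fin_two h0 h1)) ![1, 0] ?_
      fun h => h.isPeriodicTraj_of_horizontal
    exact ext_fin_two (by simp) (by simp [h1])
  · refine key (u 1) (fun h0 => hu0 (ext_fin_two (by rw [h1, h0]; simp) h0)) ![1 + √2, 1] ?_
      fun h => h.isPeriodicTraj_of_diagonal
    exact ext_fin_two (by simp [h1]; ring) (by simp)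

theorem IsTraj.exists_inSector {v : Fin 2 → ℝ} {τ : ℝ → Surface} (h : IsTraj v τ)
    (hper : ¬ IsPeriodicTraj τ) : ∃ j, InSector ((nu j).1.mulVec v) := by
  obtain ⟨j, h1 | h1 | h1⟩ := Octagon.exists_inSector v
  · exact ⟨j, h1⟩
  · exact absurd h1 (h.not_parallel hper j).1
  · exact absurd h1 (h.not_parallel hper j).2

/-! ## One step of the renormalization -/

theorem isCuttingSequenceWrt_comp {Ψ Φ : Surface ≃ₜ Surface} {τ : ℝ → Surface} {w : Word} :
    IsCuttingSequenceWrt Ψ (fun s => Φ (τ s)) w ↔ IsCuttingSequenceWrt (Ψ.trans Φ.symm) τ w := by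
  have key : ∀ x X, Φ x ∈ Ψ '' side X ↔ x ∈ (Ψ.trans Φ.symm) '' side X := by
    intro x X
    constructor
    · rintro ⟨y, hy, h⟩
      exact ⟨y, hy, by simp [h]⟩
    · rintro ⟨y, hy, h⟩
      exact ⟨y, hy, by rw [← h]; simp⟩
  simp only [IsCuttingSequenceWrt, key]

theorem isCuttingSequence_comp {Φ : Surface ≃ₜ Surface} {ϖ : Letter → Letter}
    (hϖ : Function.Surjective ϖ)
    (hΦ : ∀ x, x ∉ singularSet → ∀ X, Φ x ∈ side (ϖ X) ↔ x ∈ side X) {τ : ℝ → Surface}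
    (hτ : ∀ s, τ s ∉ singularSet) {w : Word} (hw : IsCuttingSequence τ w) :
    IsCuttingSequence (fun s => Φ (τ s)) (fun n => ϖ (w n)) := by
  rw [isCuttingSequence_iff] at *
  obtain ⟨t, h1, h2, h3⟩ := hw
  refine ⟨t, h1, ?_, fun n => (hΦ _ (hτ _) _).2 (h3 n)⟩
  rw [h2]
  ext s
  constructor
  · rintro ⟨X, hX⟩
    exact ⟨_, (hΦ _ (hτ _) _).2 hX⟩
  · rintro ⟨X, hX⟩
    obtain ⟨X, rfl⟩ := hϖ X
    exact ⟨_, (hΦ _ (hτ _) _).1 hX⟩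

/-- A sector of lines contains a direction or its opposite; the central symmetry of the octagon
reverses the velocity and preserves all labels. -/
theorem IsTraj.exists_isCoding {v : Fin 2 → ℝ} {τ : ℝ → Surface} (h : IsTraj v τ)
    (hv : InSector v) {w : Word} (hw : IsCuttingSequence τ w) :
    ∃ (Φ : Surface ≃ₜ Surface) (v' : Fin 2 → ℝ) (t : ℤ → ℝ) (e : ℤ → (Fin 2 → ℝ)),
      (Φ = Homeomorph.refl _ ∧ v' = v ∨ IsAffineAutomorphism Φ (-1) ∧ v' = -v) ∧ Sector v' ∧
      IsCoding v' (fun s => Φ (τ s)) w t e := by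
  rcases inSector_iff.1 hv with hs | hs
  · obtain ⟨t, e, he⟩ := hw.exists_isCoding h hs.height_pos
    exact ⟨Homeomorph.refl _, v, t, e, Or.inl ⟨rfl, rfl⟩, hs, he⟩
  · obtain ⟨Φ, hΦ, hl⟩ := isOctagonSymmetry_neg.exists_automorphism
    have h' := hΦ.isTraj h
    rw [Units.val_neg, Units.val_one, Matrix.neg_mulVec, Matrix.one_mulVec] at h'
    obtain ⟨t, e, he⟩ :=
      (isCuttingSequence_comp Function.surjective_id hl h.1 hw).exists_isCoding h' hs.height_pos
    exact ⟨Φ, -v, t, e, Or.inr ⟨hΦ, rfl⟩, hs, he⟩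

theorem IsTraj.isPeriodicTraj_of_isPeriodic {v : Fin 2 → ℝ} {τ : ℝ → Surface} (h : IsTraj v τ)
    (hv : InSector v) {w : Word} (hw : IsCuttingSequence τ w) (hper : IsPeriodic w) :
    IsPeriodicTraj τ := by
  obtain ⟨Φ, v', t, e, -, -, he⟩ := h.exists_isCoding hv hw
  exact IsPeriodicTraj.of_comp Φ (he.isPeriodicTraj hper)

theorem IsTraj.edge₀ {v : Fin 2 → ℝ} {τ : ℝ → Surface} (h : IsTraj v τ)
    (hv : InSector v) {w : Word} (hw : IsCuttingSequence τ w) (n : ℤ) :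
    Octagon.edge₀ (w n) (w (n + 1)) := by
  obtain ⟨Φ, v', t, e, -, hs, he⟩ := h.exists_isCoding hv hw
  exact he.admissible hs n

theorem IsTraj.isCuttingSequenceWrt_gam {v : Fin 2 → ℝ} {τ : ℝ → Surface} (h : IsTraj v τ)
    (hv : InSector v) {w w' : Word} (hw : IsCuttingSequence τ w) (hw' : IsDerived w w')
    {Ψ : Surface ≃ₜ Surface} (hΨ : IsAffineAutomorphism Ψ gam) : IsCuttingSequenceWrt Ψ τ w' := by
  obtain ⟨Ψ', h1, h2, h3, h4, h5⟩ := exists_gam_automorphism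
  obtain rfl := h1.unique hΨ
  obtain ⟨Φ, v', t, e, hΦ, hs, he⟩ := h.exists_isCoding hv hw
  have key := he.isCuttingSequenceWrt hs h2 h3 h4 h5 hw'
  rcases hΦ with ⟨rfl, -⟩ | ⟨hΦ, -⟩
  · exact key
  · rw [isCuttingSequenceWrt_comp] at key
    -- The central symmetry commutes with the automorphism, because both composites have the same
    -- derivative. It also preserves labels, so it does not change the labelled sides of the sheared
    -- octagon.
    have e : Ψ.trans Φ.symm = Φ.symm.trans Ψ := by
      have a1 := hΦ.symm.comp h1
      have a2 := h1.comp hΦ.symm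
      rw [show (-1 : GL (Fin 2) ℝ)⁻¹ * gam = gam * (-1)⁻¹ by simp] at a1
      exact a2.unique a1
    obtain ⟨Φ', hΦ', hl⟩ := isOctagonSymmetry_neg.exists_automorphism
    have e' : Φ.symm = Φ' := by
      have a1 := hΦ.symm
      rw [show (-1 : GL (Fin 2) ℝ)⁻¹ = -1 by simp] at a1
      exact hΦ'.unique a1
    obtain ⟨t', g1, g2, g3⟩ := key
    have him : ∀ s X, τ s ∈ (Ψ.trans Φ.symm) '' side X ↔ τ s ∈ Ψ '' side X := by
      intro s X
      rw [e, e']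
      have hns : Ψ.symm (τ s) ∉ singularSet := by
        rw [h1.symm.mem_singularSet]; exact h.1 s
      constructor
      · rintro ⟨x, hx, hxs⟩
        rw [Homeomorph.trans_apply] at hxs
        refine ⟨Φ' x, ?_, hxs⟩
        refine (hl x ?_ X).2 hx
        rw [← hΦ'.mem_singularSet, ← Homeomorph.symm_apply_apply Ψ (Φ' x), hxs]
        exact hns
      · rintro ⟨x, hx, hxs⟩
        have hxn : x ∉ singularSet := by rwa [← hxs, Homeomorph.symm_apply_apply] at hns
        refine ⟨Φ'.symm x, ?_, by simpa using hxs⟩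
        have hxn' : Φ'.symm x ∉ singularSet := by rwa [hΦ'.symm.mem_singularSet]
        have := hl _ hxn' X
        rw [Homeomorph.apply_symm_apply] at this
        exact this.1 hx
    simp only [him] at g2 g3
    exact ⟨t', g1, g2, g3⟩


/-! ## Diagrams and words -/

/-- The first alternative says that every walk in both diagrams turns back at each step; the second,
that the loop of one diagram is absent from the other. The $64$ pairs are decided by computation. -/
theorem edge_inter (d e : Fin 8) : d ≠ e →
    (∀ a b c, edge d a b → edge e a b → edge d b c → edge e b c → a = c) ∨
      (∀ b, perm d b = .C → ¬ edge e b b) := by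
  revert d e
  decide +kernel

theorem isPeriodic_of_add_two {w : Word} (h : ∀ n, w n = w (n + 2)) : IsPeriodic w :=
  ⟨2, by norm_num, fun n => (h n).symm⟩

/-- The first alternative of `edge_inter` would make the word alternate; the second is excluded by
the occurrence of the loop. -/
theorem admissible_unique {w : Word} (hper : ¬ IsPeriodic w) {d e : Fin 8} (hd : Admissible d w)
    (he : Admissible e w) (hC : ∃ n, perm d (w n) = .C ∧ perm d (w (n + 1)) = .C) : e = d := by
  by_contra hne
  rcases edge_inter d e (Ne.symm hne) with h | h
  · refine hper (isPeriodic_of_add_two fun n => ?_)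
    have h1 := hd (n + 1)
    have h2 := he (n + 1)
    rw [add_assoc, one_add_one_eq_two] at h1 h2
    exact h _ _ _ (hd n) (he n) h1 h2
  · obtain ⟨n, h1, h2⟩ := hC
    have h3 : w (n + 1) = w n := (isOctagonSymmetry_nu d).2.1.1 (h2.trans h1.symm)
    have h4 := he n
    rw [h3] at h4
    exact h _ h1 h4

namespace IsCoding

variable {v : Fin 2 → ℝ} {τ : ℝ → Surface} {w : Word} {t : ℤ → ℝ} {e : ℤ → (Fin 2 → ℝ)}

/-- The direction in which the cut is crossed compares the slope of `v` with that of the cut. Each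
sandwiched pattern thus bounds the cotangent of the direction. -/
theorem cutLin_of_sandwiched (h : IsCoding v τ w t e) (hv : Sector v) {n : ℤ} (hn : w n ≠ .A)
    (hs : w (n - 1) = w (n + 1)) :
    if above (w n) (w (n - 1)) = true then cutLin (w n) v < 0 else 0 < cutLin (w n) v := by
  have h1 := h.cutPos_entry hv hn
  have h2 := h.cutPos_exit hv hn
  rw [← hs] at h2
  have h3 := h.cutPos_affine n (t (n - 1)) (t (n + 1))
  have h4 : 0 < t (n + 1) - t (n - 1) := sub_pos.2 (h.mono (by omega))
  split_ifs at h1 h2 ⊢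
  · exact (pos_iff_neg_of_mul_neg (by linarith)).1 h4
  · exact (pos_iff_pos_of_mul_pos (by linarith)).1 h4

theorem cot_of_BCB (h : IsCoding v τ w t e) (hv : Sector v) {n : ℤ} (h0 : w (n - 1) = .B)
    (h1 : w n = .C) (h2 : w (n + 1) = .B) : v 0 < 2 * (1 + √2) * v 1 := by
  have := h.cutLin_of_sandwiched hv (n := n) (by rw [h1]; simp) (by rw [h0, h2])
  simp [h0, h1, above, cutLin] at this
  linarith

theorem cot_of_DBD (h : IsCoding v τ w t e) (hv : Sector v) {n : ℤ} (h0 : w (n - 1) = .D)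
    (h1 : w n = .B) (h2 : w (n + 1) = .D) : (3 + 2 * √2) * v 1 < v 0 := by
  have := h.cutLin_of_sandwiched hv (n := n) (by rw [h1]; simp) (by rw [h0, h2])
  simp [h0, h1, above, cutLin] at this
  linarith

/-- In the development across the two intermediate sides, the displacement over the three chords is
at most `4 + √2` horizontally and at least `√2` vertically; the quotient of these bounds is `1 + 2 *
√2`. -/
theorem cot_of_BCBC (h : IsCoding v τ w t e) {n : ℤ} (h0 : w n = .B)
    (h1 : w (n + 1) = .C) (h2 : w (n + 2) = .B) (h3 : w (n + 3) = .C) :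
    v 0 ≤ (1 + 2 * √2) * v 1 := by
  have r0 := sqrt_two_mul_self
  have r1 := sqrt_two_gt
  have a0 := h.height_entry n
  have a1 := h.exit_mem (n + 2)
  have a2 := h.height_exit (n + 2)
  have a3 := h.mem n
  rw [h0, height_eq_neg_one_iff] at a0
  have e1 : n + 2 + 1 = n + 3 := by ring
  rw [e1] at a1 a2
  rw [h3, height_eq_one_iff] at a2
  have c1 := h.chord_succ n (t (n + 3))
  have c2 := h.chord_succ (n + 1) (t (n + 3))
  rw [show n + 1 + 1 = n + 2 by ring, h2, c1, h1] at c2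
  rw [c2] at a1 a2
  rw [mem_octagon] at a1 a3
  simp at a0 a1 a2 a3
  obtain ⟨-, ⟨-, -⟩, ⟨-, -⟩, b1, b2⟩ := a1
  set T := t (n + 3) - t n with hT
  have hT0 : 0 < T := sub_pos.2 (h.mono (by omega))
  have k1 : T * v 0 ≤ 4 + √2 := by linarith [a3.1.1]
  have k2 : √2 ≤ T * v 1 := by linarith [a3.1.1]
  have k3 : (1 + 2 * √2) * √2 ≤ (1 + 2 * √2) * (T * v 1) :=
    mul_le_mul_of_nonneg_left k2 (by positivity)
  have k4 : T * v 0 ≤ T * ((1 + 2 * √2) * v 1) := by linarith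
  exact le_of_mul_le_mul_left k4 hT0

/-- An aperiodic trajectory crosses the vertical sides. -/
theorem exists_eq_C (h : IsCoding v τ w t e) (hv : Sector v) (hper : ¬ IsPeriodicTraj τ) :
    ∃ n, w n = .C := by
  by_contra hne
  push Not at hne
  have r1 := sqrt_two_gt
  have r2 := sqrt_two_lt
  have adm := h.admissible hv
  -- The transverse coordinate. Without `C` every other letter is `D`, and two steps change `x` in
  -- one of two ways, according as `A` or `B` follows.
  set x : ℤ → ℝ := fun n => cross v (e n) with hx
  have toD : ∀ n, w n ≠ .D → w (n + 1) = .D := by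
    intro n hn
    have h1 := adm n
    have h2 := hne n
    have h3 := hne (n + 1)
    revert h1 h2 h3 hn
    generalize w n = Y
    generalize w (n + 1) = Z
    cases Y <;> cases Z <;> simp [Octagon.edge₀]
  have ofD : ∀ n, w n = .D → w (n + 1) = .A ∨ w (n + 1) = .B := by
    intro n hn
    have h1 := adm n
    have h3 := hne (n + 1)
    rw [hn] at h1
    revert h1 h3
    generalize w (n + 1) = Z
    cases Z <;> simp [Octagon.edge₀]
  have step : ∀ n, w n ≠ .D → (w (n + 2) = .A ∧ x (n + 2) = x n + √2 * (v 0 + v 1) - 2 * v 0) ∨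
      (w (n + 2) = .B ∧ x (n + 2) = x n + 2 * √2 * v 1) := by
    intro n hn
    have e1 := h.cross_succ n
    have e2 := h.cross_succ (n + 1)
    rw [toD n hn] at e1
    have h2 := ofD _ (toD n hn)
    rw [show n + 1 + 1 = n + 2 by ring] at e2 h2
    rcases h2 with h2 | h2
    · refine Or.inl ⟨h2, ?_⟩
      simp only [hx]
      rw [e2, e1, h2]; simp [cross]; ring
    · refine Or.inr ⟨h2, ?_⟩
      simp only [hx]
      rw [e2, e1, h2]; simp [cross]; ring
  have bound : ∀ n, w n = .A → -v 0 - (√2 - 1) * v 1 ≤ x n ∧ x n ≤ -v 0 + (√2 - 1) * v 1 := by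
    intro n hn
    have h1 := h.height_entry n
    rw [hn, height_A] at h1
    have h2 := mem_octagon.1 (h.mem n)
    have h3 := hv.1
    simp only [hx, cross, h1]
    obtain ⟨-, -, ⟨b1, b2⟩, b3, b4⟩ := h2
    rw [h1] at b1 b4
    constructor <;> nlinarith
  have ret : ∀ n, w n ≠ .D → ∃ K : ℕ, 0 < K ∧ w (n + 2 * K) = .A ∧
      x (n + 2 * K) = x n + (K - 1) * (2 * √2 * v 1) + (√2 * (v 0 + v 1) - 2 * v 0) := by
    intro n hn
    by_contra hno
    have key : ∀ K : ℕ, w (n + 2 * K) ≠ .D ∧ x (n + 2 * K) = x n + K * (2 * √2 * v 1) := by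
      intro K
      induction K with
      | zero => simpa using hn
      | succ K ih =>
        have e1 : n + 2 * ((K + 1 : ℕ) : ℤ) = n + 2 * K + 2 := by push_cast; ring
        rcases step _ ih.1 with ⟨h1, h2⟩ | ⟨h1, h2⟩
        · refine absurd ⟨K + 1, by omega, ?_, ?_⟩ hno
          · rw [e1, h1]
          · rw [e1, h2, ih.2]; push_cast; ring
        · rw [e1]
          refine ⟨by rw [h1]; simp, ?_⟩
          rw [h2, ih.2]; push_cast; ring
    have : 2 * √2 * v 1 = 0 := by
      refine eq_zero_of_forall_nat_mul_le (M := (|v 0| + |v 1|) + (|v 0| + |v 1|)) fun K => ?_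
      rw [show (K : ℝ) * (2 * √2 * v 1) = x (n + 2 * K) - x n by rw [(key K).2]; ring]
      refine (abs_sub _ _).trans (add_le_add ?_ ?_) <;> exact abs_cross_le (h.mem _) _
    have h3 : 0 < 2 * √2 * v 1 := mul_pos (by positivity) hv.1
    linarith
  -- Entries through `A` have `x` in an interval of length `2 * (√2 - 1) * v 1`. Return
  -- displacements thus differ by at most twice this length, which is less than the contribution `2
  -- * √2 * v 1` of one further `B`. So every return to `A` takes equally many steps and has the
  -- same drift.
  have uniq : ∀ m n : ℤ, ∀ K L : ℕ, w m = .A → w n = .A → w (m + 2 * K) = .A →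
      w (n + 2 * L) = .A →
      x (m + 2 * K) = x m + (K - 1) * (2 * √2 * v 1) + (√2 * (v 0 + v 1) - 2 * v 0) →
      x (n + 2 * L) = x n + (L - 1) * (2 * √2 * v 1) + (√2 * (v 0 + v 1) - 2 * v 0) →
      K ≤ L := by
    intro m n K L hm hn hmK hnL h1 h2
    by_contra hlt
    have hKL : (L : ℝ) + 1 ≤ K := by exact_mod_cast not_le.1 hlt
    have b1 := bound m hm
    have b2 := bound n hn
    have b3 := bound _ hmK
    have b4 := bound _ hnL
    have h3 : ((L : ℝ) + 1) * (2 * √2 * v 1) ≤ K * (2 * √2 * v 1) :=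
      mul_le_mul_of_nonneg_right hKL (mul_pos (by positivity) hv.1).le
    have h4 : 1.414 * v 1 < √2 * v 1 := mul_lt_mul_of_pos_right r1 hv.1
    have h5 : √2 * v 1 < 1.415 * v 1 := mul_lt_mul_of_pos_right r2 hv.1
    have := hv.1
    linarith
  obtain ⟨n, hn⟩ : ∃ n, w n = .A := by
    by_cases h0 : w 0 = .D
    · have h1 : w (0 + 1) ≠ .D := by rcases ofD 0 h0 with h | h <;> rw [h] <;> simp
      obtain ⟨K, -, hK, -⟩ := ret _ h1
      exact ⟨_, hK⟩
    · obtain ⟨K, -, hK, -⟩ := ret _ h0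
      exact ⟨_, hK⟩
  obtain ⟨K, hK0, hK, hxK⟩ := ret n (by rw [hn]; simp)
  refine hper (h.isPeriodicTraj_of_drift (n := n) (p := 2 * K) (by omega)
    (d := (K - 1) * (2 * √2 * v 1) + (√2 * (v 0 + v 1) - 2 * v 0)) fun m => ?_)
  induction m with
  | zero => simp
  | succ m ih =>
    have hm : w (n + m * (2 * K)) = .A := ih.1.trans hn
    obtain ⟨L, -, hL, hxL⟩ := ret (n + m * (2 * K)) (by rw [hm]; simp)
    have hKL : L = K := le_antisymm (uniq _ _ _ _ hm hn hL hK hxL hxK)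
      (uniq _ _ _ _ hn hm hK hL hxK hxL)
    subst hKL
    have e1 : n + ((m + 1 : ℕ) : ℤ) * (2 * L) = n + m * (2 * L) + 2 * L := by push_cast; ring
    rw [e1]
    refine ⟨hL.trans hn.symm, ?_⟩
    have := ih.2
    simp only [hx] at hxL
    rw [hxL, this]; push_cast; ring

end IsCoding

/-- The position of a letter in the chain. -/
def chainPos : Letter → ℤ
  | .A => 0
  | .D => 1
  | .B => 2
  | .C => 3

theorem chainPos_injective : Function.Injective chainPos := by
  intro X Y
  cases X <;> cases Y <;> simp [chainPos]

/-- In a walk on the chain without loops consecutive turning points are different. -/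
theorem ne_of_consecutive_sandwiched {w : Word} (hw : ∀ n, edge₀ (w n) (w (n + 1)))
    (hC : ∀ n, w n = .C → w (n + 1) ≠ .C) {m n : ℤ} (hmn : m < n)
    (hno : ∀ k, m < k → k < n → w (k - 1) ≠ w (k + 1)) : w m ≠ w n := by
  have step : ∀ k, chainPos (w (k + 1)) - chainPos (w k) = 1 ∨
      chainPos (w (k + 1)) - chainPos (w k) = -1 := by
    intro k
    have h1 := hw k
    have h2 := hC k
    revert h1 h2
    generalize w k = Y
    generalize w (k + 1) = Z
    cases Y <;> cases Z <;> simp [edge₀, chainPos]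
  -- Between turning points the walk moves along the chain in a constant direction, so it cannot
  -- come back to the same letter.
  have key : ∀ j : ℕ, m + j < n → chainPos (w (m + j + 1)) - chainPos (w m) =
      (j + 1) * (chainPos (w (m + 1)) - chainPos (w m)) ∧
      chainPos (w (m + j + 1)) - chainPos (w (m + j)) =
        chainPos (w (m + 1)) - chainPos (w m) := by
    intro j
    induction j with
    | zero => intro _; simp
    | succ j ih =>
      intro hj
      push_cast at hj ⊢
      obtain ⟨h1, h2⟩ := ih (by omega)
      have h3 := step (m + j + 1)
      have h4 := step (m + j)
      have h5 := hno (m + j + 1) (by omega) (by omega)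
      rw [add_sub_cancel_right] at h5
      have h6 : chainPos (w (m + j)) ≠ chainPos (w (m + j + 1 + 1)) :=
        fun h => h5 (chainPos_injective h)
      rw [← add_assoc]
      set a := chainPos (w (m + j + 1 + 1))
      set b := chainPos (w (m + j + 1))
      set c := chainPos (w (m + j))
      have h7 : a - b = chainPos (w (m + 1)) - chainPos (w m) := by omega
      refine ⟨?_, h7⟩
      linarith
  intro heq
  obtain ⟨j, hj⟩ : ∃ j : ℕ, n = m + j + 1 := ⟨(n - m - 1).toNat, by omega⟩
  have h1 := (key j (by omega)).1
  rw [← hj, ← heq, sub_self] at h1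
  have h2 := step m
  rcases mul_eq_zero.1 h1.symm with h | h <;> omega

theorem gam_mul_self : gam * gam = 1 := by
  ext i j
  fin_cases i <;> fin_cases j <;>
    simp [gam, Matrix.GeneralLinearGroup.mkOfDetNeZero, Matrix.mul_apply, Fin.sum_univ_two]

theorem inv_gam : gam⁻¹ = gam := inv_eq_of_mul_eq_one_left gam_mul_self

/-- One step of the renormalization: the derived sequence, permuted according to a sector, is the
cutting sequence of a renormalized trajectory. -/
theorem IsTraj.exists_renormalized {v : Fin 2 → ℝ} {τ : ℝ → Surface} (h : IsTraj v τ)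
    (hv : InSector v) {w : Word} (hw : IsCuttingSequence τ w) (hper : ¬ IsPeriodicTraj τ) :
    ∃ (w' : Word) (j : Fin 8) (τ' : ℝ → Surface), IsDerived w w' ∧
      IsTraj ((nu j).1.mulVec (gam.1.mulVec v)) τ' ∧
      InSector ((nu j).1.mulVec (gam.1.mulVec v)) ∧
      IsCuttingSequence τ' (fun n => perm j (w' n)) ∧ ¬ IsPeriodicTraj τ' := by
  obtain ⟨w', hw'⟩ := exists_isDerived (h.edge₀ hv hw)
  obtain ⟨Ψ, hΨ, -⟩ := exists_gam_automorphism
  have h1 := h.isCuttingSequenceWrt_gam hv hw hw' hΨ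
  have h2 := hΨ.symm.isTraj h
  rw [inv_gam] at h2
  have h3 : IsCuttingSequence (fun s => Ψ.symm (τ s)) w' := isCuttingSequenceWrt_comp.2 h1
  have h4 : ¬ IsPeriodicTraj fun s => Ψ.symm (τ s) := fun h' => hper (h'.of_comp Ψ.symm)
  obtain ⟨j, hj⟩ := h2.exists_inSector h4
  obtain ⟨Φ, hΦ, hl⟩ := exists_nu_automorphism j
  exact ⟨w', j, _, hw', hΦ.isTraj h2, hj,
    isCuttingSequence_comp (isOctagonSymmetry_nu j).2.1.2 hl h2.1 h3, fun h' => h4 (h'.of_comp Φ)⟩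

/-- The image direction is `(X, y)` with `0 < X < (1 + √2) * y`, so its angle lies between $\pi/8$
and $\pi/2$. Sectors 2 and 3 lie beyond $\pi/4$, where `X < y`, and this is the extra inequality. -/
theorem sector_of_renormalized {v : Fin 2 → ℝ} (hv : Sector v) (hC : v 0 < 2 * (1 + √2) * v 1)
    {j : Fin 8} (hj : InSector ((nu j).1.mulVec (gam.1.mulVec v))) :
    j = 1 ∨ ((j = 2 ∨ j = 3) ∧ (1 + 2 * √2) * v 1 < v 0) := by
  have r0 := sqrt_two_mul_self
  have r1 := sqrt_two_gt
  have hy := hv.1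
  have hx := hv.2
  rw [InSector, nu_mulVec_one, nu_mulVec_zero, gam_mulVec_zero, gam_mulVec_one] at hj
  obtain ⟨X, hX⟩ : ∃ X, X = -v 0 + 2 * (1 + √2) * v 1 := ⟨_, rfl⟩
  rw [← hX] at hj
  generalize v 1 = y at *
  have hX0 : 0 < X := by linarith
  have hXc : X < (1 + √2) * y := by linarith
  have hs : 0 < √2 * X := by positivity
  have hs' : 0 < √2 * y := by positivity
  have pp := @mul_pos_iff ℝ
  have fin : ∀ {a b : ℝ}, 0 < a → b < 0 → 0 < a * b → False := by
    intro a b ha hb h; nlinarith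
  have fin' : ∀ {a b : ℝ}, a < 0 → 0 < b → 0 < a * b → False := by
    intro a b ha hb h; nlinarith
  fin_cases j <;> simp at hj
  · exact (fin hy (by linarith) hj).elim
  · exact Or.inl rfl
  · refine Or.inr ⟨Or.inl rfl, ?_⟩
    by_contra hcon
    have h1 : y ≤ X := by linarith
    refine absurd hj (not_lt.2 (mul_nonpos_of_nonpos_of_nonneg
      (mul_nonpos_of_nonneg_of_nonpos (by positivity) (by linarith)) ?_))
    have : √2 * y ≤ √2 * X := sqrt_two_mul_mono h1
    have e : √2 / 2 * (X + y) - (1 + √2) * (√2 / 2 * (-X + y)) = (1 + √2) * X - y := by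
      linear_combination (X - y) / 2 * r0
    rw [e]; linarith
  · refine Or.inr ⟨Or.inr rfl, ?_⟩
    by_contra hcon
    exact fin hX0 (by linarith) hj
  · exfalso
    nlinarith
  · exfalso
    refine fin (a := √2 / 2 * (X + y)) (by positivity) ?_ hj
    have e : √2 / 2 * (-X + y) - (1 + √2) * (√2 / 2 * (X + y)) = -(1 + √2) * X - y := by
      linear_combination (-X - y) / 2 * r0
    rw [e]; nlinarith
  · exfalso
    refine fin' (a := √2 / 2 * (-X - y)) ?_ ?_ hj
    · nlinarith
    · have e : √2 / 2 * (-X + y) - (1 + √2) * (√2 / 2 * (-X - y)) = X + (1 + √2) * y := by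
        linear_combination (X + y) / 2 * r0
      rw [e]; nlinarith
  · exfalso
    exact fin hy (by linarith) hj

/-- The cutting sequence of an aperiodic trajectory in the first sector contains `CC`. -/
theorem IsTraj.exists_loop {v : Fin 2 → ℝ} {τ : ℝ → Surface} (h : IsTraj v τ)
    (hv : InSector v) {w : Word} (hw : IsCuttingSequence τ w) (hper : ¬ IsPeriodicTraj τ) :
    ∃ n, w n = .C ∧ w (n + 1) = .C := by
  have r0 := sqrt_two_mul_self
  have r1 := sqrt_two_gt
  -- If `CC` is missing, each step either leads to a contradiction or ends in sector 1. The map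
  -- $\nu_1\gamma$ preserves `v 0 - (1 + √2) * v 1` and lowers `v 1` by `√2 / 2` times this number.
  -- The bound says that `N` such steps fit before the second coordinate runs out.
  have main : ∀ N : ℕ, ∀ (v : Fin 2 → ℝ) (τ : ℝ → Surface) (w : Word), IsTraj v τ → InSector v →
      IsCuttingSequence τ w → ¬ IsPeriodicTraj τ → (∀ n, w n = .C → w (n + 1) ≠ .C) →
      N * (√2 / 2 * (v 0 - (1 + √2) * v 1) ^ 2) ≤ v 1 * (v 0 - (1 + √2) * v 1) := by
    intro N
    induction N with
    | zero =>
      intro v τ w _ hv _ _ _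
      simpa using hv.le
    | succ N ih =>
      intro v τ w h hv hw hper hCC
      have adm := h.edge₀ hv hw
      obtain ⟨Φ, v', t, e, hvv, hs, he⟩ := h.exists_isCoding hv hw
      have hper' : ¬ IsPeriodicTraj fun s => Φ (τ s) := fun h' => hper (h'.of_comp Φ)
      obtain ⟨n, hn⟩ := he.exists_eq_C hs hper'
      have next : ∀ n, w n = .C → w (n + 1) = .B := by
        intro n hn
        have h1 := adm n
        have h2 := hCC n hn
        rw [hn] at h1
        revert h1 h2
        generalize w (n + 1) = Z
        cases Z <;> simp [Octagon.edge₀]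
      have prev : ∀ n, w n = .C → w (n - 1) = .B := by
        intro n hn
        have h1 := adm (n - 1)
        have h2 := hCC (n - 1)
        rw [sub_add_cancel] at h1 h2
        rw [hn] at h1 h2
        revert h1 h2
        generalize w (n - 1) = Z
        cases Z <;> simp [Octagon.edge₀]
      have hC := he.cot_of_BCB hs (prev n hn) hn (next n hn)
      obtain ⟨w', j, τ', hw', hτ', hv', hcut, hper''⟩ := h.exists_renormalized hv hw hper
      have hj : InSector ((nu j).1.mulVec (gam.1.mulVec v')) := by
        rcases hvv with ⟨-, rfl⟩ | ⟨-, rfl⟩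
        · exact hv'
        · have := hv'
          simp only [InSector, Matrix.mulVec_neg, Pi.neg_apply] at this ⊢
          linarith
      obtain ⟨i, hi, hir, hiw⟩ := hw'
      have hsw : ∀ k, w (i k - 1) = w (i k + 1) := fun k => by
        have : i k ∈ Set.range i := ⟨k, rfl⟩
        rw [hir] at this
        exact this
      rcases sector_of_renormalized hs hC hj with rfl | ⟨hj', hcot⟩
      · have hno : ∀ n, perm 1 (w' n) = .C → perm 1 (w' (n + 1)) ≠ .C := by
          intro k h1 h2
          have h3 : w' k = w' (k + 1) := (isOctagonSymmetry_nu 1).2.1.1 (h1.trans h2.symm)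
          rw [hiw, hiw] at h3
          refine ne_of_consecutive_sandwiched adm hCC (hi (show k < k + 1 by omega)) ?_ h3
          intro m hm1 hm2 hm
          have : m ∈ Set.range i := by rw [hir]; exact hm
          obtain ⟨l, rfl⟩ := this
          have := hi.lt_iff_lt.1 hm1
          have := hi.lt_iff_lt.1 hm2
          omega
        have := ih _ _ _ hτ' hv' hcut hper'' hno
        simp only [nu_mulVec_zero, nu_mulVec_one, gam_mulVec_zero, gam_mulVec_one] at this
        simp at this
        have e1 : √2 / 2 * (-v 0 + 2 * (1 + √2) * v 1 + v 1) -
            (1 + √2) * (√2 / 2 * (-v 0 + 2 * (1 + √2) * v 1 - v 1)) = v 0 - (1 + √2) * v 1 := by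
          linear_combination (v 0 / 2 - v 1 * (1 / 2 + √2)) * r0
        have e2 : √2 / 2 * (-v 0 + 2 * (1 + √2) * v 1 - v 1) =
            v 1 - √2 / 2 * (v 0 - (1 + √2) * v 1) := by
          linear_combination v 1 / 2 * r0
        rw [e1, e2] at this
        push_cast
        linarith
      · exfalso
        -- A sandwiched `B` between two `C` gives `BCBC` and a cotangent of at most `1 + 2 * √2`;
        -- between two `D` it gives one above `3 + 2 * √2`. Both contradict the present bounds.
        have noB : ∀ k, w' k ≠ .B := by
          intro k hk
          rw [hiw] at hk
          have h1 := adm (i k)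
          have h2 := hsw k
          rw [hk] at h1
          rcases h3 : w (i k + 1) with _ | _ | _ | _
          · rw [h3] at h1; exact h1
          · rw [h3] at h1; exact h1
          · have h4 := prev _ (h2.trans h3)
            have := he.cot_of_BCBC (n := i k - 1 - 1) h4 (by rw [sub_add_cancel, h2, h3])
              (by rw [← hk]; congr 1; ring) (by rw [← h3]; congr 1; ring)
            linarith
          · have := he.cot_of_DBD hs (h2.trans h3) hk h3
            have := hs.1
            nlinarith
        -- $\pi_2$ sends `B` to `C`, so the new word would avoid `C`. $\pi_3$ fixes `B`, so the new
        -- word would live on the pair `A`, `D` or on the loop at `C`, and have period two.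
        rcases hj' with rfl | rfl
        · obtain ⟨Φ', v'', t', e', -, hs', he'⟩ := hτ'.exists_isCoding hv' hcut
          obtain ⟨k, hk⟩ := he'.exists_eq_C hs' (fun h' => hper'' (h'.of_comp Φ'))
          have h1 := noB k
          revert hk h1
          generalize w' k = Z
          cases Z <;> simp [perm, letterMap]
        · refine hper'' (hτ'.isPeriodicTraj_of_isPeriodic hv' hcut (isPeriodic_of_add_two ?_))
          intro k
          have h1 := hτ'.edge₀ hv' hcut k
          have h2 := hτ'.edge₀ hv' hcut (k + 1)
          rw [show k + 1 + 1 = k + 2 by ring] at h2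
          have n0 := noB k
          have n1 := noB (k + 1)
          have n2 := noB (k + 2)
          revert h1 h2 n0 n1 n2
          generalize w' k = X
          generalize w' (k + 1) = Y
          generalize w' (k + 2) = Z
          cases X <;> cases Y <;> cases Z <;> simp [perm, letterMap, Octagon.edge₀]
  by_contra hne
  push Not at hne
  have hz : v 0 - (1 + √2) * v 1 ≠ 0 := fun h0 => by
    rw [InSector, h0, mul_zero] at hv; exact lt_irrefl _ hv
  have hpos : 0 < √2 / 2 * (v 0 - (1 + √2) * v 1) ^ 2 := by positivity
  obtain ⟨N, hN⟩ := exists_nat_gt (v 1 * (v 0 - (1 + √2) * v 1) / (√2 / 2 * (v 0 - (1 + √2) * v 1) ^ 2))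
  rw [div_lt_iff₀ hpos] at hN
  exact absurd (main N v τ w h hv hw hper hne) (not_le.2 hN)


/-! ## Closed trajectories through the midpoints of the sides -/

theorem abs_height_normal_lt {X Y : Letter} (h : X ≠ Y) : |height X (normal Y)| < 1 := by
  have r0 := sqrt_two_mul_self
  have r1 := sqrt_two_gt
  have r2 := sqrt_two_lt
  rw [abs_lt]
  cases X <;> cases Y <;> simp only [ne_eq, not_true_eq_false, reduceCtorEq] at h <;>
    simp only [height_A, height_B, height_C, height_D, normal_zero, normal_one] <;>
    constructor <;> linarith

theorem normal_mem_octagon (X : Letter) : normal X ∈ octagon := by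
  intro Y
  rcases eq_or_ne Y X with rfl | h
  · rw [height_normal, abs_one]
  · exact (abs_height_normal_lt h).le

theorem not_isVertex_normal (X : Letter) : ¬ IsVertex (normal X) := by
  intro h
  obtain ⟨Y, Z, hYZ, hY, hZ⟩ := h.exists_heights
  have key : ∀ Y, |height Y (normal X)| = 1 → Y = X := fun Y hY => by
    by_contra hne
    exact (abs_height_normal_lt hne).ne hY
  exact hYZ ((key Y hY).trans (key Z hZ).symm)

/-- The letters of the word of period two through the letters `X` and `Y`. -/
def alternate (X Y : Letter) (k : ℤ) : Letter := if Even k then Y else X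

/-- The closed trajectory that runs from midpoint to midpoint of the sides labelled
`X` and `Y`. -/
def midpointTraj (X Y : Letter) (s : ℝ) : Surface :=
  pr (-normal (alternate X Y ⌊s⌋) + (s - ⌊s⌋) • (normal X + normal Y))

theorem normal_alternate (X Y : Letter) (k : ℤ) :
    -normal (alternate X Y k) + (normal X + normal Y) = normal (alternate X Y (k + 1)) := by
  rcases Int.even_or_odd k with h | h
  · have h' : ¬ Even (k + 1) := by rw [Int.even_add_one, not_not]; exact h
    rw [alternate, alternate, if_pos h, if_neg h']; abel
  · rw [← Int.not_even_iff_odd] at h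
    have h' : Even (k + 1) := by rw [Int.even_add_one]; exact h
    rw [alternate, alternate, if_neg h, if_pos h']; abel

theorem midpointChord_mem (X Y : Letter) (k : ℤ) {f : ℝ} (h0 : 0 ≤ f) (h1 : f ≤ 1) :
    -normal (alternate X Y k) + f • (normal X + normal Y) ∈ octagon := by
  refine add_smul_mem_octagon (R := 1) (neg_mem_octagon (normal_mem_octagon _)) ?_ h0 h1
  rw [one_smul, normal_alternate]
  exact normal_mem_octagon _

theorem midpointTraj_eq (X Y : Letter) (k : ℤ) {s : ℝ} (h0 : k ≤ s) (h1 : s ≤ k + 1) :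
    midpointTraj X Y s = pr (-normal (alternate X Y k) + (s - k) • (normal X + normal Y)) := by
  rcases h1.lt_or_eq with h1 | rfl
  · rw [midpointTraj, Int.floor_eq_iff.2 ⟨h0, h1⟩]
  · have e : ⌊(k : ℝ) + 1⌋ = k + 1 := by rw [Int.floor_add_one, Int.floor_intCast]
    rw [midpointTraj, e]
    push_cast
    rw [sub_self, zero_smul, add_zero, add_sub_cancel_left, one_smul, normal_alternate]
    have := pr_sub_period (normal_mem_octagon (alternate X Y (k + 1))) (height_normal _)
    rw [← this]
    congr 1
    rw [period, two_smul]; abel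

theorem abs_height_midpointChord_lt {X Y Z : Letter} {k : ℤ} {f : ℝ} (h0 : 0 < f) (h1 : f < 1) :
    |height Z (-normal (alternate X Y k) + f • (normal X + normal Y))| < 1 := by
  have e : normal X + normal Y = normal (alternate X Y k) + normal (alternate X Y (k + 1)) := by
    rw [← normal_alternate]; abel
  have key : ∀ Y, -1 < height Z (normal Y) ∧ height Z (normal Y) ≤ 1 := fun Y => by
    rcases eq_or_ne Z Y with rfl | h
    · rw [height_normal]; norm_num
    · exact ⟨(abs_lt.1 (abs_height_normal_lt h)).1, (abs_lt.1 (abs_height_normal_lt h)).2.le⟩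
  obtain ⟨a1, a2⟩ := key (alternate X Y k)
  obtain ⟨b1, b2⟩ := key (alternate X Y (k + 1))
  rw [e, height_add, height_neg, height_smul, height_add, abs_lt]
  constructor <;> nlinarith

theorem midpointTraj_mem_side {X Y Z : Letter} {s : ℝ} (h : midpointTraj X Y s ∈ side Z) :
    s = ⌊s⌋ ∧ Z = alternate X Y ⌊s⌋ := by
  have h0 := Int.floor_le s
  have h1 := (Int.lt_floor_add_one s)
  have hm := midpointChord_mem X Y ⌊s⌋ (f := s - ⌊s⌋) (by linarith) (by linarith)
  rcases h0.lt_or_eq with h2 | h2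
  · exfalso
    have hlt := fun Z => abs_height_midpointChord_lt (X := X) (Y := Y) (Z := Z) (k := ⌊s⌋)
      (f := s - ⌊s⌋) (by linarith) (by linarith)
    rw [midpointTraj, pr_mem_side hm] at h
    · exact (hlt Z).ne h
    · intro hv
      obtain ⟨Z', -, -, hZ', -⟩ := hv.exists_heights
      exact (hlt Z').ne hZ'
  · refine ⟨h2.symm, ?_⟩
    rw [midpointTraj, sub_eq_zero.2 h2.symm, zero_smul, add_zero,
      pr_mem_side (neg_mem_octagon (normal_mem_octagon _))
        (by rw [isVertex_neg]; exact not_isVertex_normal _), height_neg, abs_neg] at h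
    by_contra hne
    exact (abs_height_normal_lt hne).ne h

theorem midpointTraj_int_mem (X Y : Letter) (k : ℤ) :
    midpointTraj X Y k ∈ side (alternate X Y k) := by
  rw [midpointTraj_eq X Y k le_rfl (by linarith), sub_self, zero_smul, add_zero,
    pr_mem_side (neg_mem_octagon (normal_mem_octagon _))
      (by rw [isVertex_neg]; exact not_isVertex_normal _), height_neg, abs_neg, height_normal,
    abs_one]

theorem isTraj_midpointTraj (X Y : Letter) : IsTraj (normal X + normal Y) (midpointTraj X Y) := by
  have near : ∀ t : ℝ, ∃ ε : ℝ, 0 < ε ∧ ∀ r : ℝ, |r| < ε →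
      ∃ k : ℤ, k ≤ t ∧ t ≤ k + 1 ∧ k ≤ t + r ∧ t + r ≤ k + 1 := by
    intro t
    have h0 := Int.floor_le t
    have h1 := Int.lt_floor_add_one t
    rcases h0.lt_or_eq with h2 | h2
    · refine ⟨min (t - ⌊t⌋) (⌊t⌋ + 1 - t), lt_min (by linarith) (by linarith), fun r hr => ?_⟩
      rw [lt_min_iff, abs_lt, abs_lt] at hr
      exact ⟨⌊t⌋, h0, h1.le, by linarith, by linarith⟩
    · refine ⟨1, one_pos, fun r hr => ?_⟩
      rw [abs_lt] at hr
      rcases le_total 0 r with h | h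
      · exact ⟨⌊t⌋, h0, h1.le, by linarith, by linarith⟩
      · exact ⟨⌊t⌋ - 1, by push_cast; linarith, by push_cast; linarith, by push_cast; linarith,
          by push_cast; linarith⟩
  refine ⟨fun t => ?_, fun t => ?_⟩
  · have h0 := Int.floor_le t
    have h1 := Int.lt_floor_add_one t
    rw [midpointTraj, pr_mem_singularSet (midpointChord_mem X Y _ (by linarith) (by linarith))]
    rcases h0.lt_or_eq with h2 | h2
    · intro hv
      obtain ⟨Z', -, -, hZ', -⟩ := hv.exists_heights
      exact (abs_height_midpointChord_lt (by linarith) (by linarith)).ne hZ'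
    · rw [sub_eq_zero.2 h2.symm, zero_smul, add_zero, isVertex_neg]
      exact not_isVertex_normal _
  · obtain ⟨ε, hε, H⟩ := near t
    refine ⟨ε, hε, fun r hr => ?_⟩
    obtain ⟨k, h0, h1, h2, h3⟩ := H r hr
    rw [midpointTraj_eq X Y k h0 h1, midpointTraj_eq X Y k h2 h3]
    have hp := midpointChord_mem X Y k (f := t - k) (by linarith) (by linarith)
    have hq := midpointChord_mem X Y k (f := t + r - k) (by linarith) (by linarith)
    rw [show t + r - k = t - k + r by ring, add_smul, ← add_assoc] at hq ⊢
    exact displaced_pr hp hq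

theorem midpointTraj_eq_zero {X Y : Letter} {s : ℝ}
    (h : midpointTraj X Y s = midpointTraj X Y 0) : s = ⌊s⌋ ∧ (X ≠ Y → Even ⌊s⌋) := by
  have h0 := midpointTraj_int_mem X Y 0
  rw [Int.cast_zero, ← h] at h0
  obtain ⟨h1, h2⟩ := midpointTraj_mem_side h0
  refine ⟨h1, fun hXY => ?_⟩
  by_contra hodd
  rw [alternate, alternate, if_pos (by simp), if_neg hodd] at h2
  exact hXY h2.symm

/-- Some trajectory with velocity `v` returns to its initial position exactly at the
multiples of `P`. -/
def HasPeriod (v : Fin 2 → ℝ) (P : ℝ) : Prop :=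
  ∃ τ : ℝ → Surface, IsTraj v τ ∧ ∀ s, τ s = τ 0 → ∃ n : ℤ, s = n * P

theorem hasPeriod_of_same {v : Fin 2 → ℝ} {X : Letter} {c : ℝ} (hc : c ≠ 0)
    (hv : c • v = normal X + normal X) : HasPeriod v c := by
  refine ⟨fun s => midpointTraj X X (c⁻¹ * s), ?_, fun s hs => ?_⟩
  · have := (isTraj_midpointTraj X X).comp_mul (inv_ne_zero hc)
    rwa [← hv, smul_smul, inv_mul_cancel₀ hc, one_smul] at this
  · simp only [mul_zero] at hs
    obtain ⟨h1, -⟩ := midpointTraj_eq_zero hs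
    exact ⟨_, by rw [← h1]; field_simp⟩

theorem hasPeriod_of_ne {v : Fin 2 → ℝ} {X Y : Letter} (hXY : X ≠ Y) {c : ℝ} (hc : c ≠ 0)
    (hv : c • v = normal X + normal Y) : HasPeriod v (2 * c) := by
  refine ⟨fun s => midpointTraj X Y (c⁻¹ * s), ?_, fun s hs => ?_⟩
  · have := (isTraj_midpointTraj X Y).comp_mul (inv_ne_zero hc)
    rwa [← hv, smul_smul, inv_mul_cancel₀ hc, one_smul] at this
  · simp only [mul_zero] at hs
    obtain ⟨h1, h2⟩ := midpointTraj_eq_zero hs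
    obtain ⟨m, hm⟩ := h2 hXY
    refine ⟨m, ?_⟩
    rw [hm] at h1
    push_cast at h1
    field_simp at h1
    rw [h1]; ring

theorem hasPeriod_horizontal : HasPeriod ![1, 0] 2 ∧ HasPeriod ![1, 0] (2 * √2) := by
  have r1 := sqrt_two_gt
  constructor
  · exact hasPeriod_of_same (X := .C) (by norm_num)
      (ext_fin_two (by simp [normal_zero]; norm_num) (by simp [normal_one]))
  · exact hasPeriod_of_ne (X := .B) (Y := .D) (by simp) (by positivity)
      (ext_fin_two (by simp [normal_zero]) (by simp [normal_one]))

theorem hasPeriod_diagonal :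
    HasPeriod ![1 + √2, 1] (2 - √2) ∧ HasPeriod ![1 + √2, 1] √2 := by
  have r0 := sqrt_two_mul_self
  have r1 := sqrt_two_gt
  have r2 := sqrt_two_lt
  constructor
  · have := hasPeriod_of_ne (v := ![1 + √2, 1]) (X := .A) (Y := .D) (c := 1 - √2 / 2) (by simp)
      (by intro h; linarith) (ext_fin_two
        (by simp [normal_zero]; linear_combination -r0 / 2) (by simp [normal_one]; ring))
    rwa [show 2 * (1 - √2 / 2) = 2 - √2 by ring] at this
  · have := hasPeriod_of_ne (v := ![1 + √2, 1]) (X := .B) (Y := .C) (c := √2 / 2) (by simp)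
      (by positivity) (ext_fin_two
        (by simp [normal_zero]; linear_combination r0 / 2) (by simp [normal_one]))
    rwa [show 2 * (√2 / 2) = √2 by ring] at this

/-! ## Elements of the Veech group which preserve two cylinder directions -/

/-- If an element of the Veech group takes `v` to `l • v'`, then the periods of the
trajectories with velocity `v'` are commensurable with those with velocity `v`. -/
theorem HasPeriod.commensurable {v v' : Fin 2 → ℝ} {P P₁ P₂ l : ℝ} (h : HasPeriod v P)
    (h' : ∀ τ, IsTraj v' τ → (∀ s, τ (s + P₁) = τ s) ∨ ∀ s, τ (s + P₂) = τ s)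
    {M : GL (Fin 2) ℝ} (hM : M ∈ veechGroup) (hl : l ≠ 0) (hv : M.1.mulVec v = l • v') :
    ∃ n : ℤ, P₁ = n * P * l ∨ P₂ = n * P * l := by
  obtain ⟨τ, hτ, hP⟩ := h
  obtain ⟨Ψ, hΨ⟩ := hM
  have h1 := (hΨ.isTraj hτ).comp_mul (inv_ne_zero hl)
  rw [hv, smul_smul, inv_mul_cancel₀ hl, one_smul] at h1
  have key : ∀ P', (∀ s, Ψ (τ (l⁻¹ * (s + P'))) = Ψ (τ (l⁻¹ * s))) → ∃ n : ℤ, P' = n * P * l := by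
    intro P' h2
    have h3 := Ψ.injective (h2 0)
    rw [mul_zero, zero_add] at h3
    obtain ⟨n, hn⟩ := hP _ h3
    exact ⟨n, by rw [← hn]; field_simp⟩
  rcases h' _ h1 with h2 | h2
  · exact (key P₁ h2).imp fun n => Or.inl
  · exact (key P₂ h2).imp fun n => Or.inr

theorem int_eq_zero_of_add_mul_sqrt_two {a b : ℤ} (h : (a : ℝ) + b * √2 = 0) : a = 0 ∧ b = 0 := by
  have hb : b = 0 := by
    by_contra hb
    refine irrational_sqrt_two ⟨-a / b, ?_⟩
    have : (b : ℝ) ≠ 0 := by exact_mod_cast hb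
    push_cast
    field_simp
    linarith
  subst hb
  simpa using h

theorem mem_veechGroup_inv {M : GL (Fin 2) ℝ} (h : M ∈ veechGroup) : M⁻¹ ∈ veechGroup :=
  let ⟨Ψ, hΨ⟩ := h
  ⟨Ψ.symm, hΨ.symm⟩

theorem mem_veechGroup_mul {M N : GL (Fin 2) ℝ} (hM : M ∈ veechGroup) (hN : N ∈ veechGroup) :
    M * N ∈ veechGroup :=
  let ⟨_, hΨ⟩ := hM
  let ⟨_, hΦ⟩ := hN
  ⟨_, hΨ.comp hΦ⟩

theorem inv_mulVec_eq {M : GL (Fin 2) ℝ} {v v' : Fin 2 → ℝ} {l : ℝ} (hl : l ≠ 0)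
    (h : M.1.mulVec v = l • v') : (M⁻¹).1.mulVec v' = l⁻¹ • v := by
  have h1 := congrArg ((M⁻¹).1.mulVec) h
  rw [inv_mulVec_mulVec, Matrix.mulVec_smul] at h1
  rw [h1, smul_smul, inv_mul_cancel₀ hl, one_smul]

/-- The four combinations of the alternatives make the square of `P₁ / P₂` an integer, or `P₁ / P₂`
an integer (twice), or both `l` and its inverse integers. Only the last is possible. -/
theorem eq_one_or_of_commensurable {P₁ P₂ l : ℝ} (hl : l ≠ 0) (hP : P₂ ≠ 0)
    (h : ∀ k : ℤ, P₁ ≠ k * P₂) (h' : ∀ k : ℤ, P₁ * P₁ ≠ k * (P₂ * P₂))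
    (h1 : ∃ n : ℤ, P₁ = n * P₂ * l ∨ P₂ = n * P₂ * l)
    (h2 : ∃ n : ℤ, P₁ = n * P₂ * l⁻¹ ∨ P₂ = n * P₂ * l⁻¹) : l = 1 ∨ l = -1 := by
  obtain ⟨m, hm⟩ := h1
  obtain ⟨a, ha | ha⟩ := h2
  · field_simp at ha
    exfalso
    rcases hm with hm | hm
    · exact h' (m * a) (by push_cast; linear_combination P₁ * hm + m * P₂ * ha)
    · have hm' : 1 = m * l := mul_left_cancel₀ hP (by linarith)
      exact h (m * a) (by push_cast; linear_combination P₁ * hm' + m * ha)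
  · have ha' : l = a := by
      field_simp at ha
      linarith
    subst ha'
    rcases hm with hm | hm
    · exact absurd (by push_cast; linarith) (h (m * a))
    · have hm' : (1 : ℝ) = m * a := mul_left_cancel₀ hP (by linarith)
      have : a * m = 1 := by rw [mul_comm]; exact_mod_cast hm'.symm
      rcases Int.eq_one_or_neg_one_of_mul_eq_one this with rfl | rfl <;> simp

theorem multiplier_horizontal {M : GL (Fin 2) ℝ} (hM : M ∈ veechGroup) {l : ℝ} (hl : l ≠ 0)
    (h : M.1.mulVec ![1, 0] = l • ![1, 0]) : l = 1 ∨ l = -1 := by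
  have r0 := sqrt_two_mul_self
  refine eq_one_or_of_commensurable (P₁ := 2) (P₂ := 2 * √2) hl (by positivity) ?_ ?_
    (hasPeriod_horizontal.2.commensurable (fun _ h => h.horizontal_period) hM hl h)
    (hasPeriod_horizontal.2.commensurable (fun _ h => h.horizontal_period)
      (mem_veechGroup_inv hM) (inv_ne_zero hl) (inv_mulVec_eq hl h))
  · intro k hk
    have := int_eq_zero_of_add_mul_sqrt_two (a := -2) (b := 2 * k) (by push_cast; linarith)
    simp at this
  · intro k hk
    have : (4 : ℝ) = k * 8 := by linear_combination hk + 4 * k * r0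
    have : (4 : ℤ) = k * 8 := by exact_mod_cast this
    omega

theorem multiplier_diagonal {M : GL (Fin 2) ℝ} (hM : M ∈ veechGroup) {l : ℝ} (hl : l ≠ 0)
    (h : M.1.mulVec ![1 + √2, 1] = l • ![1 + √2, 1]) : l = 1 ∨ l = -1 := by
  have r0 := sqrt_two_mul_self
  refine eq_one_or_of_commensurable (P₁ := 2 - √2) (P₂ := √2) hl (by positivity) ?_ ?_
    (hasPeriod_diagonal.2.commensurable (fun _ h => h.diagonal_period) hM hl h)
    (hasPeriod_diagonal.2.commensurable (fun _ h => h.diagonal_period)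
      (mem_veechGroup_inv hM) (inv_ne_zero hl) (inv_mulVec_eq hl h))
  · intro k hk
    have := int_eq_zero_of_add_mul_sqrt_two (a := 2) (b := -(k + 1)) (by push_cast; linarith)
    simp at this
  · intro k hk
    have := int_eq_zero_of_add_mul_sqrt_two (a := 6 - 2 * k) (b := -4)
      (by push_cast; linear_combination hk + (k - 1) * r0)
    simp at this

/-- The two closed diagonal trajectories give two expressions for `2 * l⁻¹` with integer coordinates
in the basis `1`, `√2`. Comparing coordinates forces `2 * l⁻¹ = 0`. -/
theorem mulVec_diagonal_ne_horizontal {M : GL (Fin 2) ℝ} (hM : M ∈ veechGroup) {l : ℝ}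
    (hl : l ≠ 0) : M.1.mulVec ![1 + √2, 1] ≠ l • ![1, 0] := by
  intro h
  have r0 := sqrt_two_mul_self
  have key : ∀ a b c d : ℤ, (2 : ℝ) * l⁻¹ = a + b * √2 → 2 * l⁻¹ = c + d * √2 → a = c ∧ b = d := by
    intro a b c d h1 h2
    have := int_eq_zero_of_add_mul_sqrt_two (a := a - c) (b := b - d) (by push_cast; linarith)
    omega
  have hz : (2 : ℝ) * l⁻¹ ≠ 0 := by simp [hl]
  obtain ⟨n, hn⟩ : ∃ n : ℤ, (2 : ℝ) * l⁻¹ = (2 * n : ℤ) + (-n : ℤ) * √2 ∨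
      2 * l⁻¹ = (-n : ℤ) + n * √2 := by
    obtain ⟨n, hn⟩ := hasPeriod_diagonal.1.commensurable (fun _ h => h.horizontal_period) hM hl h
    refine ⟨n, hn.imp (fun h => ?_) fun h => ?_⟩
    · rw [(mul_inv_eq_iff_eq_mul₀ hl).2 h]; push_cast; ring
    · have h3 : 2 * l⁻¹ * √2 = n * (2 - √2) := by
        rw [mul_right_comm, h]; field_simp
      push_cast
      linear_combination √2 / 2 * h3 - (l⁻¹ + n / 2) * r0
  obtain ⟨m, hm⟩ : ∃ m : ℤ, (2 : ℝ) * l⁻¹ = (0 : ℤ) + m * √2 ∨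
      2 * l⁻¹ = m + (0 : ℤ) * √2 := by
    obtain ⟨m, hm⟩ := hasPeriod_diagonal.2.commensurable (fun _ h => h.horizontal_period) hM hl h
    refine ⟨m, hm.imp (fun h => ?_) fun h => ?_⟩
    · rw [(mul_inv_eq_iff_eq_mul₀ hl).2 h]; push_cast; ring
    · have : (2 : ℝ) = m * l := by
        have : √2 ≠ 0 := by positivity
        exact mul_right_cancel₀ this (by linarith)
      rw [(mul_inv_eq_iff_eq_mul₀ hl).2 this]; push_cast; ring
  have hm0 : m = 0 := by
    rcases hn with hn | hn <;> rcases hm with hm | hm <;> have := key _ _ _ _ hn hm <;> omega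
  subst hm0
  rcases hm with hm | hm <;> exact hz (by simpa using hm)

/-- An element of the Veech group which preserves the lines of the first and the last
direction of the sector is determined up to sign and up to `γ`. -/
theorem eq_of_mulVec {M : GL (Fin 2) ℝ} {a b : ℝ} (h1 : M.1.mulVec ![1, 0] = a • ![1, 0])
    (h2 : M.1.mulVec ![1 + √2, 1] = b • ![1 + √2, 1]) :
    M.1 = !![a, (b - a) * (1 + √2); 0, b] := by
  have a0 := congrFun h1 0
  have a1 := congrFun h1 1
  have b0 := congrFun h2 0
  have b1 := congrFun h2 1
  simp [Matrix.mulVec, dotProduct, Fin.sum_univ_two] at a0 a1 b0 b1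
  ext i j
  fin_cases i <;> fin_cases j <;> simp
  · exact a0
  · rw [a0] at b0; linarith
  · exact a1
  · rw [a1] at b1; linarith


/-! ## Points of the upper half plane as quadratic forms -/

/-- The symmetric bilinear form of determinant one which corresponds to a point of the upper
half plane. -/
def gramForm (z : UpperHalfPlane) (a b : Fin 2 → ℝ) : ℝ :=
  ((z.re ^ 2 + z.im ^ 2) * (a 0 * b 0) + z.re * (a 0 * b 1 + a 1 * b 0) + a 1 * b 1) / z.im

/-- The right action is the pullback of forms, normalized to determinant one. Orientation-reversing
elements are covered too, as only the absolute value of the determinant enters. -/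
theorem gramForm_rightAct (z : UpperHalfPlane) (M : GL (Fin 2) ℝ) (a b : Fin 2 → ℝ) :
    gramForm (rightAct z M) a b = gramForm z (M.1.mulVec a) (M.1.mulVec b) / |M.1.det| := by
  have hy := z.im_pos
  have hdet : M.1.det ≠ 0 := M.det.ne_zero
  have hD : 0 < |M.1.det| := abs_pos.2 hdet
  have hD2 : |M.1.det| ^ 2 = (M.1 0 0 * M.1 1 1 - M.1 0 1 * M.1 1 0) ^ 2 := by
    rw [sq_abs, Matrix.det_fin_two]
  have hT : |(transposeGL M).det.val| = |M.1.det| := by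
    congr 1
    exact Matrix.det_transpose M.1
  set D := |M.1.det|
  set n := (M.1 0 1 * z.re + M.1 1 1) ^ 2 + (M.1 0 1 * z.im) ^ 2 with hn
  set m := (M.1 0 0 * z.re + M.1 1 0) ^ 2 + (M.1 0 0 * z.im) ^ 2 with hm
  set R := (M.1 0 0 * z.re + M.1 1 0) * (M.1 0 1 * z.re + M.1 1 1) + M.1 0 0 * M.1 0 1 * z.im ^ 2
    with hR
  have hden : UpperHalfPlane.denom (transposeGL M) z = M.1 0 1 * z + M.1 1 1 := rfl
  have hnum : UpperHalfPlane.num (transposeGL M) z = M.1 0 0 * z + M.1 1 0 := rfl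
  have hnsq : Complex.normSq (UpperHalfPlane.denom (transposeGL M) z) = n := by
    rw [hden, Complex.normSq_apply, hn]
    simp
    ring
  have hn0 : 0 < n := by rw [← hnsq]; exact UpperHalfPlane.normSq_denom_pos _ z.im_ne_zero
  have him : (rightAct z M).im = D * z.im / n := by
    rw [rightAct, UpperHalfPlane.im_smul_eq_div_normSq, hT, hnsq]
  have hre : (rightAct z M).re = R / n := by
    rw [rightAct, UpperHalfPlane.re_smul, Complex.div_re, hnsq, hnum, hden, hR]
    simp
    field_simp
  have hsq : (R / n) ^ 2 + (D * z.im / n) ^ 2 = m / n := by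
    field_simp
    rw [hD2, hR, hm, hn]
    ring
  rw [gramForm, hre, him, hsq, gramForm]
  simp only [Matrix.mulVec, dotProduct, Fin.sum_univ_two]
  rw [hm, hR]
  field_simp
  rw [hn]
  ring

theorem rightAct_mul (z : UpperHalfPlane) (M N : GL (Fin 2) ℝ) :
    rightAct z (M * N) = rightAct (rightAct z M) N := by
  have : transposeGL (M * N) = transposeGL N * transposeGL M := by
    ext1
    exact Matrix.transpose_mul _ _
  rw [rightAct, this, mul_smul]; rfl

theorem rightAct_one (z : UpperHalfPlane) : rightAct z 1 = z := by
  have : transposeGL 1 = 1 := by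
    ext1
    exact Matrix.transpose_one
  rw [rightAct, this, one_smul]

theorem rightAct_inv_rightAct (z : UpperHalfPlane) (M : GL (Fin 2) ℝ) :
    rightAct (rightAct z M) M⁻¹ = z := by
  rw [← rightAct_mul, mul_inv_cancel, rightAct_one]

theorem rightAct_rightAct_inv (z : UpperHalfPlane) (M : GL (Fin 2) ℝ) :
    rightAct (rightAct z M⁻¹) M = z := by
  rw [← rightAct_mul, inv_mul_cancel, rightAct_one]

theorem mem_imageRight {S : Set UpperHalfPlane} {M : GL (Fin 2) ℝ} {z : UpperHalfPlane} :
    z ∈ imageRight S M ↔ rightAct z M⁻¹ ∈ S := by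
  constructor
  · rintro ⟨y, hy, rfl⟩
    simpa only [rightAct_inv_rightAct] using hy
  · intro h
    exact ⟨_, h, rightAct_rightAct_inv z M⟩

theorem rightAct_mem_imageRight {S : Set UpperHalfPlane} {M : GL (Fin 2) ℝ} {z : UpperHalfPlane} :
    rightAct z M ∈ imageRight S M ↔ z ∈ S := by
  rw [mem_imageRight, rightAct_inv_rightAct]

theorem imageRight_mul (S : Set UpperHalfPlane) (M N : GL (Fin 2) ℝ) :
    imageRight S (M * N) = imageRight (imageRight S M) N := by
  ext z
  rw [mem_imageRight, mem_imageRight, mem_imageRight, mul_inv_rev, rightAct_mul]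

theorem imageRight_one (S : Set UpperHalfPlane) : imageRight S 1 = S := by
  ext z
  rw [mem_imageRight, inv_one, rightAct_one]

theorem imageRight_eq_iff {S T : Set UpperHalfPlane} {M : GL (Fin 2) ℝ} :
    imageRight S M = T ↔ S = imageRight T M⁻¹ := by
  constructor
  · rintro rfl
    rw [← imageRight_mul, mul_inv_cancel, imageRight_one]
  · rintro rfl
    rw [← imageRight_mul, inv_mul_cancel, imageRight_one]

/-- A point is determined by the values of its form on the two directions which bound the
first sector. -/
theorem eq_of_gramForm_eq {z z' : UpperHalfPlane}
    (h1 : gramForm z ![1, 0] ![1, 0] = gramForm z' ![1, 0] ![1, 0])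
    (h2 : gramForm z ![1, 0] ![1 + √2, 1] = gramForm z' ![1, 0] ![1 + √2, 1])
    (h3 : gramForm z ![1 + √2, 1] ![1 + √2, 1] = gramForm z' ![1 + √2, 1] ![1 + √2, 1]) :
    z = z' := by
  have hy := z.im_pos
  have hy' := z'.im_pos
  simp [gramForm] at h1 h2 h3
  have e2 : z.re / z.im = z'.re / z'.im := by
    have i1 : (z.re ^ 2 + z.im ^ 2) * (1 + √2) / z.im + z.re / z.im =
      (z'.re ^ 2 + z'.im ^ 2) * (1 + √2) / z'.im + z'.re / z'.im := by
      rw [← add_div, ← add_div]; exact h2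
    rw [mul_div_right_comm, mul_div_right_comm, h1] at i1
    linarith
  have e3 : 1 / z.im = 1 / z'.im := by
    have i1 : (1 + √2) ^ 2 * ((z.re ^ 2 + z.im ^ 2) / z.im) + 2 * (1 + √2) * (z.re / z.im) +
      1 / z.im = (1 + √2) ^ 2 * ((z'.re ^ 2 + z'.im ^ 2) / z'.im) +
      2 * (1 + √2) * (z'.re / z'.im) + 1 / z'.im := by
      convert h3 using 1 <;> ring
    rw [h1, e2] at i1
    linarith
  have e4 : z.im = z'.im := by
    have := congrArg (fun x => x⁻¹) e3
    simpa using this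
  have e5 : z.re = z'.re := by
    rw [e4] at e2
    exact (div_left_inj' hy'.ne').1 e2
  exact UpperHalfPlane.ext (Complex.ext e5 e4)

theorem rightAct_neg (z : UpperHalfPlane) (M : GL (Fin 2) ℝ) : rightAct z (-M) = rightAct z M := by
  have : transposeGL (-M) = -transposeGL M := by
    ext1
    exact Matrix.transpose_neg _
  rw [rightAct, this, UpperHalfPlane.neg_smul]; rfl

theorem imageRight_neg (S : Set UpperHalfPlane) (M : GL (Fin 2) ℝ) :
    imageRight S (-M) = imageRight S M := by
  simp only [imageRight, rightAct_neg]

/-- Here `l` is the smaller eigenvalue; what remains has rank at most one and is the square of a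
linear form. The traceless part transforms like the square of a vector regarded as a complex number,
so `v` is found as a complex square root. -/
theorem exists_gramForm_eq (z : UpperHalfPlane) : ∃ (l : ℝ) (v : Fin 2 → ℝ), 0 < l ∧
    ∀ a b, gramForm z a b = l * (a ⬝ᵥ b) + cross v a * cross v b := by
  have hy := z.im_pos
  obtain ⟨p, hp⟩ : ∃ p, p = ((z.re ^ 2 + z.im ^ 2) + 1) / (2 * z.im) := ⟨_, rfl⟩
  obtain ⟨U, hU⟩ : ∃ U, U = ((z.re ^ 2 + z.im ^ 2) - 1) / z.im := ⟨_, rfl⟩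
  obtain ⟨W, hW⟩ : ∃ W, W = 2 * z.re / z.im := ⟨_, rfl⟩
  have hp0 : 0 < p := by rw [hp]; positivity
  have hUW : U ^ 2 + W ^ 2 = 4 * p ^ 2 - 4 := by
    rw [hU, hW, hp]
    field_simp
    ring
  have e1 : (z.re ^ 2 + z.im ^ 2) / z.im = p + U / 2 := by rw [hp, hU]; field_simp; ring
  have e2 : z.re / z.im = W / 2 := by rw [hW]; ring
  have e3 : 1 / z.im = p - U / 2 := by rw [hp, hU]; field_simp; ring
  obtain ⟨x, hx⟩ := IsAlgClosed.exists_pow_nat_eq (⟨-U, -W⟩ : ℂ) (n := 2) (by norm_num)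
  have hre := congrArg Complex.re hx
  have him := congrArg Complex.im hx
  simp [sq] at hre him
  have key : (x.re ^ 2 + x.im ^ 2) ^ 2 = 4 * p ^ 2 - 4 := by
    linear_combination (x.re * x.re - x.im * x.im - U) * hre +
      (x.re * x.im + x.im * x.re - W) * him + hUW
  refine ⟨p - (x.re ^ 2 + x.im ^ 2) / 2, ![x.re, x.im], ?_, fun a b => ?_⟩
  · nlinarith [sq_nonneg x.re, sq_nonneg x.im]
  · have : gramForm z a b = (z.re ^ 2 + z.im ^ 2) / z.im * (a 0 * b 0) +
        z.re / z.im * (a 0 * b 1 + a 1 * b 0) + 1 / z.im * (a 1 * b 1) := by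
      rw [gramForm]; ring
    rw [this, e1, e2, e3]
    simp [cross, dotProduct, Fin.sum_univ_two]
    linear_combination (-(a 0 * b 0) / 2 + a 1 * b 1 / 2) * -hre +
      (a 0 * b 1 + a 1 * b 0) / 2 * him

/-! ## The eight sectors -/

/-- The quadratic form which is positive on the lines of the first sector. -/
def sectorForm (v : Fin 2 → ℝ) : ℝ := v 1 * (v 0 - (1 + √2) * v 1)

theorem sectorForm_eq (v : Fin 2 → ℝ) : 2 * sectorForm v =
    (1 + √2) * (v 0 ^ 2 - v 1 ^ 2) + 2 * v 0 * v 1 - (1 + √2) * (v 0 ^ 2 + v 1 ^ 2) := by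
  rw [sectorForm]; ring

/-- The action of the isometries of the octagon on the real and imaginary parts of the square
of a vector, regarded as a complex number. -/
theorem nu_mulVec_sq (j : Fin 8) (v : Fin 2 → ℝ) {U W : ℝ} (hU : U = v 0 ^ 2 - v 1 ^ 2)
    (hW : W = 2 * v 0 * v 1) :
    ((nu j).1.mulVec v 0 ^ 2 - (nu j).1.mulVec v 1 ^ 2 = ![U, W, W, -U, -U, -W, -W, U] j ∧
    2 * (nu j).1.mulVec v 0 * (nu j).1.mulVec v 1 = ![W, U, -U, W, -W, -U, U, -W] j) ∧
    (nu j).1.mulVec v 0 ^ 2 + (nu j).1.mulVec v 1 ^ 2 = v 0 ^ 2 + v 1 ^ 2 := by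
  have r0 := sqrt_two_mul_self
  subst hU hW
  rw [nu_mulVec_zero, nu_mulVec_one]
  fin_cases j <;> refine ⟨⟨?_, ?_⟩, ?_⟩ <;> simp <;>
    first
    | ring1
    | linear_combination (v 0 * v 1) * r0
    | linear_combination (-v 0 * v 1) * r0
    | linear_combination (v 0 ^ 2 - v 1 ^ 2) / 2 * r0
    | linear_combination -(v 0 ^ 2 - v 1 ^ 2) / 2 * r0
    | linear_combination (v 0 ^ 2 + v 1 ^ 2) / 2 * r0

theorem two_mul_sectorForm_nu (j : Fin 8) (v : Fin 2 → ℝ) {U W : ℝ} (hU : U = v 0 ^ 2 - v 1 ^ 2)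
    (hW : W = 2 * v 0 * v 1) : 2 * sectorForm ((nu j).1.mulVec v) =
      (1 + √2) * ![U, W, W, -U, -U, -W, -W, U] j + ![W, U, -U, W, -W, -U, U, -W] j -
        (1 + √2) * (v 0 ^ 2 + v 1 ^ 2) := by
  obtain ⟨⟨h1, h2⟩, h3⟩ := nu_mulVec_sq j v hU hW
  rw [sectorForm_eq, h1, h2, h3]

/-- Two different sectors have disjoint interiors. -/
theorem sectorForm_add_nonpos {i j : Fin 8} (hij : i ≠ j) (v : Fin 2 → ℝ) :
    sectorForm ((nu i).1.mulVec v) + sectorForm ((nu j).1.mulVec v) ≤ 0 := by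
  have r0 := sqrt_two_mul_self
  have r1 := sqrt_two_gt
  obtain ⟨U, hU⟩ : ∃ U, U = v 0 ^ 2 - v 1 ^ 2 := ⟨_, rfl⟩
  obtain ⟨W, hW⟩ : ∃ W, W = 2 * v 0 * v 1 := ⟨_, rfl⟩
  obtain ⟨N, hN⟩ : ∃ N, N = v 0 ^ 2 + v 1 ^ 2 := ⟨_, rfl⟩
  have hi := two_mul_sectorForm_nu i v hU hW
  have hj := two_mul_sectorForm_nu j v hU hW
  rw [← hN] at hi hj
  have hN0 : 0 ≤ N := by rw [hN]; positivity
  have hsq : U ^ 2 + W ^ 2 = N ^ 2 := by rw [hU, hW, hN]; ring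
  have hUN := abs_le.1 (abs_le_of_sq_le_sq (show U ^ 2 ≤ N ^ 2 by nlinarith [sq_nonneg W]) hN0)
  have hWN := abs_le.1 (abs_le_of_sq_le_sq (show W ^ 2 ≤ N ^ 2 by nlinarith [sq_nonneg U]) hN0)
  -- The point `(U, W)` lies on a circle of radius `N`, so `|U ± W| ≤ √2 * N`. These bounds and
  -- those on `U` and `W` settle all pairs linearly.
  have hd1 := abs_le.1 (abs_le_of_sq_le_sq (show (U + W) ^ 2 ≤ (√2 * N) ^ 2 by
    nlinarith [sq_nonneg (U - W)]) (by positivity))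
  have hd2 := abs_le.1 (abs_le_of_sq_le_sq (show (U - W) ^ 2 ≤ (√2 * N) ^ 2 by
    nlinarith [sq_nonneg (U + W)]) (by positivity))
  have a1 := sqrt_two_mul_mono hUN.1
  have a2 := sqrt_two_mul_mono hUN.2
  have a3 := sqrt_two_mul_mono hWN.1
  have a4 := sqrt_two_mul_mono hWN.2
  have b1 := sqrt_two_mul_mono hd1.1
  have b2 := sqrt_two_mul_mono hd1.2
  have b3 := sqrt_two_mul_mono hd2.1
  have b4 := sqrt_two_mul_mono hd2.2
  have e : √2 * (√2 * N) = 2 * N := by rw [← mul_assoc, r0]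
  suffices 2 * sectorForm ((nu i).1.mulVec v) + 2 * sectorForm ((nu j).1.mulVec v) ≤ 0 by linarith
  rw [hi, hj]
  clear hi hj hU hW hN hsq
  fin_cases i <;> fin_cases j <;> first | exact absurd rfl hij | (simp; linarith)


theorem cross_mulVec (M : Matrix (Fin 2) (Fin 2) ℝ) (v a : Fin 2 → ℝ) :
    cross (M.mulVec v) (M.mulVec a) = M.det * cross v a := by
  simp only [cross, Matrix.mulVec, dotProduct, Fin.sum_univ_two, Matrix.det_fin_two]
  ring

theorem det_nu_sq (j : Fin 8) : (nu j).1.det ^ 2 = 1 := by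
  have := congrArg Matrix.det (isOctagonSymmetry_nu j).1
  rwa [Matrix.det_mul, Matrix.det_transpose, Matrix.det_one, ← sq] at this

theorem det_inv_sq {M : GL (Fin 2) ℝ} (h : M.1.det ^ 2 = 1) : (M⁻¹).1.det ^ 2 = 1 := by
  have h1 : (M⁻¹).1.det * M.1.det = 1 := by
    rw [← Matrix.det_mul, ← Units.val_mul, inv_mul_cancel, Units.val_one, Matrix.det_one]
  have h2 := congrArg (· ^ 2) h1
  simpa only [mul_pow, h, mul_one, one_pow] using h2

theorem det_mul_sq {M N : GL (Fin 2) ℝ} (hM : M.1.det ^ 2 = 1) (hN : N.1.det ^ 2 = 1) :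
    (M * N).1.det ^ 2 = 1 := by
  rw [Units.val_mul, Matrix.det_mul, mul_pow, hM, hN, one_mul]

theorem abs_det_eq_one {M : GL (Fin 2) ℝ} (h : M.1.det ^ 2 = 1) : |M.1.det| = 1 := by
  rw [← sq_abs] at h
  exact (pow_eq_one_iff_of_nonneg (abs_nonneg _) (by norm_num)).1 h

theorem det_gam_sq : gam.1.det ^ 2 = 1 := by
  have : gam.1.det = -1 := by
    show Matrix.det !![-1, 2 * (1 + √2); 0, 1] = -1
    simp [Matrix.det_fin_two]
  rw [this]; norm_num

/-! ## The ideal octagon in terms of quadratic forms -/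

/-- The form which corresponds to `z` is `l` times the standard one plus the square of the
linear form of kernel `v`. -/
def HasNormalForm (z : UpperHalfPlane) (l : ℝ) (v : Fin 2 → ℝ) : Prop :=
  ∀ a b, gramForm z a b = l * (a ⬝ᵥ b) + cross v a * cross v b

theorem nu_dotProduct (j : Fin 8) (a b : Fin 2 → ℝ) :
    (nu j).1.mulVec a ⬝ᵥ (nu j).1.mulVec b = a ⬝ᵥ b := by
  rw [Matrix.dotProduct_mulVec, Matrix.vecMul_mulVec, ← Matrix.dotProduct_mulVec,
    (isOctagonSymmetry_nu j).1, Matrix.one_mulVec]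

theorem HasNormalForm.nu {z : UpperHalfPlane} {l : ℝ} {v : Fin 2 → ℝ} (h : HasNormalForm z l v)
    (j : Fin 8) : HasNormalForm (rightAct z (nu j)⁻¹) l ((nu j).1.mulVec v) := by
  intro a b
  rw [gramForm_rightAct, abs_det_eq_one (det_inv_sq (det_nu_sq j)), div_one, h]
  obtain ⟨a, rfl⟩ : ∃ a', a = (Octagon.nu j).1.mulVec a' := ⟨_, (mulVec_inv_mulVec _ _).symm⟩
  obtain ⟨b, rfl⟩ : ∃ b', b = (Octagon.nu j).1.mulVec b' := ⟨_, (mulVec_inv_mulVec _ _).symm⟩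
  rw [inv_mulVec_mulVec, inv_mulVec_mulVec, nu_dotProduct, cross_mulVec, cross_mulVec]
  linear_combination -(cross v a * cross v b) * det_nu_sq j

/-- The form which vanishes on the geodesic fixed by `γ`. -/
def sideForm (z : UpperHalfPlane) : ℝ := gramForm z ![1, 0] ![1 + √2, 1]

theorem HasNormalForm.sideForm {z : UpperHalfPlane} {l : ℝ} {v : Fin 2 → ℝ}
    (h : HasNormalForm z l v) : sideForm z = l * (1 + √2) - sectorForm v := by
  rw [Octagon.sideForm, h, sectorForm]
  simp [cross, dotProduct, Fin.sum_univ_two]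
  ring

/-- After division by the imaginary part the mirror inequalities are linear in the coefficients of
the form. The multiple of the standard form drops out of the first two, which leave a condition on
the direction of `v`. -/
theorem HasNormalForm.mem_triangle {z : UpperHalfPlane} {l : ℝ} {v : Fin 2 → ℝ}
    (h : HasNormalForm z l v) : z ∈ triangle ↔
      0 ≤ v 0 * v 1 ∧ v 1 ^ 2 + 2 * v 0 * v 1 ≤ v 0 ^ 2 ∧ 0 ≤ Octagon.sideForm z := by
  have hy := z.im_pos
  have hn : ‖(z : ℂ)‖ ^ 2 = z.re ^ 2 + z.im ^ 2 := by
    rw [← Complex.normSq_eq_norm_sq, Complex.normSq_apply]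
    simp [sq]
  have h12 := h ![1, 0] ![0, 1]
  have h11 := h ![1, 0] ![1, 0]
  have h22 := h ![0, 1] ![0, 1]
  simp [gramForm, cross, dotProduct, Fin.sum_univ_two] at h12 h11 h22
  have e : z ∈ triangle ↔ z.re / z.im ≤ 0 ∧
      (z.re ^ 2 + z.im ^ 2) / z.im - 2 * (z.re / z.im) - z.im⁻¹ ≤ 0 ∧ 0 ≤ Octagon.sideForm z := by
    have e1 : Octagon.sideForm z = ((1 + √2) * (z.re ^ 2 + z.im ^ 2) + z.re) / z.im := by
      rw [Octagon.sideForm, gramForm]; simp; ring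
    have e2 : (z.re ^ 2 + z.im ^ 2) / z.im - 2 * (z.re / z.im) - z.im⁻¹ =
        (z.re ^ 2 + z.im ^ 2 - 2 * z.re - 1) / z.im := by
      field_simp
    rw [e1, e2, div_le_iff₀ hy, div_le_iff₀ hy, le_div_iff₀ hy, zero_mul, sub_nonpos]
    rw [triangle, Set.mem_ofPred_eq, hn]
  rw [e, h12, h11, h22]
  refine and_congr ?_ (and_congr ?_ Iff.rfl)
  · constructor <;> intro <;> linarith
  · constructor <;> intro <;> nlinarith

theorem gam_mulVec_horizontal : gam.1.mulVec ![1, 0] = -![1, 0] :=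
  ext_fin_two (by simp [gam_mulVec_zero]) (by simp [gam_mulVec_one])

theorem gam_mulVec_diagonal : gam.1.mulVec ![1 + √2, 1] = ![1 + √2, 1] :=
  ext_fin_two (by rw [gam_mulVec_zero]; simp; ring) (by simp [gam_mulVec_one])

theorem gramForm_neg_left (z : UpperHalfPlane) (a b : Fin 2 → ℝ) :
    gramForm z (-a) b = -gramForm z a b := by
  simp only [gramForm, Pi.neg_apply]
  ring

theorem gramForm_comm (z : UpperHalfPlane) (a b : Fin 2 → ℝ) :
    gramForm z a b = gramForm z b a := by
  simp only [gramForm]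
  ring

theorem sideForm_gam (z : UpperHalfPlane) : sideForm (rightAct z gam) = -sideForm z := by
  rw [sideForm, gramForm_rightAct, abs_det_eq_one det_gam_sq, div_one, gam_mulVec_horizontal,
    gam_mulVec_diagonal, gramForm_neg_left, sideForm]

/-- $\gamma$ negates one boundary vector of the sector and fixes the other. Of the three values that
determine a form it changes only the mixed one, by a sign. -/
theorem rightAct_gam_eq_iff {z : UpperHalfPlane} : rightAct z gam = z ↔ sideForm z = 0 := by
  constructor
  · intro h
    have := sideForm_gam z
    rw [h] at this
    linarith
  · intro h
    have h1 := abs_det_eq_one det_gam_sq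
    refine eq_of_gramForm_eq ?_ ?_ ?_
    · rw [gramForm_rightAct, h1, div_one, gam_mulVec_horizontal, gramForm_neg_left, gramForm_comm,
        gramForm_neg_left, neg_neg]
    · exact (sideForm_gam z).trans (by rw [h, neg_zero]; exact h.symm)
    · rw [gramForm_rightAct, h1, div_one, gam_mulVec_diagonal]

theorem mem_idealSide {z : UpperHalfPlane} {j : Fin 8} :
    z ∈ idealSide j ↔ sideForm (rightAct z (nu j)⁻¹) = 0 := by
  rw [idealSide, mem_imageRight, ← rightAct_gam_eq_iff]
  rfl

theorem one_add_sqrt_two_pos : 0 < 1 + √2 := by positivity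

/-- A point beyond one side of the ideal octagon is on the inner side of all the others. -/
theorem sideForm_pos_of_ne {z : UpperHalfPlane} {i j : Fin 8} (hij : i ≠ j)
    (h : sideForm (rightAct z (nu i)⁻¹) ≤ 0) : 0 < sideForm (rightAct z (nu j)⁻¹) := by
  obtain ⟨l, v, hl, hz⟩ := exists_gramForm_eq z
  have hz : HasNormalForm z l v := hz
  rw [(hz.nu i).sideForm] at h
  rw [(hz.nu j).sideForm]
  have := sectorForm_add_nonpos hij v
  have := mul_pos hl one_add_sqrt_two_pos
  linarith

/-- In the triangle with index `i` the vector `v` lies in the closed sector `i`, so all other sector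
forms are nonpositive and only the side `i` can exclude the point. Conversely, a sector containing
`v` selects the triangle. -/
theorem mem_idealOctagon {z : UpperHalfPlane} :
    z ∈ idealOctagon ↔ ∀ j, 0 ≤ sideForm (rightAct z (nu j)⁻¹) := by
  obtain ⟨l, v, hl, hz⟩ := exists_gramForm_eq z
  have hz : HasNormalForm z l v := hz
  have hlc := mul_pos hl one_add_sqrt_two_pos
  rw [idealOctagon, Set.mem_iUnion]
  constructor
  · rintro ⟨i, hi⟩ j
    rw [mem_imageRight, (hz.nu i).mem_triangle] at hi
    rcases eq_or_ne i j with rfl | hij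
    · exact hi.2.2
    · rw [(hz.nu j).sideForm]
      have h1 := sectorForm_add_nonpos hij v
      obtain ⟨a1, a2, -⟩ := hi
      have h2 : 0 ≤ sectorForm ((Octagon.nu i).1.mulVec v) := by
        generalize (Octagon.nu i).1.mulVec v = u at a1 a2
        have r0 := sqrt_two_mul_self
        have r1 := sqrt_two_gt
        rw [sectorForm]
        by_contra hneg
        push Not at hneg
        have b2 : 0 < u 1 ^ 2 := by
          by_contra hh
          have : u 1 = 0 := by
            have := le_antisymm (not_lt.1 hh) (sq_nonneg _)
            exact pow_eq_zero_iff (by norm_num) |>.1 this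
          rw [this] at hneg
          simp at hneg
        -- The form $u_0^2-2u_0u_1-u_1^2$ factors as $(u_0-(1+\sqrt2)u_1)(u_0+(\sqrt2-1)u_1)$; both
        -- factors are multiplied by $u_1$ to make their signs visible.
        have b3 := mul_pos (show 0 < (1 + √2) * u 1 ^ 2 - u 0 * u 1 by linarith)
          (show 0 < u 0 * u 1 + (√2 - 1) * u 1 ^ 2 by nlinarith)
        have b4 := mul_nonneg (sub_nonneg.2 a2) b2.le
        have e : ((1 + √2) * u 1 ^ 2 - u 0 * u 1) * (u 0 * u 1 + (√2 - 1) * u 1 ^ 2) =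
            -((u 0 ^ 2 - (u 1 ^ 2 + 2 * u 0 * u 1)) * u 1 ^ 2) := by
          linear_combination u 1 ^ 4 * r0
        linarith
      linarith
  · intro H
    obtain ⟨j, hj⟩ := exists_inSector v
    refine ⟨j, ?_⟩
    rw [mem_imageRight, (hz.nu j).mem_triangle]
    have hq : 0 ≤ sectorForm ((Octagon.nu j).1.mulVec v) := by
      rw [sectorForm]
      rcases hj with h | h | h
      · exact le_of_lt h
      · rw [h, zero_mul]
      · rw [h, sub_self, mul_zero]
    have r0 := sqrt_two_mul_self
    have r1 := sqrt_two_gt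
    refine (fun h : _ ∧ _ => ⟨h.1, h.2, H j⟩) ?_
    generalize (Octagon.nu j).1.mulVec v = u at hq
    rw [sectorForm] at hq
    have h1 : 0 ≤ u 0 * u 1 := by nlinarith [sq_nonneg (u 1)]
    refine ⟨h1, ?_⟩
    rcases eq_or_ne (u 1) 0 with h0 | h0
    · rw [h0]; simpa using sq_nonneg (u 0)
    · have h2 : 0 < u 1 ^ 2 := by positivity
      have h3 := mul_nonneg hq (show 0 ≤ u 0 * u 1 + (√2 - 1) * u 1 ^ 2 by nlinarith)
      have e : u 1 * (u 0 - (1 + √2) * u 1) * (u 0 * u 1 + (√2 - 1) * u 1 ^ 2) =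
          u 1 ^ 2 * (u 0 ^ 2 - (u 1 ^ 2 + 2 * u 0 * u 1)) := by
        linear_combination -(u 1 ^ 4) * r0
      rw [e] at h3
      exact sub_nonneg.1 (nonneg_of_mul_nonneg_right h3 h2)

/-- In the coordinates `U`, `W` an isometry permutes the eight inequalities that define the octagon.
-/
theorem imageRight_idealOctagon_nu (i : Fin 8) : imageRight idealOctagon (nu i) = idealOctagon := by
  ext z
  obtain ⟨l, v, hl, hz⟩ := exists_gramForm_eq z
  have hz : HasNormalForm z l v := hz
  obtain ⟨U, hU⟩ : ∃ U, U = v 0 ^ 2 - v 1 ^ 2 := ⟨_, rfl⟩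
  obtain ⟨W, hW⟩ : ∃ W, W = 2 * v 0 * v 1 := ⟨_, rfl⟩
  obtain ⟨⟨h1, h2⟩, h3⟩ := nu_mulVec_sq i v hU hW
  have key : ∀ (x : ℝ) (u : Fin 2 → ℝ), 0 ≤ x - sectorForm u ↔ 2 * sectorForm u ≤ 2 * x := by
    intro x u
    constructor <;> intro <;> linarith
  rw [mem_imageRight, mem_idealOctagon, mem_idealOctagon]
  simp only [((hz.nu i).nu _).sideForm, (hz.nu _).sideForm, key, two_mul_sectorForm_nu _ _ hU hW,
    two_mul_sectorForm_nu _ _ h1.symm h2.symm, h3, Fin.forall_fin_succ, IsEmpty.forall_iff]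
  generalize (1 + √2) * (v 0 ^ 2 + v 1 ^ 2) = N
  generalize 2 * (l * (1 + √2)) = K
  clear key h1 h2 h3 hU hW
  generalize (1 + √2) = c
  fin_cases i <;> simp <;> constructor <;> rintro ⟨a1, a2, a3, a4, a5, a6, a7, a8⟩ <;>
    refine ⟨?_, ?_, ?_, ?_, ?_, ?_, ?_, ?_⟩ <;> assumption

theorem nuProd_det_sq (s : ℕ → Fin 8) (k : ℕ) : (nuProd s k).1.det ^ 2 = 1 := by
  induction k with
  | zero => simp [nuProd]
  | succ k ih => exact det_mul_sq ih (det_mul_sq (det_inv_sq (det_nu_sq _)) det_gam_sq)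

theorem nuProd_mem (s : ℕ → Fin 8) (k : ℕ) : nuProd s k ∈ veechGroup := by
  have hg : gam ∈ veechGroup := let ⟨Ψ, h, _⟩ := exists_gam_automorphism; ⟨Ψ, h⟩
  induction k with
  | zero => exact ⟨_, isAffineAutomorphism_refl⟩
  | succ k ih =>
    refine mem_veechGroup_mul ih (mem_veechGroup_mul (mem_veechGroup_inv ?_) hg)
    obtain ⟨Φ, h, -⟩ := exists_nu_automorphism (s k)
    exact ⟨Φ, h⟩

/-! ## The ray -/

/-- The flow scales the squared component along `θ` by $e^{-t}$ and the transverse one by $e^{t}$.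
The points of the ray thus have a normal form with vector parallel to `θ`. -/
theorem gramForm_ray (θ t : ℝ) (a b : Fin 2 → ℝ) : gramForm (ray θ t) a b =
    exp (-t) * (a ⬝ᵥ b + (exp (2 * t) - 1) *
      (cross ![cos θ, sin θ] a * cross ![cos θ, sin θ] b)) := by
  have hI : ∀ a b, gramForm UpperHalfPlane.I a b = a ⬝ᵥ b := by
    intro a b
    simp [gramForm, dotProduct, Fin.sum_univ_two]
  have hrot : ∀ φ a b, (rot φ).1.mulVec a ⬝ᵥ (rot φ).1.mulVec b = a ⬝ᵥ b := by
    intro φ a b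
    simp [rot, Matrix.GeneralLinearGroup.mkOfDetNeZero, Matrix.mulVec, dotProduct,
      Fin.sum_univ_two]
    linear_combination (a 0 * b 0 + a 1 * b 1) * sin_sq_add_cos_sq φ
  have hrotInv : ∀ φ a b, ((rot φ)⁻¹).1.mulVec a ⬝ᵥ ((rot φ)⁻¹).1.mulVec b = a ⬝ᵥ b := by
    intro φ a b
    rw [← hrot φ, mulVec_inv_mulVec, mulVec_inv_mulVec]
  have hteich : ∀ a b, (teich t).1.mulVec a ⬝ᵥ (teich t).1.mulVec b =
      exp (-t) * (exp (2 * t) * (a 0 * b 0) + a 1 * b 1) := by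
    intro a b
    have e1 : exp (t / 2) * exp (t / 2) = exp (-t) * exp (2 * t) := by
      rw [← exp_add, ← exp_add]; congr 1; ring
    have e2 : exp (-t / 2) * exp (-t / 2) = exp (-t) := by
      rw [← exp_add]; congr 1; ring
    simp [teich, Matrix.GeneralLinearGroup.mkOfDetNeZero, Matrix.mulVec, dotProduct,
      Fin.sum_univ_two]
    linear_combination a 0 * b 0 * e1 + a 1 * b 1 * e2
  have hdet : ((rot (π / 2 - θ))⁻¹ * teich t * rot (π / 2 - θ)).1.det = 1 := by
    have e1 : (teich t).1.det = 1 := by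
      show Matrix.det !![exp (t / 2), 0; 0, exp (-t / 2)] = 1
      rw [Matrix.det_fin_two_of, mul_zero, sub_zero, ← exp_add, neg_div, add_neg_cancel, exp_zero]
    rw [Units.val_mul, Units.val_mul, Matrix.det_mul, Matrix.det_mul, mul_right_comm,
      ← Matrix.det_mul, ← Units.val_mul, inv_mul_cancel, Units.val_one, Matrix.det_one, e1, one_mul]
  rw [ray, isometryClass, gramForm_rightAct, hdet, abs_one, div_one, hI, Units.val_mul,
    Units.val_mul, ← Matrix.mulVec_mulVec, ← Matrix.mulVec_mulVec, ← Matrix.mulVec_mulVec,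
    ← Matrix.mulVec_mulVec, hrotInv, hteich]
  simp [rot, Matrix.GeneralLinearGroup.mkOfDetNeZero, Matrix.mulVec, dotProduct,
    Fin.sum_univ_two, cross]
  rw [cos_pi_div_two_sub, sin_pi_div_two_sub]
  linear_combination (a 0 * b 0 + a 1 * b 1) * sin_sq_add_cos_sq θ

/-- In the parameter $e^{2t}-1$ the function is affine up to a positive factor. A ray starting on
its positive side can reach the geodesic only if `sectorForm` is positive at the direction seen
through `M`. -/
theorem sideForm_ray {M : GL (Fin 2) ℝ} (hM : M.1.det ^ 2 = 1) (θ t : ℝ) :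
    sideForm (rightAct (ray θ t) M) =
      exp (-t) * (M.1.mulVec ![1, 0] ⬝ᵥ M.1.mulVec ![1 + √2, 1] -
        (exp (2 * t) - 1) * sectorForm ((M⁻¹).1.mulVec ![cos θ, sin θ])) := by
  rw [sideForm, gramForm_rightAct, abs_det_eq_one hM, div_one, gramForm_ray]
  generalize ![cos θ, sin θ] = v
  obtain ⟨u, rfl⟩ : ∃ u, v = M.1.mulVec u := ⟨_, (mulVec_inv_mulVec _ _).symm⟩
  rw [inv_mulVec_mulVec, cross_mulVec, cross_mulVec, sectorForm]
  have e : M.1.det * cross u ![1, 0] * (M.1.det * cross u ![1 + √2, 1]) =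
      -(u 1 * (u 0 - (1 + √2) * u 1)) := by
    simp [cross]
    linear_combination (u 1 * (u 0 - (1 + √2) * u 1)) * hM
  rw [e]
  ring


/-! ## The normalized Teichmüller cutting sequence -/

theorem nu_zero : nu 0 = 1 := by
  ext i j
  fin_cases i <;> fin_cases j <;> rfl

theorem sectorForm_gam (v : Fin 2 → ℝ) : sectorForm (gam.1.mulVec v) = -sectorForm v := by
  rw [sectorForm, sectorForm, gam_mulVec_zero, gam_mulVec_one]
  ring

/-- The direction `θ`, seen from the `k`-th tile of the path `s`. -/
def tileDirection (θ : ℝ) (s : ℕ → Fin 8) (k : ℕ) : Fin 2 → ℝ :=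
  (nuProd s k)⁻¹.1.mulVec ![cos θ, sin θ]

theorem tileDirection_succ (θ : ℝ) (s : ℕ → Fin 8) (k : ℕ) : tileDirection θ s (k + 1) =
    gam.1.mulVec ((nu (s k)).1.mulVec (tileDirection θ s k)) := by
  rw [tileDirection, tileDirection, nuProd, mul_inv_rev, mul_inv_rev, inv_inv, inv_gam,
    Units.val_mul, Units.val_mul, Matrix.mulVec_mulVec, Matrix.mulVec_mulVec, Matrix.mul_assoc]

theorem exists_sideForm_tile (θ : ℝ) (s : ℕ → Fin 8) (k : ℕ) : ∃ a : Fin 8 → ℝ, ∀ j t,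
    sideForm (rightAct (rightAct (ray θ t) (nuProd s k)) (nu j)⁻¹) =
      exp (-t) * (a j - (exp (2 * t) - 1) *
        sectorForm ((nu j).1.mulVec (tileDirection θ s k))) := by
  refine ⟨fun j => (nuProd s k * (nu j)⁻¹).1.mulVec ![1, 0] ⬝ᵥ
    (nuProd s k * (nu j)⁻¹).1.mulVec ![1 + √2, 1], fun j t => ?_⟩
  rw [← rightAct_mul, sideForm_ray (det_mul_sq (nuProd_det_sq s k) (det_inv_sq (det_nu_sq j))),
    mul_inv_rev, inv_inv, Units.val_mul (nu j), ← Matrix.mulVec_mulVec]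
  rfl

theorem hasNormalForm_I : HasNormalForm UpperHalfPlane.I 1 0 := by
  intro a b
  simp [gramForm, dotProduct, Fin.sum_univ_two, cross]

theorem sideForm_I (j : Fin 8) : 0 < sideForm (rightAct UpperHalfPlane.I (nu j)⁻¹) := by
  rw [(hasNormalForm_I.nu j).sideForm, Matrix.mulVec_zero]
  simp [sectorForm, one_add_sqrt_two_pos]

theorem ray_zero (θ : ℝ) : ray θ 0 = UpperHalfPlane.I := by
  have h : teich 0 = 1 := by
    ext i j
    fin_cases i <;> fin_cases j <;> simp [teich, Matrix.GeneralLinearGroup.mkOfDetNeZero]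
  rw [ray, isometryClass, h, mul_one, inv_mul_cancel, rightAct_one]

/-- The adjacent tile beyond the side through which a tile is left differs from it. -/
theorem imageRight_idealOctagon_ne (M : GL (Fin 2) ℝ) (j : Fin 8) :
    imageRight idealOctagon (M * ((nu j)⁻¹ * gam))⁻¹ ≠ imageRight idealOctagon M⁻¹ := by
  intro h
  have h1 : rightAct UpperHalfPlane.I M⁻¹ ∈ imageRight idealOctagon M⁻¹ := by
    rw [rightAct_mem_imageRight, mem_idealOctagon]
    exact fun i => (sideForm_I i).le
  rw [← h, mem_imageRight, inv_inv, rightAct_mul, rightAct_rightAct_inv, rightAct_mul,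
    mem_idealOctagon] at h1
  have h2 := h1 0
  rw [nu_zero, inv_one, rightAct_one, sideForm_gam] at h2
  linarith [sideForm_I j]

theorem imageRight_idealSide (j : Fin 8) :
    imageRight (idealSide j) ((nu j)⁻¹ * gam) = idealSide 0 := by
  ext z
  rw [mem_imageRight, mem_idealSide, mem_idealSide, mul_inv_rev, inv_inv, rightAct_mul,
    rightAct_inv_rightAct, inv_gam, nu_zero, inv_one, rightAct_one, sideForm_gam, neg_eq_zero]

theorem exp_two_mul_half_log {x : ℝ} (hx : 0 ≤ x) : exp (2 * (log (1 + x) / 2)) - 1 = x := by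
  rw [mul_div_cancel₀ _ (two_ne_zero), exp_log (by linarith)]
  ring

/-- A path which leaves every tile through the side at which the ray points is the
cutting sequence of the ray. -/
theorem isNormalizedTeichCuttingSequence_of_inSector {θ : ℝ} {s : ℕ → Fin 8}
    (H : ∀ k, InSector ((nu (s k)).1.mulVec (tileDirection θ s k))) :
    IsNormalizedTeichCuttingSequence θ s := by
  choose a ha using exists_sideForm_tile θ s
  obtain ⟨q, hq⟩ : ∃ q : ℕ → Fin 8 → ℝ, ∀ k j,
      q k j = sectorForm ((nu j).1.mulVec (tileDirection θ s k)) := ⟨_, fun _ _ => rfl⟩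
  simp only [← hq] at ha
  have hpos : ∀ k, 0 < q k (s k) := fun k => by rw [hq]; exact H k
  have hneg : ∀ k j, j ≠ s k → q k j < 0 := fun k j hj => by
    have := sectorForm_add_nonpos hj (tileDirection θ s k)
    rw [← hq, ← hq] at this
    linarith [hpos k]
  -- `E k` is the value of $e^{2t}-1$ on entering tile `k`. Since the side functions are affine in
  -- this parameter, the exit value is an explicit quotient.
  obtain ⟨E, hE0, hE⟩ : ∃ E : ℕ → ℝ, E 0 = 0 ∧ ∀ k, E (k + 1) = a k (s k) / q k (s k) :=
    ⟨fun k => Nat.casesOn k 0 fun k => a k (s k) / q k (s k), rfl, fun _ => rfl⟩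
  have hE' : ∀ k, a k (s k) - E (k + 1) * q k (s k) = 0 := fun k => by
    rw [hE, div_mul_cancel₀ _ (hpos k).ne', sub_self]
  have inv : ∀ k, 0 ≤ E k ∧ (∀ j, 0 ≤ a k j - E k * q k j) ∧ 0 < a k (s k) - E k * q k (s k) := by
    intro k
    induction k with
    | zero =>
      have h0 : ∀ j, 0 < a 0 j := fun j => by
        have h1 := ha 0 j 0
        rw [ray_zero, nuProd, rightAct_one] at h1
        have h2 := sideForm_I j
        rw [h1] at h2
        simpa using h2
      rw [hE0]
      exact ⟨le_rfl, fun j => by simpa using (h0 j).le, by simpa using h0 (s 0)⟩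
    | succ k ih =>
      obtain ⟨i1, i2, i3⟩ := ih
      have hlt : E k < E (k + 1) := by
        have := hE' k
        by_contra hle
        have := mul_le_mul_of_nonneg_right (not_lt.1 hle) (hpos k).le
        linarith
      have h0 : 0 ≤ E (k + 1) := i1.trans hlt.le
      have hexp := exp_two_mul_half_log h0
      set t := log (1 + E (k + 1)) / 2
      have h1 := ha k (s k) t
      rw [hexp, hE', mul_zero] at h1
      -- The exit point lies on the mirror of $\gamma$, so it has the same coordinates before and
      -- after the reflection into the next tile.
      have h2 : rightAct (ray θ t) (nuProd s (k + 1)) =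
          rightAct (rightAct (ray θ t) (nuProd s k)) (nu (s k))⁻¹ := by
        rw [nuProd, rightAct_mul, rightAct_mul]
        exact rightAct_gam_eq_iff.2 h1
      have h3 : ∀ j, j ≠ 0 → 0 < a (k + 1) j - E (k + 1) * q (k + 1) j := by
        intro j hj
        have h4 := sideForm_pos_of_ne (z := rightAct (ray θ t) (nuProd s (k + 1))) hj.symm
          (by rw [nu_zero, inv_one, rightAct_one, h2, h1])
        rw [ha, hexp] at h4
        exact (mul_pos_iff_of_pos_left (exp_pos _)).1 h4
      have h5 : a (k + 1) 0 - E (k + 1) * q (k + 1) 0 = 0 := by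
        have h4 := ha (k + 1) 0 t
        rw [nu_zero, inv_one, rightAct_one, h2, h1, hexp] at h4
        exact (mul_eq_zero.1 h4.symm).resolve_left (exp_ne_zero _)
      refine ⟨h0, fun j => ?_, h3 _ ?_⟩
      · rcases eq_or_ne j 0 with rfl | hj
        · exact h5.ge
        · exact (h3 j hj).le
      · intro h
        -- The entry side cannot be the exit side: $\gamma$ changes the sign of the sector form, so
        -- the form of the side `0` is now negative.
        have h6 := hpos (k + 1)
        rw [h, hq, nu_zero, Units.val_one, Matrix.one_mulVec, tileDirection_succ,
          sectorForm_gam] at h6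
        have h7 := hpos k
        rw [hq] at h7
        linarith
  have hlt : ∀ k, E k < E (k + 1) := fun k => by
    have h1 := hE' k
    have h2 := (inv k).2.2
    by_contra hle
    have := mul_le_mul_of_nonneg_right (not_lt.1 hle) (hpos k).le
    linarith
  have hexp := fun k => exp_two_mul_half_log (inv k).1
  refine ⟨fun k => log (1 + E k) / 2, fun k => imageRight idealOctagon (nuProd s k)⁻¹,
    fun k => imageRight (idealSide (s k)) (nuProd s k)⁻¹, nuProd s, by simp [hE0],
    strictMono_nat_of_lt_succ fun k => ?_, fun k r hr => ?_, fun k => ?_,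
    fun k => imageRight_idealOctagon_ne _ _, fun k => ⟨nuProd_mem s k, ?_, ?_⟩, rfl, fun k => ?_⟩
  · have := log_lt_log (by linarith [(inv k).1]) (show 1 + E k < 1 + E (k + 1) by linarith [hlt k])
    linarith
  · rw [mem_imageRight, inv_inv, mem_idealOctagon]
    intro j
    rw [ha]
    refine mul_nonneg (exp_pos _).le ?_
    have h1 : E k ≤ exp (2 * r) - 1 := by
      rw [← hexp k]
      have := exp_le_exp.2 (show 2 * (log (1 + E k) / 2) ≤ 2 * r by linarith [hr.1])
      linarith
    have h2 : exp (2 * r) - 1 ≤ E (k + 1) := by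
      rw [← hexp (k + 1)]
      have := exp_le_exp.2 (show 2 * r ≤ 2 * (log (1 + E (k + 1)) / 2) by linarith [hr.2])
      linarith
    rcases eq_or_ne j (s k) with rfl | hj
    · have := mul_le_mul_of_nonneg_right h2 (hpos k).le
      linarith [hE' k]
    · have := mul_le_mul_of_nonpos_right h1 (hneg k j hj).le
      linarith [(inv k).2.1 j]
  · rw [mem_imageRight, inv_inv, mem_idealSide, ha, hexp, hE', mul_zero]
  · rw [← imageRight_mul, inv_mul_cancel, imageRight_one]
  · rw [← imageRight_mul, inv_mul_cancel, imageRight_one]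
  · rw [← imageRight_mul, nuProd, inv_mul_cancel_left, imageRight_idealSide]

/-- The direction seen from tile `k` involves only the earlier indices, so the path is built
recursively; the auxiliary sequence `M` carries the product of the matrices. -/
theorem exists_inSector_path {θ : ℝ}
    (H : ∀ M ∈ veechGroup, ∃ d, InSector ((nu d).1.mulVec ((M⁻¹).1.mulVec ![cos θ, sin θ]))) :
    ∃ s : ℕ → Fin 8, ∀ k, InSector ((nu (s k)).1.mulVec (tileDirection θ s k)) := by
  choose! d hd using H
  let M : ℕ → GL (Fin 2) ℝ := fun k => Nat.rec 1 (fun _ N => N * ((nu (d N))⁻¹ * gam)) k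
  have hM : ∀ k, nuProd (fun k => d (M k)) k = M k := by
    intro k
    induction k with
    | zero => rfl
    | succ k ih => rw [nuProd, ih]
  refine ⟨fun k => d (M k), fun k => ?_⟩
  rw [tileDirection, hM]
  refine hd _ ?_
  rw [← hM]
  exact nuProd_mem _ _

theorem gramForm_mk {x y : ℝ} (hy : 0 < y) (a b : Fin 2 → ℝ) :
    gramForm ⟨⟨x, y⟩, hy⟩ a b =
      ((x ^ 2 + y ^ 2) * (a 0 * b 0) + x * (a 0 * b 1 + a 1 * b 0) + a 1 * b 1) / y := rfl

/-- The stabilizer in the Veech group of a side of the ideal octagon tessellation. -/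
theorem eq_of_imageRight_idealSide {M : GL (Fin 2) ℝ} (hM : M ∈ veechGroup)
    (h : imageRight (idealSide 0) M = idealSide 0) : M = 1 ∨ M = -1 ∨ M = gam ∨ M = -gam := by
  obtain ⟨c, hc⟩ : ∃ c, c = 1 + √2 := ⟨_, rfl⟩
  have hc0 : 0 < c := hc ▸ one_add_sqrt_two_pos
  have side : ∀ z, z ∈ idealSide 0 ↔ gramForm z ![1, 0] ![c, 1] = 0 := fun z => by
    rw [mem_idealSide, nu_zero, inv_one, rightAct_one, hc]
    rfl
  obtain ⟨P, hP⟩ : ∃ P, P = M.1.mulVec ![1, 0] := ⟨_, rfl⟩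
  obtain ⟨Q, hQ⟩ : ∃ Q, Q = M.1.mulVec ![c, 1] := ⟨_, rfl⟩
  have key : ∀ z, gramForm z ![1, 0] ![c, 1] = 0 → gramForm z P Q = 0 := by
    intro z hz
    have h1 := (rightAct_mem_imageRight (M := M)).2 ((side z).2 hz)
    rw [h, side, gramForm_rightAct, ← hP, ← hQ] at h1
    exact (div_eq_zero_iff.1 h1).resolve_right (abs_ne_zero.2 M.det.ne_zero)
  have key' : ∀ x y : ℝ, 0 < y → (x ^ 2 + y ^ 2) * c + x = 0 →
      (x ^ 2 + y ^ 2) * (P 0 * Q 0) + x * (P 0 * Q 1 + P 1 * Q 0) + P 1 * Q 1 = 0 := by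
    intro x y hy hxy
    have h1 := key ⟨⟨x, y⟩, hy⟩ (by rw [gramForm_mk]; simp [hxy])
    rw [gramForm_mk] at h1
    exact (div_eq_zero_iff.1 h1).resolve_right hy.ne'
  -- Two points of the geodesic, the first being the top of the semicircle. Their equations force
  -- one of `P`, `Q` to be horizontal and one to be diagonal; the exchange of the two lines is
  -- excluded at the end.
  have k1 := key' (-1 / (2 * c)) (1 / (2 * c)) (by positivity) (by field_simp; norm_num)
  have k2 := key' (-4 / (5 * c)) (2 / (5 * c)) (by positivity) (by field_simp; norm_num)
  field_simp at k1 k2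
  have e1 : (P 0 - c * P 1) * (Q 0 - c * Q 1) = 0 := by linarith
  have e2 : P 1 * Q 1 = 0 := by
    have : c ^ 2 * (P 1 * Q 1) = 0 := by linarith
    exact (mul_eq_zero.1 this).resolve_left (by positivity)
  have hinj : ∀ u, M.1.mulVec u = 0 → u = 0 := fun u hu => by
    rw [← inv_mulVec_mulVec M u, hu, Matrix.mulVec_zero]
  have hP0 : P ≠ 0 := fun h0 => by
    have := congrFun (hinj _ (hP.symm.trans h0)) 0
    simp at this
  have hQ0 : Q ≠ 0 := fun h0 => by
    have := congrFun (hinj _ (hQ.symm.trans h0)) 1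
    simp at this
  have hor : ∀ R : Fin 2 → ℝ, R 1 = 0 → R = R 0 • ![1, 0] := fun R h1 =>
    ext_fin_two (by simp) (by simp [h1])
  have dia : ∀ R : Fin 2 → ℝ, R 0 - c * R 1 = 0 → R = R 1 • ![c, 1] := fun R h1 =>
    ext_fin_two (by simp; linarith) (by simp)
  have nz : ∀ {R u : Fin 2 → ℝ} {l : ℝ}, R ≠ 0 → R = l • u → l ≠ 0 := by
    rintro R u l hR h rfl
    exact hR (by rw [h, zero_smul])
  rcases mul_eq_zero.1 e2 with hP1 | hQ1
  · have hPe := hor P hP1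
    have hQe := dia Q ((mul_eq_zero.1 e1).resolve_left fun h0 => by
      rw [hP1, mul_zero, sub_zero] at h0
      exact hP0 (ext_fin_two h0 hP1))
    obtain ⟨a, ha, ha0⟩ : ∃ a, M.1.mulVec ![1, 0] = a • ![1, 0] ∧ a ≠ 0 :=
      ⟨_, hP.symm.trans hPe, nz hP0 hPe⟩
    obtain ⟨b, hb, hb0⟩ : ∃ b, M.1.mulVec ![1 + √2, 1] = b • ![1 + √2, 1] ∧ b ≠ 0 :=
      ⟨_, hc ▸ hQ.symm.trans hQe, nz hQ0 hQe⟩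
    have hMe := eq_of_mulVec ha hb
    rcases multiplier_horizontal hM ha0 ha with rfl | rfl <;>
      rcases multiplier_diagonal hM hb0 hb with rfl | rfl
    · refine .inl (Units.ext (hMe.trans ?_))
      ext i j
      fin_cases i <;> fin_cases j <;> simp
    · refine .inr (.inr (.inr (Units.ext (hMe.trans ?_))))
      rw [Units.val_neg]
      show _ = -!![-1, 2 * (1 + √2); 0, 1]
      ext i j
      fin_cases i <;> fin_cases j <;> simp
      norm_num
    · refine .inr (.inr (.inl (Units.ext (hMe.trans ?_))))
      show _ = !![-1, 2 * (1 + √2); 0, 1]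
      ext i j
      fin_cases i <;> fin_cases j <;> simp
      norm_num
    · refine .inr (.inl (Units.ext (hMe.trans ?_)))
      rw [Units.val_neg, Units.val_one]
      ext i j
      fin_cases i <;> fin_cases j <;> simp
  · exfalso
    have hQe := hor Q hQ1
    exact mulVec_diagonal_ne_horizontal hM (nz hQ0 hQe) (by rw [← hc, ← hQ]; exact hQe)

/-- The ray leaves every tile through the side at which it points. -/
theorem IsNormalizedTeichCuttingSequence.inSector {θ : ℝ} {s : ℕ → Fin 8}
    (hs : IsNormalizedTeichCuttingSequence θ s)
    (H : ∀ M ∈ veechGroup, ∃ d, InSector ((nu d).1.mulVec ((M⁻¹).1.mulVec ![cos θ, sin θ])))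
    (k : ℕ) : InSector ((nu (s k)).1.mulVec (tileDirection θ s k)) := by
  obtain ⟨t, T, exit, μ, ht0, ht, hT, hexit, hne, hμ, hμ0, hside⟩ := hs
  have tile : ∀ k, (μ k = nuProd s k ∨ μ k = -nuProd s k) →
      T k = imageRight idealOctagon (nuProd s k)⁻¹ ∧
      exit k = imageRight (idealSide (s k)) (nuProd s k)⁻¹ := by
    intro k hk
    obtain ⟨-, h1, h2⟩ := hμ k
    rcases hk with hk | hk <;> rw [hk] at h1 h2
    · exact ⟨imageRight_eq_iff.1 h1, imageRight_eq_iff.1 h2⟩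
    · rw [imageRight_neg] at h1 h2
      exact ⟨imageRight_eq_iff.1 h1, imageRight_eq_iff.1 h2⟩
  have main : ∀ k, μ k = nuProd s k ∨ μ k = -nuProd s k := by
    intro k
    induction k with
    | zero => exact .inl hμ0
    | succ k ih =>
      obtain ⟨hTk, hek⟩ := tile k ih
      have h1 := hside k
      rw [hek, imageRight_eq_iff.1 (imageRight_idealSide (s k)), ← imageRight_mul,
        ← imageRight_mul, ← mul_assoc, ← mul_inv_rev, ← nuProd] at h1
      have hu : μ (k + 1) = nuProd s (k + 1) * ((nuProd s (k + 1))⁻¹ * μ (k + 1)) := by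
        rw [mul_inv_cancel_left]
      have hγ : nuProd s (k + 1) * gam = nuProd s k * (nu (s k))⁻¹ := by
        rw [nuProd, mul_assoc, mul_assoc, gam_mul_self, mul_one]
      -- With $\pm\gamma$ from the stabilizer the next tile would equal the present one.
      have hex : imageRight (T (k + 1)) (nuProd s k * (nu (s k))⁻¹) ≠ idealOctagon := by
        intro h2
        apply hne k
        rw [imageRight_eq_iff.1 h2, hTk, mul_inv_rev, inv_inv, imageRight_mul,
          imageRight_idealOctagon_nu]
      have h3 := (hμ (k + 1)).2.1
      rcases eq_of_imageRight_idealSide (mem_veechGroup_mul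
        (mem_veechGroup_inv (nuProd_mem s (k + 1))) (hμ (k + 1)).1) h1 with h2 | h2 | h2 | h2 <;>
        rw [h2] at hu
      · exact .inl (hu.trans (mul_one _))
      · exact .inr (hu.trans (by rw [mul_neg, mul_one]))
      · rw [hu, hγ] at h3
        exact absurd h3 hex
      · rw [hu, mul_neg, hγ, imageRight_neg] at h3
        exact absurd h3 hex
  obtain ⟨hTk, hek⟩ := tile k (main k)
  -- The direction is interior to some sector, so if it is not interior to the sector `s k` the form
  -- of that sector is strictly negative. The function of the exit side then increases from a
  -- nonnegative value and cannot vanish at the exit time.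
  obtain ⟨d, hd⟩ := H _ (nuProd_mem s k)
  have hd : 0 < sectorForm ((nu d).1.mulVec (tileDirection θ s k)) := hd
  by_contra hsk
  have hneg : sectorForm ((nu (s k)).1.mulVec (tileDirection θ s k)) < 0 := by
    rcases eq_or_ne d (s k) with h | h
    · exact absurd (h ▸ hd) hsk
    · have := sectorForm_add_nonpos h (tileDirection θ s k)
      linarith
  obtain ⟨a, ha⟩ := exists_sideForm_tile θ s k
  have hlt := ht (Nat.lt_succ_self k)
  have h1 := hT k (t k) ⟨le_rfl, hlt.le⟩
  rw [hTk, mem_imageRight, inv_inv, mem_idealOctagon] at h1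
  have h2 := h1 (s k)
  rw [ha] at h2
  have h3 := hexit k
  rw [hek, mem_imageRight, inv_inv, mem_idealSide, ha] at h3
  have h4 := nonneg_of_mul_nonneg_right h2 (exp_pos _)
  have h5 := (mul_eq_zero.1 h3).resolve_left (exp_ne_zero _)
  have h6 := exp_lt_exp.2 (show 2 * t k < 2 * t (k + 1) from by linarith)
  have h7 := mul_lt_mul_of_neg_right (sub_lt_sub_right h6 1) hneg
  linarith


/-! ## Renormalization of trajectories -/

/-- One step of the renormalization of an aperiodic trajectory, coded with respect to the image of
the octagon under an affine automorphism of derivative `M`. -/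
theorem IsTraj.renormalization_step {v : Fin 2 → ℝ} {τ : ℝ → Surface} (h : IsTraj v τ)
    (hper : ¬ IsPeriodicTraj τ) {Ψ : Surface ≃ₜ Surface} {M : GL (Fin 2) ℝ}
    (hΨ : IsAffineAutomorphism Ψ M) {d : Fin 8}
    (hd : InSector ((nu d).1.mulVec ((M⁻¹).1.mulVec v))) :
    ∃ Ψ' : Surface ≃ₜ Surface, IsAffineAutomorphism Ψ' (M * ((nu d)⁻¹ * gam)) ∧
      ∀ u, IsCuttingSequenceWrt Ψ τ u → Admissible d u ∧ (∀ e, Admissible e u → e = d) ∧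
        (∃ u', IsDerived (fun n => perm d (u n)) u') ∧
        ∀ u', IsDerived (fun n => perm d (u n)) u' → IsCuttingSequenceWrt Ψ' τ u' := by
  obtain ⟨Φ, hΦ, hl⟩ := exists_nu_automorphism d
  obtain ⟨Γ, hΓ, -⟩ := exists_gam_automorphism
  have h1 := hΨ.symm.isTraj h
  have h2 := hΦ.isTraj h1
  have hper2 : ¬ IsPeriodicTraj fun s => Φ (Ψ.symm (τ s)) := fun h' =>
    hper ((h'.of_comp Φ).of_comp Ψ.symm)
  refine ⟨(Γ.trans Φ.symm).trans Ψ, hΨ.comp (hΦ.symm.comp hΓ), fun u hu => ?_⟩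
  have hu1 : IsCuttingSequence (fun s => Ψ.symm (τ s)) u := isCuttingSequenceWrt_comp.2 hu
  have hu2 := isCuttingSequence_comp (isOctagonSymmetry_nu d).2.1.2 hl h1.1 hu1
  have adm : Admissible d u := h2.edge₀ hd hu2
  refine ⟨adm, fun e he => admissible_unique ?_ adm he (h2.exists_loop hd hu2 hper2),
    exists_isDerived adm, fun u' hu' => ?_⟩
  · rintro ⟨p, hp, hpu⟩
    exact hper2 (h2.isPeriodicTraj_of_isPeriodic hd hu2 ⟨p, hp, fun n => congrArg (perm d) (hpu n)⟩)
  · have h3 := h2.isCuttingSequenceWrt_gam hd hu2 hu' hΓ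
    exact isCuttingSequenceWrt_comp (Φ := Ψ.symm).1 (isCuttingSequenceWrt_comp.1 h3)

theorem IsTraj.exists_isRenormalized {θ : ℝ} {τ : ℝ → Surface} (h : IsTraj ![cos θ, sin θ] τ)
    (hper : ¬ IsPeriodicTraj τ) {w : Word} (hw : IsCuttingSequence τ w) {s : ℕ → Fin 8}
    (hs : ∀ k, InSector ((nu (s k)).1.mulVec (tileDirection θ s k))) (k : ℕ) :
    (∃ u, IsRenormalized w k u) ∧ ∃ Ψ : Surface ≃ₜ Surface, IsAffineAutomorphism Ψ (nuProd s k) ∧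
      ∀ u, IsRenormalized w k u → IsCuttingSequenceWrt Ψ τ u := by
  induction k with
  | zero =>
    refine ⟨⟨w, .zero⟩, Homeomorph.refl _, isAffineAutomorphism_refl, fun u hu => ?_⟩
    cases hu
    exact hw
  | succ k ih =>
    obtain ⟨⟨u, hu⟩, Ψ, hΨ, hcut⟩ := ih
    obtain ⟨Ψ', hΨ', H⟩ := h.renormalization_step hper hΨ (hs k)
    refine ⟨?_, Ψ', hΨ', fun u' hu' => ?_⟩
    · obtain ⟨h1, h2, ⟨u', h3⟩, -⟩ := H u (hcut u hu)
      exact ⟨u', hu.succ h1 h2 h3⟩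
    · cases hu' with
      | succ hu hd hu1 hder =>
        obtain ⟨h1, -, -, h4⟩ := H _ (hcut _ hu)
        -- Uniqueness of the diagram identifies the index of the combinatorial step with the index
        -- `s k` of the exit side.
        rw [← hu1 _ h1] at hder
        exact h4 _ hder

end Octagon

end

theorem proposition3p3 (θ : ℝ) (τ : ℝ → Octagon.Surface) (hτ : Octagon.IsTrajectory θ τ)
    (w : Octagon.Word) (hw : Octagon.IsCuttingSequence τ w) (hper : ¬ Octagon.IsPeriodic w) :
    (∃ s : ℕ → Fin 8, Octagon.IsNormalizedTeichCuttingSequence θ s) ∧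
    ∀ s : ℕ → Fin 8, Octagon.IsNormalizedTeichCuttingSequence θ s → ∀ k : ℕ,
      (∃ u, Octagon.IsRenormalized w k u) ∧
      ∃ Ψ : Octagon.Surface ≃ₜ Octagon.Surface,
        Octagon.IsAffineAutomorphism Ψ (Octagon.nuProd s k) ∧
        (∀ Ψ', Octagon.IsAffineAutomorphism Ψ' (Octagon.nuProd s k) → Ψ' = Ψ) ∧
        ∀ u, Octagon.IsRenormalized w k u → Octagon.IsCuttingSequenceWrt Ψ τ u := by
  have h := hτ.isTraj
  have hnp : ¬ Octagon.IsPeriodicTraj τ := fun h' => hper (hw.isPeriodic h.1 h')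
  -- The inverse of an automorphism takes `τ` to another aperiodic trajectory, whose direction is
  -- interior to a sector.
  have H : ∀ M ∈ Octagon.veechGroup,
      ∃ d, Octagon.InSector ((Octagon.nu d).1.mulVec ((M⁻¹).1.mulVec ![cos θ, sin θ])) := by
    rintro M ⟨Ψ, hΨ⟩
    exact (hΨ.symm.isTraj h).exists_inSector fun h' => hnp (h'.of_comp Ψ.symm)
  obtain ⟨s, hs⟩ := Octagon.exists_inSector_path H
  refine ⟨⟨s, Octagon.isNormalizedTeichCuttingSequence_of_inSector hs⟩, fun s hs k => ?_⟩
  obtain ⟨h1, Ψ, hΨ, h2⟩ := h.exists_isRenormalized hnp hw (hs.inSector H) k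
  exact ⟨h1, Ψ, hΨ, fun Ψ' hΨ' => hΨ.unique hΨ', h2⟩
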